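/- Let $\mathfrak g=\mathfrak g_{-3}\oplus\mathfrak g_{-2}\oplus\mathfrak g_{-1}$ be the $5$-dimensional graded nilpotent real Lie algebra with graded basis $X_1,X_2\in\mathfrak g_{-1}$, $X_3=[X_1,X_2]\in\mathfrak g_{-2}$, $X_4=[X_1,X_3],\ X_5=[X_2,X_3]\in\mathfrak g_{-3}$ (all other brackets of basis vectors vanish). Let $D_q\in\mathcal U(\mathfrak g)\otimes L(H^q(\mathfrak g),H^{q+1}(\mathfrak g))$, $q=0,\dots,4$, be the Rumin differentials, where $H^q(\mathfrak g)=H^q(\mathfrak g;\mathbb C)$, on which the grading automorphism acts by $t^{N_q}$ with $(N_0,\dots,N_5)=(0,1,4,6,9,10)$. That is, for a representation $\rho$ of $\mathfrak g$ on $V$, $\rho(D_q)$ maps the class of a $\partial$-closed $\sigma\in V\otimes\Lambda^q\mathfrak g^*$ of weight $N_q$ to the class of the weight $N_{q+1}$ part of $d\omega$, where $\partial$ is the Chevalley–Eilenberg differential with trivial coefficients, $d$ the one with coefficients in $V$, and $\omega\in V\otimes\Lambda^q\mathfrak g^*$ is any form such that $\omega-\sigma$ has only components of weight $>N_q$ and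 $d\omega$ has only components of weight $\ge N_{q+1}$. Let $g=g_{-3}\oplus g_{-2}\oplus g_{-1}$ be a graded Euclidean inner product on $\mathfrak g$, let $b_g$ be the Euclidean inner product on $\mathfrak g_{-1}$ with $$g_{-3}([X,Z],[Y,Z])=g_{-2}(Z,Z)\,b_g(X,Y),\qquad X,Y\in\mathfrak g_{-1},\ Z\in\mathfrak g_{-2},$$ and assume that $b_g$ is proportional to $g_{-1}$. Let $h_g$ be the Hermitian inner product on $H^*(\mathfrak g)$ obtained by restricting the inner product on $\Lambda^*\mathfrak g^*\otimes\mathbb C$ induced by $g$ to harmonic forms, $H^q(\mathfrak g)\cong\ker\partial\cap(\operatorname{im}\partial)^\perp$. For $0\ne\hbar\in\mathbb R$ let $\rho_\hbar$ be the Schrödinger representation on $L^2(\mathbb R,d\theta)$, with smooth vectors $\mathcal S(\mathbb R)$, $$\rho_\hbar(X_1)=\sqrt{|\hbar|}\,\partial_\theta,\quad \rho_\hbar(X_2)=\mathbf i\,\mathrm{sgn}(\hbar)\sqrt{|\hbar|}\,\theta,\quad \rho_\hbar(X_3)=\mathbf i\hbar,\quad \rho_\hbar(X_4)=\rho_\hbar(X_5)=0.$$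 Let $\rho_\hbar(D_q)^*$ denote the formal adjoint of $\rho_\hbar(D_q)$ with respect to $h_g$ and the $L^2$ inner product, and put $|\rho_\hbar(D_q)|=\sqrt{\rho_\hbar(D_q)^*\rho_\hbar(D_q)}$. Then, for each $q=0,\dots,4$, the nonzero spectrum of $\rho_\hbar(D_q)^*\rho_\hbar(D_q)$ consists of positive eigenvalues $\lambda_i$ (listed with multiplicities) whose eigenvectors are smooth; the zeta function $\zeta_q(s)=\sum_i\lambda_i^{-s/2}$ converges for $\operatorname{Re}s$ sufficiently large and extends to a meromorphic function on $\mathbb C$ which is holomorphic at $s=0$; and the zeta regularized determinants $\det{}'|\rho_\hbar(D_q)|:=\exp(-\zeta_q'(0))$ are $$\det{}'|\rho_\hbar(D_4)|=\det{}'|\rho_\hbar(D_0)|=2^{1/4},$$ $$\det{}'|\rho_\hbar(D_3)|=\det{}'|\rho_\hbar(D_1)|=2^{3/4}\,\sin^{1/2}\!\Bigl(\pi\cdot\tfrac{\sqrt2-1}2\Bigr),$$ $$\det{}'|\rho_\hbar(D_2)|=2\,\sin\!\Bigl(\pi\cdot\tfrac{\sqrt2-1}2\Bigr).$$ In particular,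 the torsion is trivial: $$\tau_{h_g}(\rho_\hbar(D)):=\frac{\det'|\rho_\hbar(D_0)|\cdot\det'|\rho_\hbar(D_2)|\cdot\det'|\rho_\hbar(D_4)|}{\det'|\rho_\hbar(D_1)|\cdot\det'|\rho_\hbar(D_3)|}=1.$$ Moreover, if $X_1,\dots,X_5$ is orthonormal with respect to $g$, then the nonzero eigenvalues, listed with multiplicities, are $|\hbar|^3(2n+1)\,\bigl|(2n+1)^2-2\bigr|$, $n=0,1,2,\dots$, for $\rho_\hbar(D_1)^*\rho_\hbar(D_1)$, and $\hbar^2\Bigl(\tfrac{\sqrt{8(2n+1)^2+9}\pm5}4\Bigr)^2$, $n=0,1,2,\dots$, for $\rho_\hbar(D_2)^*\rho_\hbar(D_2)$. -/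

import Mathlib

noncomputable section

open scoped SchwartzMap ComplexConjugate

/-! ### The graded Lie algebra -/

/-- The 5-dimensional graded nilpotent real Lie algebra with growth vector `(2,3,5)`. Elements are
coordinate vectors `x 0, …, x 4` with respect to the graded basis `X₁, …, X₅`
(so `X₁, …, X₅` are `Lie235.X 0, …, Lie235.X 4`), and the only nontrivial brackets of basis
vectors are `[X₁,X₂] = X₃`, `[X₁,X₃] = X₄`, `[X₂,X₃] = X₅`. -/
def Lie235 : Type := Fin 5 → ℝ

namespace Lie235

instance : AddCommGroup Lie235 := inferInstanceAs (AddCommGroup (Fin 5 → ℝ))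

instance : Module ℝ Lie235 := inferInstanceAs (Module ℝ (Fin 5 → ℝ))

instance : Bracket Lie235 Lie235 where
  bracket x y := ![0, 0, x 0 * y 1 - x 1 * y 0, x 0 * y 2 - x 2 * y 0, x 1 * y 2 - x 2 * y 1]

theorem bracket_apply (x y : Lie235) (i : Fin 5) :
    ⁅x, y⁆ i =
      (![0, 0, x 0 * y 1 - x 1 * y 0, x 0 * y 2 - x 2 * y 0, x 1 * y 2 - x 2 * y 1] :
        Fin 5 → ℝ) i := rfl

theorem add_apply (x y : Lie235) (i : Fin 5) : (x + y) i = x i + y i := rfl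

theorem smul_apply (c : ℝ) (x : Lie235) (i : Fin 5) : (c • x) i = c * x i := rfl

theorem zero_apply (i : Fin 5) : (0 : Lie235) i = 0 := rfl

instance : LieRing Lie235 where
  add_lie x y z := by
    funext i
    fin_cases i <;> simp [bracket_apply, add_apply] <;> ring
  lie_add x y z := by
    funext i
    fin_cases i <;> simp [bracket_apply, add_apply] <;> ring
  lie_self x := by
    funext i
    fin_cases i <;> simp [bracket_apply, zero_apply, mul_comm]
  leibniz_lie x y z := by
    funext i
    fin_cases i <;> simp [bracket_apply, add_apply] <;> ring

instance : LieAlgebra ℝ Lie235 where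
  lie_smul c x y := by
    funext i
    fin_cases i <;> simp [bracket_apply, smul_apply] <;> ring

/-- The graded basis `X₁, …, X₅`. -/
def X (i : Fin 5) : Lie235 := (Pi.single i 1 : Fin 5 → ℝ)

theorem X_apply (i j : Fin 5) : X i j = if j = i then 1 else 0 := by
  simp only [X, Pi.single_apply]

/-- The (absolute) degree of the basis vectors: `X₁, X₂` span `𝔤₋₁`, `X₃` spans `𝔤₋₂`, and
`X₄, X₅` span `𝔤₋₃`. -/
def wt : Fin 5 → ℕ := ![1, 1, 2, 3, 3]

/-- The graded component `𝔤₋ⱼ`. -/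
def gr (j : ℕ) : Submodule ℝ Lie235 where
  carrier := {x | ∀ i, wt i ≠ j → x i = 0}
  add_mem' := by
    intro x y hx hy i hi
    rw [add_apply, hx i hi, hy i hi, add_zero]
  zero_mem' := fun i _ => zero_apply i
  smul_mem' := by
    intro c x hx i hi
    rw [smul_apply, hx i hi, mul_zero]

end Lie235

open Lie235

/-- `g = g₋₃ ⊕ g₋₂ ⊕ g₋₁` is a graded Euclidean inner product on `𝔤`. -/
structure IsGradedEuclidean (g : LinearMap.BilinForm ℝ Lie235) : Prop where
  symm : ∀ x y, g x y = g y x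
  pos : ∀ x, x ≠ 0 → 0 < g x x
  graded : ∀ j k, j ≠ k → ∀ x ∈ gr j, ∀ y ∈ gr k, g x y = 0

/-! ### Forms on the Lie algebra with values in a vector space

`Form V` is `V ⊗ Λ^*𝔤^*`: the value `ω S` is the coefficient of
`χ^S = χ^{i₁} ∧ ⋯ ∧ χ^{i_q}`, where `S = {i₁ < ⋯ < i_q}` and `χ^1, …, χ^5` is the basis dual to
`X₁, …, X₅`. -/

/-- `V`-valued forms on `𝔤`, given by their coefficients with respect to the basis `χ^S`. -/
abbrev Form (V : Type*) : Type _ := Finset (Fin 5) → V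

/-- The sign `(-1)^{#{j ∈ S : j < i}}`. -/
def wedgeSign (i : Fin 5) (S : Finset (Fin 5)) : ℂ := (-1) ^ (S.filter (· < i)).card

section
variable (V : Type*) [AddCommGroup V] [Module ℂ V]

/-- Exterior multiplication `ω ↦ χ^i ∧ ω`. -/
def wedge (i : Fin 5) : Form V →ₗ[ℂ] Form V where
  toFun ω S := if i ∈ S then wedgeSign i S • ω (S.erase i) else 0
  map_add' ω η := by
    funext S
    by_cases h : i ∈ S <;> simp [h]
  map_smul' c ω := by
    funext S
    by_cases h : i ∈ S <;> simp [h, smul_comm c]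

/-- Interior multiplication, i.e. contraction with `X_i` in the first slot. -/
def contract (i : Fin 5) : Form V →ₗ[ℂ] Form V where
  toFun ω S := if i ∈ S then 0 else wedgeSign i S • ω (insert i S)
  map_add' ω η := by
    funext S
    by_cases h : i ∈ S <;> simp [h]
  map_smul' c ω := by
    funext S
    by_cases h : i ∈ S <;> simp [h, smul_comm c]

/-- The Chevalley–Eilenberg differential `∂` with trivial coefficients, i.e. the derivation
`∑ₖ ∂χ^k ∧ ι_{X_k}` determined by
`∂χ^k = - ∑_{i<j} χ^k([X_i, X_j]) χ^i ∧ χ^j`. -/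
def ceDiff : Form V →ₗ[ℂ] Form V :=
  -∑ i : Fin 5, ∑ j ∈ Finset.Ioi i, ∑ k : Fin 5,
    ((⁅X i, X j⁆ k : ℝ) : ℂ) • (wedge V i ∘ₗ wedge V j ∘ₗ contract V k)

variable {V}

/-- The de Rham differential, written in the left invariant frame, on `V ⊗ Λ^*𝔤^*`, with the fields
`X_i` acting on the coefficients by `ρ(X_i)`:
`d (f ⊗ α) = ∑ᵢ ρ(X_i) f ⊗ χ^i ∧ α + f ⊗ ∂α`. -/
def deRham (ρ : Fin 5 → V →ₗ[ℂ] V) : Form V →ₗ[ℂ] Form V :=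
  (∑ i : Fin 5, wedge V i ∘ₗ (ρ i).compLeft (Finset (Fin 5))) + ceDiff V

end

/-- The weight of `χ^S` with respect to the grading. -/
def formWt (S : Finset (Fin 5)) : ℕ := ∑ i ∈ S, wt i

/-- The weights of the (pure) cohomology: the grading automorphism `φ_t` acts on `H^q(𝔤)` by
`t ^ N_q`. -/
def cohWt : ℕ → ℕ
  | 0 => 0
  | 1 => 1
  | 2 => 4
  | 3 => 6
  | 4 => 9
  | _ => 10

/-! ### Inner products on forms and harmonic forms -/

/-- The minor of `A` with rows `S` and columns `T` (and `0` if they are not equally many). -/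
def minor (A : Matrix (Fin 5) (Fin 5) ℝ) (S T : Finset (Fin 5)) : ℝ :=
  if h : T.card = S.card then
    (A.submatrix (S.orderEmbOfFin rfl) (T.orderEmbOfFin h)).det
  else 0

/-- The inner product of `χ^S` and `χ^T` induced by `g`:
`⟨χ^{i₁} ∧ ⋯ ∧ χ^{i_q}, χ^{j₁} ∧ ⋯ ∧ χ^{j_q}⟩ = det (g⁻¹(χ^{i_a}, χ^{j_b}))`. -/
def lambdaGram (g : LinearMap.BilinForm ℝ Lie235) (S T : Finset (Fin 5)) : ℝ :=
  minor (Matrix.of fun i j => g (X i) (X j))⁻¹ S T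

/-- `V ⊗ H^q(𝔤)`, where `H^q(𝔤) = ker ∂ / im ∂` is identified with the space
`ker ∂ ∩ (im ∂)^⊥` of harmonic `q`-forms by finite dimensional Hodge theory: the `V`-valued
`q`-forms that are `∂`-closed and orthogonal to all `∂`-exact forms. -/
def Harm (V : Type*) [AddCommGroup V] [Module ℂ V] (g : LinearMap.BilinForm ℝ Lie235) (q : ℕ) :
    Submodule ℂ (Form V) where
  carrier := {ω | (∀ S, S.card ≠ q → ω S = 0) ∧ ceDiff V ω = 0 ∧
    ∀ β : Form ℂ, ∑ S, ∑ T, ((lambdaGram g S T : ℂ) * conj (ceDiff ℂ β S)) • ω T = 0}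
  add_mem' := by
    rintro ω η ⟨h1, h2, h3⟩ ⟨k1, k2, k3⟩
    refine ⟨fun S hS => by simp [h1 S hS, k1 S hS], by simp [h2, k2], fun β => ?_⟩
    simp only [Pi.add_apply, smul_add, Finset.sum_add_distrib, h3 β, k3 β, add_zero]
  zero_mem' := ⟨fun _ _ => rfl, by simp, fun β => by simp⟩
  smul_mem' := by
    rintro c ω ⟨h1, h2, h3⟩
    refine ⟨fun S hS => by simp [h1 S hS], by simp [h2], fun β => ?_⟩
    have h := congrArg (fun v => c • v) (h3 β)
    simpa only [Finset.smul_sum, smul_zero, Pi.smul_apply, smul_comm c] using h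

/-! ### Rumin differentials -/

/-- `RuminRel ρ q σ τ` says that the Rumin differential `ρ(D_q)` maps the class of the leading
form `σ`, of degree `q` and weight `N_q`, to the class of `τ`, of degree `q + 1` and weight
`N_{q+1}`: there is a `q`-form `ω = L_q σ` with leading part `σ` (the other components of `ω` are
of weight larger than `N_q`) such that `dω` has only components of weight at least `N_{q+1}`,
and its component of weight `N_{q+1}` represents the same class as `τ` in `V ⊗ H^{q+1}(𝔤)`.
As the cohomology in degree `q` is concentrated in weight `N_q` for each `q`, the class of `τ` is
uniquely determined by the class of `σ`. -/
def RuminRel {V : Type*} [AddCommGroup V] [Module ℂ V] (ρ : Fin 5 → V →ₗ[ℂ] V) (q : ℕ)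
    (σ τ : Form V) : Prop :=
  ∃ ω : Form V,
    (∀ S, S.card ≠ q → ω S = 0) ∧
    (∀ S, formWt S ≤ cohWt q → ω S = σ S) ∧
    (∀ S, formWt S < cohWt (q + 1) → deRham ρ ω S = 0) ∧
    ∃ β : Form V, ∀ S, formWt S = cohWt (q + 1) → τ S = deRham ρ ω S + ceDiff V β S

/-- `D` is the Rumin differential `ρ(D_q) : V ⊗ H^q(𝔤) → V ⊗ H^{q+1}(𝔤)`, the cohomology spaces
being identified with spaces of harmonic forms by means of `g`. -/
def IsRuminDifferential {V : Type*} [AddCommGroup V] [Module ℂ V] (ρ : Fin 5 → V →ₗ[ℂ] V)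
    (g : LinearMap.BilinForm ℝ Lie235) (q : ℕ)
    (D : Harm V g q →ₗ[ℂ] Harm V g (q + 1)) : Prop :=
  ∀ (σ : Harm V g q) (τ : Harm V g (q + 1)),
    D σ = τ ↔ RuminRel ρ q (σ : Form V) (τ : Form V)

/-! ### The Schrödinger representations -/

/-- The operator of multiplication with `θ` on the Schwartz space. -/
def mulTheta : 𝓢(ℝ, ℂ) →ₗ[ℂ] 𝓢(ℝ, ℂ) :=
  (SchwartzMap.smulLeftCLM ℂ (fun θ : ℝ => (θ : ℂ))).toLinearMap

theorem mulTheta_apply (f : 𝓢(ℝ, ℂ)) (θ : ℝ) : mulTheta f θ = θ * f θ := by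
  have h : (fun θ : ℝ => (θ : ℂ)).HasTemperateGrowth := Function.Complex.hasTemperateGrowth_ofReal
  exact SchwartzMap.smulLeftCLM_apply_apply h f θ

/-- The operator `∂_θ` on the Schwartz space. -/
def dTheta : 𝓢(ℝ, ℂ) →ₗ[ℂ] 𝓢(ℝ, ℂ) := (SchwartzMap.derivCLM ℂ ℂ).toLinearMap

theorem dTheta_apply (f : 𝓢(ℝ, ℂ)) (θ : ℝ) : dTheta f θ = deriv f θ := rfl

/-- The operators `ρ_ħ(X₁), …, ρ_ħ(X₅)` of the Schrödinger representation on the space of smooth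
vectors, which is the Schwartz space `𝓢(ℝ, ℂ) ⊆ L²(ℝ)`. -/
def schrodinger (ħ : ℝ) : Fin 5 → 𝓢(ℝ, ℂ) →ₗ[ℂ] 𝓢(ℝ, ℂ) :=
  ![((√|ħ| : ℝ) : ℂ) • dTheta,
    (Complex.I * ((Real.sign ħ * √|ħ| : ℝ) : ℂ)) • mulTheta,
    (Complex.I * (ħ : ℂ)) • LinearMap.id,
    0,
    0]

/-- The Hermitian inner product on `𝓢(ℝ, ℂ) ⊗ Λ^*𝔤^* ⊆ L²(ℝ) ⊗ Λ^*𝔤^*` that is induced by the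
`L²` inner product and `g`. Its restriction to `𝓢(ℝ, ℂ) ⊗ H^q(𝔤)` (harmonic forms) is the one
induced by the `L²` inner product and `h_g`. -/
def formInner (g : LinearMap.BilinForm ℝ Lie235) (α β : Form 𝓢(ℝ, ℂ)) : ℂ :=
  ∑ S, ∑ T, (lambdaGram g S T : ℂ) * ∫ θ : ℝ, conj (α S θ) * β T θ

/-- `D'` is the formal adjoint `D^{*_{h_g}}` of `D`. -/
def IsFormalAdjoint (g : LinearMap.BilinForm ℝ Lie235) {p q : ℕ}
    (D : Harm 𝓢(ℝ, ℂ) g p →ₗ[ℂ] Harm 𝓢(ℝ, ℂ) g q)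
    (D' : Harm 𝓢(ℝ, ℂ) g q →ₗ[ℂ] Harm 𝓢(ℝ, ℂ) g p) : Prop :=
  ∀ (σ : Harm 𝓢(ℝ, ℂ) g p) (τ : Harm 𝓢(ℝ, ℂ) g q),
    formInner g (D σ : Form 𝓢(ℝ, ℂ)) τ = formInner g σ (D' τ : Form 𝓢(ℝ, ℂ))

/-! ### Zeta regularized determinants -/

/-- The nonzero spectrum of the (closure of the) nonnegative symmetric operator `T`, with
multiplicities, is the family `lam` of positive eigenvalues: there is an orthonormal system `e` of
eigenvectors, `T (e i) = lam i • e i`, whose closed span in the `L²` completion contains the range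
of `T` (this is Parseval's identity `complete`). Equivalently, the closure of `T` is self-adjoint,
it is diagonal with eigenvalues `lam i` on the closed span of the `e i`, and it vanishes on the
orthogonal complement. -/
structure IsSpectralResolution (g : LinearMap.BilinForm ℝ Lie235) {q : ℕ}
    (T : Harm 𝓢(ℝ, ℂ) g q →ₗ[ℂ] Harm 𝓢(ℝ, ℂ) g q) {ι : Type}
    (e : ι → Harm 𝓢(ℝ, ℂ) g q) (lam : ι → ℝ) : Prop where
  pos : ∀ i, 0 < lam i
  eigen : ∀ i, T (e i) = (lam i : ℂ) • e i
  normalized : ∀ i, formInner g (e i : Form 𝓢(ℝ, ℂ)) (e i) = 1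
  orthogonal : ∀ i j, i ≠ j → formInner g (e i : Form 𝓢(ℝ, ℂ)) (e j) = 0
  complete : ∀ φ, HasSum (fun i => ‖formInner g (e i : Form 𝓢(ℝ, ℂ)) (T φ)‖ ^ 2)
    (formInner g (T φ : Form 𝓢(ℝ, ℂ)) (T φ)).re

/-- `d = det' √T` for an operator `T = D^* D`: if `lam` is the family of nonzero eigenvalues of
`T`, then the zeta function `ζ(s) = tr' T^{-s/2} = ∑ᵢ (lam i)^{-s/2}` converges for `Re s`
sufficiently large and has a meromorphic continuation `ζ` to the complex plane that is holomorphic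
at `s = 0`, and `log d = - ζ'(0)`. -/
def HasRegDetSqrt (g : LinearMap.BilinForm ℝ Lie235) {q : ℕ}
    (T : Harm 𝓢(ℝ, ℂ) g q →ₗ[ℂ] Harm 𝓢(ℝ, ℂ) g q) (d : ℝ) : Prop :=
  ∃ (ι : Type) (e : ι → Harm 𝓢(ℝ, ℂ) g q) (lam : ι → ℝ) (ζ : ℂ → ℂ),
    IsSpectralResolution g T e lam ∧
    (∃ c : ℝ, ∀ s : ℂ, c < s.re → HasSum (fun i => (lam i : ℂ) ^ (-s / 2)) (ζ s)) ∧
    Meromorphic ζ ∧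
    AnalyticAt ℂ ζ 0 ∧
    0 < d ∧ (Real.log d : ℂ) = -deriv ζ 0

/-- The analytic torsion, i.e. the graded product of the determinants `d q = det' |ρ(D_q)|`. -/
def torsion (d : Fin 5 → ℝ) : ℝ := d 0 * d 2 * d 4 / (d 1 * d 3)

end

/-! The vectors X₄, X₅ act by zero, so only the Heisenberg quotient acts, and the Rumin complex
becomes a complex of matrices in the ladder operators of a harmonic oscillator.

Bracketing with X₃ identifies 𝔤₋₁ with 𝔤₋₃, and proportionality of b_g and g₋₁ says that both carry
the same Gram matrix up to a factor (`exists_isBlockCogram`). The harmonic forms of degree 0, …, 5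
are then scalars, pairs, symmetric 2-tensors, symmetric 2-tensors, pairs and scalars, and all inner
products come from a single positive 2×2 block. Take α ∈ ℂ² isotropic for this block, scaled so that
α and its conjugate span the area iħ (`exists_isIsotropicFrame`). These two vectors are orthogonal
of equal length, and ρ(X_i) = α_i ad − conj(α_i) a for mutually adjoint operators with [a, ad] = 1
and a Gaussian ground state. In this frame the differentials are, up to constants, `d0`, `d1`, `d2`,
`d1'`, `d0'`, where `d0'` and `d1'` are the adjoints of `d0` and `d1`, and `d2` is symmetric. This
is Hodge duality made explicit, and it reduces five spectra to three.

The model operators respect the number grading, so they split into small blocks. With m = 2n + 1,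
`d0' ∘ d0` has eigenvalues m; `d1' ∘ d1`, off the image of `d0`, has eigenvalues m|m² − 2|; and `d2`
satisfies the cubic x(x² − 5x/2 − (m² − 2)/2) = 0 on the middle vector of each block (`d2_cubic`). A
few vectors of low degree fall outside this pattern, but they supply exactly the eigenvalues that
are missing elsewhere. The oscillator states are total in L² by a moment argument
(`schrodinger_total`), so the eigenvectors found, together with the kernel, exhaust everything
(`EigenSystem.hasSum`).

For the determinants, λ^(-s/2) is written as m^(-as) exp(-s ℓ), up to a factor exponential in s,
where ℓ is analytic in 1/m. Expanding in 1/m continues the zeta function through ∑ m^(-w) = (1 −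
2^(-w)) ζ(w), which vanishes at w = 0 with derivative −(log 2)/2. The coefficient of 1/m is zero,
for `d2` only after adding the two branches, so no pole interferes at s = 0 (`exists_zeta`). Hence
log det' equals c·a·(log 2)/2, with c the number of branches, plus the sum of the ℓ. That sum is
governed by ∏ (1 − 2/m²) = cos(π/√2) = −sin(π(√2 − 1)/2) (`tsum_log_one_sub`). As the zeta functions
vanish at 0, multiplying all eigenvalues by a constant does not change the determinant
(`IsZetaDet.scale`), so neither ħ nor the scales in g enter. -/

noncomputable section

/-! ### Dirichlet series over the odd numbers and their continuation. -/

open Filter Topology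

/-- The odd positive number `2n+1`. -/
def oddN (n : ℕ) : ℝ := 2 * n + 1

theorem oddN_pos (n : ℕ) : 0 < oddN n := by unfold oddN; positivity

theorem one_le_oddN (n : ℕ) : 1 ≤ oddN n := by unfold oddN; linarith [n.cast_nonneg (α := ℝ)]

theorem oddN_ne_zero (n : ℕ) : (oddN n : ℂ) ≠ 0 := by exact_mod_cast (oddN_pos n).ne'

/-- The Dirichlet series `∑ (2n+1)^{-w}`, continued to the complex plane. -/
def oddZeta (w : ℂ) : ℂ := (1 - 2 ^ (-w)) * riemannZeta w

/-- Removing the even integers from the zeta series removes 2^(-w) times the whole series. -/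
theorem hasSum_oddZeta {w : ℂ} (hw : 1 < w.re) :
    HasSum (fun n => (oddN n : ℂ) ^ (-w)) (oddZeta w) := by
  have hs : Summable (fun n : ℕ => 1 / (n : ℂ) ^ w) := Complex.summable_one_div_nat_cpow.2 hw
  have he : ∀ k : ℕ, 1 / ((2 * k : ℕ) : ℂ) ^ w = 2 ^ (-w) * (1 / (k : ℂ) ^ w) := by
    intro k
    rw [Nat.cast_mul, Complex.natCast_mul_natCast_cpow, Complex.cpow_neg]
    push_cast
    rw [one_div, one_div, mul_inv]
  have hE : Summable (fun k : ℕ => 1 / ((2 * k : ℕ) : ℂ) ^ w) := by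
    simp_rw [he]; exact hs.mul_left _
  have hO : Summable (fun k : ℕ => 1 / ((2 * k + 1 : ℕ) : ℂ) ^ w) :=
    hs.comp_injective (i := fun k : ℕ => 2 * k + 1) (fun a b h => by simpa using h)
  have h := tsum_even_add_odd (f := fun n : ℕ => 1 / (n : ℂ) ^ w) hE hO
  rw [← zeta_eq_tsum_one_div_nat_cpow hw] at h
  simp_rw [he] at h
  rw [tsum_mul_left, ← zeta_eq_tsum_one_div_nat_cpow hw] at h
  have h2 : oddZeta w = ∑' k : ℕ, 1 / ((2 * k + 1 : ℕ) : ℂ) ^ w := by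
    rw [oddZeta, ← sub_eq_iff_eq_add'.2 h.symm]; ring
  rw [h2]
  convert hO.hasSum using 2 with k
  rw [Complex.cpow_neg, one_div, oddN]
  push_cast
  rfl

theorem differentiableAt_oddZeta {w : ℂ} (hw : w ≠ 1) : DifferentiableAt ℂ oddZeta w := by
  unfold oddZeta
  refine DifferentiableAt.mul ?_ (differentiableAt_riemannZeta hw)
  exact (differentiableAt_const _).sub (differentiableAt_id.neg.const_cpow (Or.inl two_ne_zero))

theorem analyticAt_oddZeta {w : ℂ} (hw : w ≠ 1) : AnalyticAt ℂ oddZeta w := by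
  rw [Complex.analyticAt_iff_eventually_differentiableAt]
  filter_upwards [isOpen_ne.mem_nhds hw] with z hz using differentiableAt_oddZeta hz

/-- The residue formula makes (s − 1) ζ(s) continuous at 1 once the value 1 is inserted, so the
singularity is removable; dividing by s − 1 gives the claim. -/
theorem meromorphicAt_riemannZeta_one : MeromorphicAt riemannZeta 1 := by
  set f : ℂ → ℂ := Function.update (fun s => (s - 1) * riemannZeta s) 1 1 with hf
  have hfe : ∀ z : ℂ, z ≠ 1 → f z = (z - 1) * riemannZeta z := fun z hz => by
    simp [hf, Function.update_of_ne hz]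
  have h1 : AnalyticAt ℂ f 1 := by
    refine Complex.analyticAt_of_differentiable_on_punctured_nhds_of_continuousAt ?_ ?_
    · filter_upwards [self_mem_nhdsWithin] with z hz
      have h2 : f =ᶠ[𝓝 z] fun s => (s - 1) * riemannZeta s := by
        filter_upwards [isOpen_ne.mem_nhds hz] with y hy using hfe y hy
      exact ((differentiableAt_id.sub_const 1).mul
        (differentiableAt_riemannZeta hz)).congr_of_eventuallyEq h2
    · rw [hf, continuousAt_update_same]
      exact riemannZeta_residue_one
  have h2 : MeromorphicAt (fun s : ℂ => (s - 1)⁻¹ * f s) 1 := by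
    refine MeromorphicAt.mul (MeromorphicAt.inv ?_) h1.meromorphicAt
    exact (analyticAt_id.sub analyticAt_const).meromorphicAt
  refine h2.congr ?_
  filter_upwards [self_mem_nhdsWithin] with z hz
  rw [hfe z hz, inv_mul_cancel_left₀ (sub_ne_zero.2 hz)]

theorem meromorphicAt_oddZeta (w : ℂ) : MeromorphicAt oddZeta w := by
  rcases eq_or_ne w 1 with rfl | hw
  · refine MeromorphicAt.mul (AnalyticAt.meromorphicAt ?_) meromorphicAt_riemannZeta_one
    refine Differentiable.analyticAt (fun z => ?_) _
    exact (differentiableAt_const _).sub (differentiableAt_id.neg.const_cpow (Or.inl two_ne_zero))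
  · exact (analyticAt_oddZeta hw).meromorphicAt

theorem oddZeta_zero : oddZeta 0 = 0 := by simp [oddZeta]

/-- Since 1 − 2^(-w) vanishes at 0 with slope log 2, only the value ζ(0) = −1/2 enters. All powers
of 2 in the first four degrees of homogeneity of the final answer, 2^(1/4), 2^(3/4) and 2, originate
here. -/
theorem hasDerivAt_oddZeta_zero : HasDerivAt oddZeta (-(Real.log 2 / 2) : ℝ) 0 := by
  have h1 : HasDerivAt (fun w : ℂ => 1 - (2 : ℂ) ^ (-w)) (Complex.log 2) 0 := by
    have := ((hasDerivAt_id (0 : ℂ)).neg.const_cpow (c := 2) (Or.inl two_ne_zero)).const_sub 1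
    simpa using this
  have h2 := h1.mul (differentiableAt_riemannZeta (zero_ne_one)).hasDerivAt
  have h3 : Complex.log 2 = (Real.log 2 : ℝ) := by
    rw [Complex.ofReal_log (by norm_num)]; simp
  have h4 : ((-(Real.log 2 / 2) : ℝ) : ℂ) = Complex.log 2 * riemannZeta 0 +
      (1 - (2 : ℂ) ^ (-0 : ℂ)) * deriv riemannZeta 0 := by
    rw [riemannZeta_zero, h3]
    simp
    ring
  exact h4 ▸ h2

/-- `E s n` has an asymptotic expansion `∑ e j s * (2n+1)^{-j}`, locally uniformly in `s`. -/
structure OddExpansion (E : ℂ → ℕ → ℂ) (e : ℕ → ℂ → ℂ) : Prop where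
  diff : ∀ n, Differentiable ℂ fun s => E s n
  coeff : ∀ j, Differentiable ℂ (e j)
  rem : ∀ (K : ℕ) (B : ℝ), ∃ C, ∀ s : ℂ, ‖s‖ ≤ B → ∀ n,
    ‖E s n - ∑ j ∈ Finset.range K, e j s * ((oddN n : ℂ)⁻¹) ^ j‖ ≤ C * ((oddN n)⁻¹) ^ K

theorem OddExpansion.add {E F : ℂ → ℕ → ℂ} {e f : ℕ → ℂ → ℂ} (hE : OddExpansion E e)
    (hF : OddExpansion F f) :
    OddExpansion (fun s n => E s n + F s n) (fun j s => e j s + f j s) where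
  diff n := (hE.diff n).add (hF.diff n)
  coeff j := (hE.coeff j).add (hF.coeff j)
  rem K B := by
    obtain ⟨C, hC⟩ := hE.rem K B
    obtain ⟨D, hD⟩ := hF.rem K B
    refine ⟨C + D, fun s hs n => ?_⟩
    have : E s n + F s n - ∑ j ∈ Finset.range K, (e j s + f j s) * ((oddN n : ℂ)⁻¹) ^ j =
        (E s n - ∑ j ∈ Finset.range K, e j s * ((oddN n : ℂ)⁻¹) ^ j) +
        (F s n - ∑ j ∈ Finset.range K, f j s * ((oddN n : ℂ)⁻¹) ^ j) := by
      simp only [add_mul, Finset.sum_add_distrib]; ring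
    rw [this, add_mul]
    exact (norm_add_le _ _).trans (add_le_add (hC s hs n) (hD s hs n))

section continuation

variable (E : ℂ → ℕ → ℂ) (e : ℕ → ℂ → ℂ) (a : ℝ)

/-- The remainder of order `K` in the expansion of the Dirichlet series. -/
def zetaRem (K : ℕ) (s : ℂ) (n : ℕ) : ℂ :=
  (oddN n : ℂ) ^ (-(a * s)) *
    (E s n - ∑ j ∈ Finset.range K, e j s * ((oddN n : ℂ)⁻¹) ^ j)

/-- The continuation of the Dirichlet series to `Re (a s) > 1 - K`. -/
def zetaCont (K : ℕ) (s : ℂ) : ℂ :=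
  ∑ j ∈ Finset.range K, e j s * oddZeta (a * s + j) + ∑' n, zetaRem E e a K s n

variable {E e a}

theorem summable_oddN_rpow {t : ℝ} (ht : 1 < t) : Summable fun n => (oddN n) ^ (-t) := by
  have h := (hasSum_oddZeta (w := (t : ℂ)) (by simpa using ht)).summable.norm
  refine h.congr fun n => ?_
  rw [Complex.norm_cpow_eq_rpow_re_of_pos (oddN_pos n)]
  simp

/-- A majorant independent of s on a bounded part of a half plane. For η > 1 it is summable, which
gives analyticity of the remainder sum and termwise differentiation. -/
theorem norm_zetaRem_le (h : OddExpansion E e) (K : ℕ) (B : ℝ) {η : ℝ} :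
    ∃ C, ∀ s : ℂ, ‖s‖ ≤ B → η < a * s.re + K → ∀ n, ‖zetaRem E e a K s n‖ ≤ C * oddN n ^ (-η) := by
  obtain ⟨C, hC⟩ := h.rem K B
  refine ⟨|C|, fun s hs hη n => ?_⟩
  rw [zetaRem, norm_mul, Complex.norm_cpow_eq_rpow_re_of_pos (oddN_pos n)]
  have h1 : (-((a : ℂ) * s)).re = -(a * s.re) := by simp
  rw [h1]
  calc oddN n ^ (-(a * s.re)) * _ ≤ oddN n ^ (-(a * s.re)) * (|C| * ((oddN n)⁻¹) ^ K) := by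
        gcongr
        · exact (Real.rpow_pos_of_pos (oddN_pos n) _).le
        · exact (hC s hs n).trans (mul_le_mul_of_nonneg_right (le_abs_self C)
            (pow_nonneg (inv_nonneg.2 (oddN_pos n).le) _))
    _ = |C| * oddN n ^ (-(a * s.re + K)) := by
        rw [neg_add, Real.rpow_add (oddN_pos n), Real.rpow_neg (oddN_pos n).le (K : ℝ),
          Real.rpow_natCast, inv_pow]; ring
    _ ≤ |C| * oddN n ^ (-η) := by
        gcongr
        · exact one_le_oddN n

theorem summable_zetaRem (h : OddExpansion E e) {K : ℕ} {s : ℂ}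
    (hs : 1 < a * s.re + K) : Summable (zetaRem E e a K s) := by
  obtain ⟨η, h1, h2⟩ := exists_between hs
  obtain ⟨C, hC⟩ := norm_zetaRem_le h K ‖s‖ (η := η)
  exact Summable.of_norm_bounded ((summable_oddN_rpow h1).mul_left C) (hC s le_rfl h2)

theorem zetaRem_zero (E : ℂ → ℕ → ℂ) (e : ℕ → ℂ → ℂ) (a : ℝ) (s : ℂ) :
    zetaRem E e a 0 s = fun n => (oddN n : ℂ) ^ (-(a * s)) * E s n := by
  funext n
  simp [zetaRem]

theorem differentiable_zetaRem (h : OddExpansion E e) (K n : ℕ) :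
    Differentiable ℂ fun s => zetaRem E e a K s n := by
  unfold zetaRem
  have h1 : Differentiable ℂ fun s : ℂ => (oddN n : ℂ) ^ (-(a * s)) := fun s =>
    ((differentiableAt_id.const_mul _).neg).const_cpow (Or.inl (oddN_ne_zero n))
  refine h1.mul ((h.diff n).sub ?_)
  exact Differentiable.fun_sum fun j _ => (h.coeff j).mul_const _

theorem zetaRem_local (h : OddExpansion E e) (K : ℕ) {x : ℂ}
    (hx : 1 < a * x.re + K) : ∃ U : Set ℂ, IsOpen U ∧ x ∈ U ∧ ∃ u : ℕ → ℝ, Summable u ∧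
      ∀ n, ∀ s ∈ U, ‖zetaRem E e a K s n‖ ≤ u n := by
  obtain ⟨η, h1, h2⟩ := exists_between hx
  obtain ⟨C, hC⟩ := norm_zetaRem_le h K (‖x‖ + 1) (η := η)
  refine ⟨{s | η < a * s.re + K} ∩ Metric.ball x 1, ?_, ⟨h2, by simp⟩, _,
    (summable_oddN_rpow h1).mul_left C, fun n s hs => hC s ?_ hs.1 n⟩
  · refine IsOpen.inter ?_ Metric.isOpen_ball
    exact isOpen_lt continuous_const
      ((continuous_const.mul Complex.continuous_re).add continuous_const)
  · have := hs.2
    rw [Metric.mem_ball, dist_eq_norm] at this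
    calc ‖s‖ = ‖x + (s - x)‖ := by ring_nf
      _ ≤ ‖x‖ + 1 := (norm_add_le _ _).trans (by linarith)

theorem analyticAt_tsum_zetaRem (h : OddExpansion E e) (K : ℕ) {x : ℂ}
    (hx : 1 < a * x.re + K) : AnalyticAt ℂ (fun s => ∑' n, zetaRem E e a K s n) x := by
  obtain ⟨U, hU, hxU, u, hu, hb⟩ := zetaRem_local h K hx
  exact (Complex.differentiableOn_tsum_of_summable_norm hu
    (fun n => (differentiable_zetaRem h K n).differentiableOn) hU hb).analyticAt
    (hU.mem_nhds hxU)

theorem hasSum_deriv_zetaRem (h : OddExpansion E e) (K : ℕ) {x : ℂ}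
    (hx : 1 < a * x.re + K) : HasSum (fun n => deriv (fun s => zetaRem E e a K s n) x)
      (deriv (fun s => ∑' n, zetaRem E e a K s n) x) := by
  obtain ⟨U, hU, hxU, u, hu, hb⟩ := zetaRem_local h K hx
  exact Complex.hasSum_deriv_of_summable_norm hu
    (fun n => (differentiable_zetaRem h K n).differentiableOn) hU hb hxU

theorem meromorphicAt_zetaCont (h : OddExpansion E e) (K : ℕ) {x : ℂ}
    (hx : 1 < a * x.re + K) : MeromorphicAt (zetaCont E e a K) x := by
  refine MeromorphicAt.add ?_ (analyticAt_tsum_zetaRem h K hx).meromorphicAt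
  refine MeromorphicAt.fun_sum fun j _ => ?_
  refine MeromorphicAt.mul ((h.coeff j).analyticAt x).meromorphicAt ?_
  refine MeromorphicAt.comp_analyticAt (meromorphicAt_oddZeta _) ?_
  fun_prop

/-- One more term of the expansion moves from the remainder, where its series converges, to an
explicit odd zeta value. Hence the continuations of different orders agree where both apply. -/
theorem zetaCont_succ (h : OddExpansion E e) (K : ℕ) {s : ℂ}
    (hs : 1 < a * s.re + K) : zetaCont E e a (K + 1) s = zetaCont E e a K s := by
  have h1 := summable_zetaRem h hs
  have h3 : HasSum (fun n => (oddN n : ℂ) ^ (-(a * s + K))) (oddZeta (a * s + K)) :=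
    hasSum_oddZeta (by simpa using hs)
  have h4 : ∀ n, zetaRem E e a (K + 1) s n =
      zetaRem E e a K s n - e K s * (oddN n : ℂ) ^ (-(a * s + K)) := by
    intro n
    rw [zetaRem, zetaRem, Finset.sum_range_succ, neg_add, Complex.cpow_add _ _ (oddN_ne_zero n),
      Complex.cpow_neg _ (K : ℂ), Complex.cpow_natCast, inv_pow]
    ring
  rw [zetaCont, zetaCont, Finset.sum_range_succ]
  simp_rw [h4]
  rw [(h1.hasSum.sub (h3.mul_left (e K s))).tsum_eq]
  ring

theorem zetaCont_eq (h : OddExpansion E e) {K L : ℕ} {s : ℂ}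
    (hs : 1 < a * s.re + K) (hKL : K ≤ L) : zetaCont E e a L s = zetaCont E e a K s := by
  induction L, hKL using Nat.le_induction with
  | base => rfl
  | succ L hL ih =>
    rw [zetaCont_succ h L _, ih]
    have : (K : ℝ) ≤ L := by exact_mod_cast hL
    linarith

/-- At s = 0 order two suffices. The term j = 0 gives c times the odd zeta function at a s; the term
j = 1, which would meet the pole at w = 1, is absent as `e 1 = 0`; the remainder vanishes at s = 0
because every `E 0 n` equals c. -/
theorem exists_zeta (h : OddExpansion E e) (ha : 0 < a) (h1 : e 1 = 0) {c : ℂ}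
    (h0 : ∀ s, e 0 s = c) (hE0 : ∀ n, E 0 n = c) : ∃ ζ : ℂ → ℂ,
      (∀ s : ℂ, 1 < a * s.re → HasSum (fun n => (oddN n : ℂ) ^ (-(a * s)) * E s n) (ζ s)) ∧
      Meromorphic ζ ∧ AnalyticAt ℂ ζ 0 ∧ ζ 0 = 0 ∧
      deriv ζ 0 = c * a * (-(Real.log 2 / 2) : ℝ) + ∑' n, deriv (fun s => E s n) 0 := by
  -- An order, depending on s, that is always large enough; the local continuations glue to one
  -- function on ℂ.
  let κ : ℂ → ℕ := fun s => ⌈a * ‖s‖⌉₊ + 2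
  have hκ : ∀ (s : ℂ) (L : ℕ), a * ‖s‖ + 1 < L → 1 < a * s.re + L := by
    intro s L hL
    have := Complex.abs_re_le_norm s
    have := (abs_le.1 this).1
    nlinarith
  have hκ' : ∀ s, a * ‖s‖ + 1 < κ s := by
    intro s
    have := Nat.le_ceil (a * ‖s‖)
    simp only [κ]; push_cast; linarith
  have key : ∀ (s : ℂ) (K : ℕ), 1 < a * s.re + K →
      zetaCont E e a (κ s) s = zetaCont E e a K s := by
    intro s K hK
    rw [← zetaCont_eq h hK (le_max_left K (κ s)),
      ← zetaCont_eq h (hκ s _ (hκ' s)) (le_max_right K (κ s))]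
  have hloc : ∀ x : ℂ, ∀ K : ℕ, 1 < a * x.re + K →
      (fun s => zetaCont E e a (κ s) s) =ᶠ[𝓝 x] zetaCont E e a K := by
    intro x K hK
    have : ∀ᶠ s in 𝓝 x, 1 < a * s.re + K :=
      ((continuous_const.mul Complex.continuous_re).add continuous_const).continuousAt.eventually
        (lt_mem_nhds hK)
    filter_upwards [this] with s hs using key s K hs
  have hl2 := hloc 0 2 (by norm_num)
  have hF : zetaCont E e a 2 = fun s => c * oddZeta (a * s) + ∑' n, zetaRem E e a 2 s n := by
    funext s
    simp [zetaCont, Finset.sum_range_succ, h0, h1]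
  have hz0 : HasDerivAt (fun s : ℂ => oddZeta (a * s)) ((-(Real.log 2 / 2) : ℝ) * a) 0 := by
    have h2 : HasDerivAt (fun s : ℂ => (a : ℂ) * s) a 0 := by
      simpa using (hasDerivAt_id (0 : ℂ)).const_mul (a : ℂ)
    have h3 : HasDerivAt oddZeta (-(Real.log 2 / 2) : ℝ) ((a : ℂ) * 0) := by
      simpa using hasDerivAt_oddZeta_zero
    exact h3.comp 0 h2
  have hrem := analyticAt_tsum_zetaRem (a := a) h 2 (x := 0) (by norm_num)
  have hder := hasSum_deriv_zetaRem (a := a) h 2 (x := 0) (by norm_num)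
  have hrem0 : ∀ n, zetaRem E e a 2 0 n = 0 := by
    intro n
    simp [zetaRem, Finset.sum_range_succ, h0, h1, hE0]
  -- The power of 2n + 1 equals 1 at s = 0 and multiplies a function vanishing there, so its own
  -- derivative drops out.
  have hdn : ∀ n, deriv (fun s => zetaRem E e a 2 s n) 0 = deriv (fun s => E s n) 0 := by
    intro n
    have h5 : HasDerivAt (fun s : ℂ => (oddN n : ℂ) ^ (-(a * s)))
        (deriv (fun s : ℂ => (oddN n : ℂ) ^ (-(a * s))) 0) 0 :=
      DifferentiableAt.hasDerivAt
        (((differentiableAt_id.const_mul _).neg).const_cpow (Or.inl (oddN_ne_zero n)))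
    have h6 := h5.mul (((h.diff n) 0).hasDerivAt.sub_const c)
    have h7 : (fun s => zetaRem E e a 2 s n) =
        (fun s : ℂ => (oddN n : ℂ) ^ (-(a * s))) * fun s => E s n - c := by
      funext s
      simp [zetaRem, Finset.sum_range_succ, h0, h1]
    rw [h7, h6.deriv]
    simp [hE0]
  refine ⟨fun s => zetaCont E e a (κ s) s, fun s hs => ?_, fun x => ?_, ?_, ?_, ?_⟩
  · show HasSum _ (zetaCont E e a (κ s) s)
    rw [key s 0 (by simpa using hs)]
    have := (summable_zetaRem (K := 0) h (s := s) (by simpa using hs)).hasSum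
    rw [zetaCont, Finset.range_zero, Finset.sum_empty, zero_add]
    rwa [zetaRem_zero] at this ⊢
  · have hK := hκ x _ (hκ' x)
    exact (meromorphicAt_zetaCont h _ hK).congr ((hloc x _ hK).symm.filter_mono
      nhdsWithin_le_nhds)
  · refine AnalyticAt.congr ?_ hl2.symm
    rw [hF]
    refine (analyticAt_const.mul (AnalyticAt.fun_comp ?_ (by fun_prop))).add hrem
    simpa using analyticAt_oddZeta zero_ne_one
  · show zetaCont E e a (κ 0) 0 = 0
    rw [show zetaCont E e a (κ 0) 0 = _ from hl2.self_of_nhds, hF]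
    simp [oddZeta_zero, hrem0]
  · rw [hl2.deriv_eq, hF, ((hz0.const_mul c).fun_add hrem.differentiableAt.hasDerivAt).deriv,
      ← hder.tsum_eq]
    simp_rw [hdn]
    ring

end continuation
end

/-! ### Asymptotic expansions from analytic functions, and zeta determinants. -/

noncomputable section

open Filter Topology

/-- Each derivative in the second variable is the total derivative evaluated at (0, 1), which is
again jointly analytic. This makes Taylor coefficients in u entire in the parameter s. -/
theorem analyticOnNhd_iteratedDeriv_snd {U : Set ℂ} (hU : IsOpen U) {G : ℂ × ℂ → ℂ}
    (hG : AnalyticOnNhd ℂ G (Set.univ ×ˢ U)) (j : ℕ) : ∃ F : ℂ × ℂ → ℂ,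
      AnalyticOnNhd ℂ F (Set.univ ×ˢ U) ∧
      ∀ s, ∀ u ∈ U, iteratedDeriv j (fun v => G (s, v)) u = F (s, u) := by
  induction j with
  | zero => exact ⟨G, hG, fun s u _ => by simp⟩
  | succ j ih =>
    obtain ⟨F, hF, hFe⟩ := ih
    refine ⟨fun p => fderiv ℂ F p (0, 1), fun p hp => ?_, fun s u hu => ?_⟩
    · exact (ContinuousLinearMap.apply ℂ ℂ ((0, 1) : ℂ × ℂ)).analyticAt _ |>.comp (hF.fderiv p hp)
    · have h1 : iteratedDeriv j (fun v => G (s, v)) =ᶠ[𝓝 u] fun v => F (s, v) := by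
        filter_upwards [hU.mem_nhds hu] with v hv using hFe s v hv
      rw [iteratedDeriv_succ, h1.deriv_eq]
      have h2 : HasDerivAt (fun v : ℂ => ((s, v) : ℂ × ℂ)) (0, 1) u :=
        (hasDerivAt_const u s).prodMk (hasDerivAt_id u)
      exact ((hF (s, u) ⟨trivial, hu⟩).differentiableAt.hasFDerivAt.comp_hasDerivAt u h2).deriv

/-- Cauchy's estimates bound the terms by M (‖u‖/r)^j; for ‖u‖ ≤ r/2 the tail is dominated by a
geometric series of ratio 1/2, whence the factor 2. -/
theorem norm_taylor_remainder_le {f : ℂ → ℂ} {r M : ℝ} (hr : 0 < r)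
    (hf : DiffContOnCl ℂ f (Metric.ball 0 r)) (hM : ∀ z ∈ Metric.sphere (0 : ℂ) r, ‖f z‖ ≤ M)
    (K : ℕ) {u : ℂ} (hu : ‖u‖ ≤ r / 2) :
    ‖f u - ∑ j ∈ Finset.range K, ((j.factorial : ℂ)⁻¹ * iteratedDeriv j f 0) * u ^ j‖ ≤
      2 * M / r ^ K * ‖u‖ ^ K := by
  have hM0 : 0 ≤ M := by
    refine (norm_nonneg _).trans (hM (r : ℂ) ?_)
    simp [abs_of_pos hr]
  have hub : u ∈ Metric.ball (0 : ℂ) r := by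
    rw [mem_ball_zero_iff]; linarith
  have h1 := Complex.hasSum_taylorSeries_on_ball (hf.differentiableOn) hub
  have h2 : ∀ j, (j.factorial : ℂ)⁻¹ • (u - 0) ^ j • iteratedDeriv j f 0 =
      ((j.factorial : ℂ)⁻¹ * iteratedDeriv j f 0) * u ^ j := by
    intro j; simp only [smul_eq_mul, sub_zero]; ring
  simp_rw [h2] at h1
  have h3 := (hasSum_nat_add_iff' K).2 h1
  have hterm : ∀ j, ‖((j.factorial : ℂ)⁻¹ * iteratedDeriv j f 0) * u ^ j‖ ≤ M * (‖u‖ / r) ^ j := by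
    intro j
    have hc := Complex.norm_iteratedDeriv_le_of_forall_mem_sphere_norm_le j hr hf hM
    have hj : (0 : ℝ) < j.factorial := by exact_mod_cast j.factorial_pos
    rw [norm_mul, norm_mul, norm_inv, norm_pow, Complex.norm_natCast]
    calc (j.factorial : ℝ)⁻¹ * ‖iteratedDeriv j f 0‖ * ‖u‖ ^ j
        ≤ (j.factorial : ℝ)⁻¹ * (j.factorial * M / r ^ j) * ‖u‖ ^ j := by gcongr
      _ = M * (‖u‖ / r) ^ j := by rw [div_pow]; field_simp
  have hq : ‖u‖ / r ≤ 1 / 2 := by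
    rw [div_le_iff₀ hr]; linarith
  have hq0 : 0 ≤ ‖u‖ / r := by positivity
  have h4 : HasSum (fun j : ℕ => M * (‖u‖ / r) ^ K * (1 / 2 : ℝ) ^ j) (M * (‖u‖ / r) ^ K * 2) :=
    (hasSum_geometric_two).mul_left _
  have h5 := h3.norm_le_of_bounded h4 (fun j => (hterm (j + K)).trans ?_)
  · refine h5.trans (le_of_eq ?_)
    rw [div_pow]; ring
  · rw [pow_add, mul_comm ((‖u‖ / r) ^ j), ← mul_assoc]
    gcongr

theorem tendsto_oddN_inv : Tendsto (fun n => (oddN n)⁻¹) atTop (𝓝 0) := by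
  refine tendsto_inv_atTop_zero.comp ?_
  refine tendsto_atTop_mono (fun n => ?_) tendsto_natCast_atTop_atTop
  unfold oddN; linarith [n.cast_nonneg (α := ℝ)]

/-- The expansion is the Taylor series of exp(-s L(u)) at u = 1/(2n+1). The Cauchy bound applies
only for large n; the finitely many other n are controlled by compactness of the disc of parameters.
-/
theorem oddExpansion_exp {L : ℂ → ℂ} (hL : AnalyticAt ℂ L 0) {ℓ : ℕ → ℝ}
    (h : ∀ᶠ n in atTop, (ℓ n : ℂ) = L ((oddN n : ℂ)⁻¹)) :
    OddExpansion (fun s n => Complex.exp (-s * ℓ n))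
      (fun j s => (j.factorial : ℂ)⁻¹ * iteratedDeriv j (fun u => Complex.exp (-s * L u)) 0) := by
  obtain ⟨R, hR, hLR⟩ := Metric.eventually_nhds_iff_ball.1 hL.eventually_analyticAt
  have hE : ∀ n, Differentiable ℂ fun s : ℂ => Complex.exp (-s * ℓ n) := fun n => by fun_prop
  have he : ∀ j, Differentiable ℂ fun s : ℂ =>
      (j.factorial : ℂ)⁻¹ * iteratedDeriv j (fun u => Complex.exp (-s * L u)) 0 := by
    intro j
    have hG : AnalyticOnNhd ℂ (fun p : ℂ × ℂ => Complex.exp (-p.1 * L p.2))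
        (Set.univ ×ˢ Metric.ball 0 R) := fun p hp => by
      have : AnalyticAt ℂ (fun p : ℂ × ℂ => L p.2) p := (hLR p.2 hp.2).fun_comp analyticAt_snd
      exact (analyticAt_fst.neg.mul this).cexp'
    obtain ⟨F, hF, hFe⟩ := analyticOnNhd_iteratedDeriv_snd Metric.isOpen_ball hG j
    simp_rw [fun s : ℂ => hFe s 0 (Metric.mem_ball_self hR)]
    intro s
    refine DifferentiableAt.const_mul ?_ _
    have h1 := (hF (s, 0) ⟨trivial, Metric.mem_ball_self hR⟩).differentiableAt
    exact h1.comp s (f := fun s : ℂ => ((s, 0) : ℂ × ℂ))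
      (differentiableAt_id.prodMk (differentiableAt_const _))
  refine ⟨hE, he, fun K B => ?_⟩
  have hr : 0 < R / 2 := by linarith
  have hsub : Metric.closedBall (0 : ℂ) (R / 2) ⊆ Metric.ball 0 R :=
    Metric.closedBall_subset_ball (by linarith)
  have hLc : ContinuousOn L (Metric.closedBall 0 (R / 2)) := fun z hz =>
    (hLR z (hsub hz)).continuousAt.continuousWithinAt
  obtain ⟨A, hA⟩ := (isCompact_closedBall (0 : ℂ) (R / 2)).exists_bound_of_continuousOn hLc
  have hn : ∀ n, ∃ C, ∀ s : ℂ, ‖s‖ ≤ B → ‖Complex.exp (-s * ℓ n) - ∑ j ∈ Finset.range K,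
      ((j.factorial : ℂ)⁻¹ * iteratedDeriv j (fun u => Complex.exp (-s * L u)) 0) *
        ((oddN n : ℂ)⁻¹) ^ j‖ ≤ C := by
    intro n
    have hd : Differentiable ℂ fun s : ℂ => Complex.exp (-s * ℓ n) - ∑ j ∈ Finset.range K,
      ((j.factorial : ℂ)⁻¹ * iteratedDeriv j (fun u => Complex.exp (-s * L u)) 0) *
        ((oddN n : ℂ)⁻¹) ^ j :=
      (hE n).sub (Differentiable.fun_sum fun j _ => (he j).mul_const _)
    obtain ⟨C, hC⟩ := (isCompact_closedBall (0 : ℂ) B).exists_bound_of_continuousOn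
      hd.continuous.continuousOn
    exact ⟨C, fun s hs => hC s (by simpa using hs)⟩
  choose D hD using hn
  have hsmall : ∀ᶠ n in atTop, (oddN n)⁻¹ ≤ R / 2 / 2 :=
    tendsto_oddN_inv.eventually (ge_mem_nhds (by linarith))
  obtain ⟨N, hN⟩ := eventually_atTop.1 (h.and hsmall)
  set M := Real.exp (|B| * |A|) with hMdef
  have hC0 : 0 ≤ 2 * M / (R / 2) ^ K := by positivity
  have hS0 : ∀ n, 0 ≤ |D n| * oddN n ^ K := fun n =>
    mul_nonneg (abs_nonneg _) (pow_nonneg (oddN_pos n).le _)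
  -- The powers of `oddN n` undo the decay demanded by the bound at the exceptional indices n < N.
  refine ⟨2 * M / (R / 2) ^ K + ∑ n ∈ Finset.range N, |D n| * oddN n ^ K, fun s hs n => ?_⟩
  have hnorm : ‖((oddN n : ℂ)⁻¹)‖ = (oddN n)⁻¹ := by
    rw [norm_inv, Complex.norm_real, Real.norm_of_nonneg (oddN_pos n).le]
  have hp0 : 0 ≤ (oddN n)⁻¹ ^ K := pow_nonneg (inv_nonneg.2 (oddN_pos n).le) _
  rcases lt_or_ge n N with hnN | hnN
  · calc _ ≤ |D n| := (hD n s hs).trans (le_abs_self _)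
      _ = |D n| * oddN n ^ K * (oddN n)⁻¹ ^ K := by
        rw [mul_assoc, ← mul_pow, mul_inv_cancel₀ (oddN_pos n).ne', one_pow, mul_one]
      _ ≤ _ := by
        refine mul_le_mul_of_nonneg_right ?_ hp0
        have := Finset.single_le_sum (f := fun n => |D n| * oddN n ^ K) (fun i _ => hS0 i)
          (Finset.mem_range.2 hnN)
        linarith
  · obtain ⟨hℓ, hsm⟩ := hN n hnN
    rw [hℓ]
    have hf : DiffContOnCl ℂ (fun u => Complex.exp (-s * L u)) (Metric.ball 0 (R / 2)) := by
      refine DifferentiableOn.diffContOnCl ?_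
      rw [closure_ball _ hr.ne']
      intro z hz
      have := (hLR z (hsub hz)).differentiableAt
      exact (this.const_mul (-s)).cexp.differentiableWithinAt
    have hb : ∀ z ∈ Metric.sphere (0 : ℂ) (R / 2), ‖Complex.exp (-s * L z)‖ ≤ M := by
      intro z hz
      rw [Complex.norm_exp, hMdef]
      refine Real.exp_le_exp.2 ((Complex.re_le_norm _).trans ?_)
      rw [norm_mul, norm_neg]
      refine mul_le_mul (hs.trans (le_abs_self _)) ?_ (norm_nonneg _) (abs_nonneg _)
      exact (hA z (Metric.sphere_subset_closedBall hz)).trans (le_abs_self _)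
    have := norm_taylor_remainder_le hr hf hb K (u := (oddN n : ℂ)⁻¹) (by rw [hnorm]; exact hsm)
    rw [hnorm] at this
    refine this.trans (mul_le_mul_of_nonneg_right ?_ hp0)
    have := Finset.sum_nonneg (s := Finset.range N) fun n _ => hS0 n
    linarith

/-- `d` is the zeta regularized determinant of an operator whose square has the eigenvalues `lam`,
and the zeta function vanishes at `0`. -/
def IsZetaDet {ι : Type} (lam : ι → ℝ) (d : ℝ) : Prop :=
  ∃ ζ : ℂ → ℂ, (∃ c : ℝ, ∀ s : ℂ, c < s.re → HasSum (fun i => (lam i : ℂ) ^ (-s / 2)) (ζ s)) ∧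
    Meromorphic ζ ∧ AnalyticAt ℂ ζ 0 ∧ ζ 0 = 0 ∧ (Real.log d : ℂ) = -deriv ζ 0

/-- The zeta function gets multiplied by C^(-s/2), and the resulting extra term in the derivative at
0 is proportional to ζ(0) = 0. -/
theorem IsZetaDet.scale {ι : Type} {lam : ι → ℝ} {d : ℝ} (h : IsZetaDet lam d)
    (hlam : ∀ i, 0 < lam i) {C : ℝ} (hC : 0 < C) : IsZetaDet (fun i => C * lam i) d := by
  obtain ⟨ζ, ⟨c, hc⟩, hm, ha, h0, hd⟩ := h
  have hCd : Differentiable ℂ fun s : ℂ => (C : ℂ) ^ (-s / 2) := fun s =>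
    ((differentiableAt_id.neg.div_const 2)).const_cpow (Or.inl (by exact_mod_cast hC.ne'))
  refine ⟨fun s => (C : ℂ) ^ (-s / 2) * ζ s, ⟨c, fun s hs => ?_⟩, fun x => ?_, ?_, by simp [h0], ?_⟩
  · refine ((hc s hs).mul_left ((C : ℂ) ^ (-s / 2))).congr_fun fun i => ?_
    push_cast
    rw [Complex.mul_cpow_ofReal_nonneg hC.le (hlam i).le]
  · exact (hCd.analyticAt x).meromorphicAt.mul (hm x)
  · exact (hCd.analyticAt 0).mul ha
  · rw [((hCd 0).hasDerivAt.fun_mul ha.differentiableAt.hasDerivAt).deriv, h0, hd]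
    simp
end

/-! ### The three regularized determinants. -/

noncomputable section

open Filter Topology

theorem oddN_sq_sub_two_ne (n : ℕ) : oddN n ^ 2 - 2 ≠ 0 := by
  rcases n with _ | n
  · norm_num [oddN]
  · have : (3 : ℝ) ≤ oddN (n + 1) := by
      unfold oddN; push_cast; linarith [n.cast_nonneg (α := ℝ)]
    nlinarith

theorem one_sub_two_div_sq (n : ℕ) : 1 + -2 / oddN n ^ 2 = (oddN n ^ 2 - 2) / oddN n ^ 2 := by
  have := (oddN_pos n).ne'
  field_simp
  ring

theorem one_sub_two_div_sq_ne (n : ℕ) : 1 + -2 / oddN n ^ 2 ≠ 0 := by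
  rw [one_sub_two_div_sq]
  exact div_ne_zero (oddN_sq_sub_two_ne n) (pow_ne_zero _ (oddN_pos n).ne')

/-- Divide Euler's product for sin(πx), cut after 2N factors, by the one for sin(πx/2), cut after N
factors. The odd denominators remain, and the double angle formula identifies the limit. -/
theorem tendsto_cos_prod {x : ℝ} (hx : Real.sin (Real.pi * (x / 2)) ≠ 0) :
    Tendsto (fun N => ∏ n ∈ Finset.range N, (1 - x ^ 2 / oddN n ^ 2)) atTop
      (𝓝 (Real.cos (Real.pi * (x / 2)))) := by
  have hx0 : x ≠ 0 := by rintro rfl; simp at hx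
  set f : ℕ → ℝ := fun j => 1 - x ^ 2 / ((j : ℝ) + 1) ^ 2 with hf
  have h1 := (Real.tendsto_euler_sin_prod x).comp
    (tendsto_id.const_mul_atTop' (two_pos : (0 : ℕ) < 2))
  have h2 := Real.tendsto_euler_sin_prod (x / 2)
  have h3 := (h1.div h2 hx).div_const 2
  -- Index j has denominator (j+1)², so even j give the odd denominators, while odd j reproduce the
  -- product for x/2.
  have hsplit : ∀ N, ∏ j ∈ Finset.range (2 * N), f j =
      (∏ n ∈ Finset.range N, (1 - x ^ 2 / oddN n ^ 2)) *
        ∏ j ∈ Finset.range N, (1 - (x / 2) ^ 2 / ((j : ℝ) + 1) ^ 2) := by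
    intro N
    induction N with
    | zero => simp
    | succ N ih =>
      rw [show 2 * (N + 1) = 2 * N + 1 + 1 by ring, Finset.prod_range_succ, Finset.prod_range_succ,
        ih, Finset.prod_range_succ, Finset.prod_range_succ]
      have e1 : f (2 * N) = 1 - x ^ 2 / oddN N ^ 2 := by simp [hf, oddN]
      have e2 : f (2 * N + 1) = 1 - (x / 2) ^ 2 / ((N : ℝ) + 1) ^ 2 := by
        simp only [hf]; push_cast
        have : ((2 : ℝ) * N + 1 + 1) = 2 * (N + 1) := by ring
        rw [this]
        have : (N : ℝ) + 1 ≠ 0 := by positivity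
        field_simp
      rw [e1, e2]; ring
  have hlim : Real.sin (Real.pi * x) / Real.sin (Real.pi * (x / 2)) / 2 =
      Real.cos (Real.pi * (x / 2)) := by
    rw [show Real.pi * x = 2 * (Real.pi * (x / 2)) by ring, Real.sin_two_mul]
    generalize Real.pi * (x / 2) = y at hx
    field_simp
  rw [hlim] at h3
  refine h3.congr' ?_
  filter_upwards [h2.eventually_ne hx] with N hN
  simp only [Pi.div_apply, Function.comp_apply, id]
  rw [hsplit N]
  have hN' := right_ne_zero_of_mul hN
  have hpi := Real.pi_ne_zero
  generalize ∏ j ∈ Finset.range N, (1 - (x / 2) ^ 2 / ((j : ℝ) + 1) ^ 2) = Q at hN'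
  field_simp

/-- The value `sin (π (√2 - 1) / 2)`. -/
theorem sin_pos_value : 0 < Real.sin (Real.pi * ((√2 - 1) / 2)) := by
  have h1 : (1 : ℝ) < √2 := by rw [Real.lt_sqrt] <;> norm_num
  have h2 : √2 < (2 : ℝ) := by rw [Real.sqrt_lt'] <;> norm_num
  have := Real.pi_pos
  refine Real.sin_pos_of_pos_of_lt_pi (by nlinarith) (by nlinarith)

theorem cos_eq_neg_sin_value :
    Real.cos (Real.pi * (√2 / 2)) = -Real.sin (Real.pi * ((√2 - 1) / 2)) := by
  rw [show Real.pi * ((√2 - 1) / 2) = Real.pi * (√2 / 2) - Real.pi / 2 by ring,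
    Real.sin_sub_pi_div_two, neg_neg]

theorem summable_log_one_sub :
    Summable fun n => Real.log (1 + -2 / oddN n ^ 2) := by
  refine Real.summable_log_one_add_of_summable ?_
  have := (summable_oddN_rpow (t := 2) (by norm_num)).mul_left (-2)
  refine this.congr fun n => ?_
  rw [Real.rpow_neg (oddN_pos n).le]
  norm_cast

/-- This is the cosine product at x = √2. Its only negative factor, 1 − 2 = −1 at n = 0, explains
the minus sign of the cosine and is ignored by `Real.log`. -/
theorem tsum_log_one_sub : ∑' n, Real.log (1 + -2 / oddN n ^ 2) =
    Real.log (Real.sin (Real.pi * ((√2 - 1) / 2))) := by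
  have hsin : Real.sin (Real.pi * (√2 / 2)) ≠ 0 := by
    have h1 : (0 : ℝ) < √2 := by positivity
    have h2 : √2 < (2 : ℝ) := by rw [Real.sqrt_lt'] <;> norm_num
    have := Real.pi_pos
    exact (Real.sin_pos_of_pos_of_lt_pi (by nlinarith) (by nlinarith)).ne'
  have h1 := tendsto_cos_prod hsin
  rw [cos_eq_neg_sin_value] at h1
  have h2 := h1.log (neg_ne_zero.2 sin_pos_value.ne')
  rw [Real.log_neg_eq_log] at h2
  refine tendsto_nhds_unique summable_log_one_sub.hasSum.tendsto_sum_nat (h2.congr fun N => ?_)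
  rw [Real.log_prod]
  · refine Finset.sum_congr rfl fun n _ => ?_
    rw [Real.sq_sqrt (by norm_num)]
    congr 1; ring
  · intro n _
    rw [Real.sq_sqrt (by norm_num)]
    have := one_sub_two_div_sq_ne n
    rwa [neg_div, ← sub_eq_add_neg] at this

/-- No correction factor is present, and a = 1/2 because an eigenvalue of D*D enters with the
exponent −s/2. -/
theorem isZetaDet_linear : IsZetaDet oddN ((2 : ℝ) ^ (1 / 4 : ℝ)) := by
  have hx := oddExpansion_exp (L := fun _ => 0) analyticAt_const (ℓ := fun _ => 0) (by simp)
  obtain ⟨ζ, hs, hm, ha, h0, hd⟩ := exists_zeta hx (a := 1 / 2) (by norm_num) (c := 1)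
    (by funext s; simp [iteratedDeriv_succ]) (by simp) (by simp)
  refine ⟨ζ, ⟨2, fun s hs2 => ?_⟩, hm, ha, h0, ?_⟩
  · refine (hs s (by linarith)).congr_fun fun n => ?_
    simp only [Complex.ofReal_zero, mul_zero, Complex.exp_zero, mul_one]
    congr 1; push_cast; ring
  · rw [hd, Real.log_rpow (by norm_num)]
    simp
    ring

theorem deriv_exp_neg_mul {c : ℂ} (n : ℂ) (hc : c = 1) :
    deriv (fun s : ℂ => Complex.exp (-s * n)) 0 = -n * c := by
  have : HasDerivAt (fun s : ℂ => Complex.exp (-s * n)) (Complex.exp (-0 * n) * (-1 * n)) 0 :=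
    ((hasDerivAt_id (0 : ℂ)).neg.mul_const n).cexp
  rw [this.deriv, hc]; simp

theorem coeff_zero_eq {L : ℂ → ℂ} (h0 : L 0 = 0) (s : ℂ) :
    ((Nat.factorial 0 : ℕ) : ℂ)⁻¹ * iteratedDeriv 0 (fun u => Complex.exp (-s * L u)) 0 = 1 := by
  simp [h0]

theorem coeff_one_eq {L : ℂ → ℂ} {d : ℂ} (h0 : L 0 = 0) (hd : HasDerivAt L d 0) (s : ℂ) :
    ((Nat.factorial 1 : ℕ) : ℂ)⁻¹ * iteratedDeriv 1 (fun u => Complex.exp (-s * L u)) 0 =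
      -s * d := by
  rw [iteratedDeriv_one, ((hd.const_mul (-s)).cexp).deriv, h0]
  simp

/-- Write m|m² − 2| = m³|1 − 2/m²|, so that a = 3/2 and the correction is half the logarithm of |1 −
2/m²|. It is even in 1/m, which makes the critical coefficient vanish. -/
theorem isZetaDet_cubic : IsZetaDet (fun n => oddN n * |oddN n ^ 2 - 2|)
    ((2 : ℝ) ^ (3 / 4 : ℝ) * √(Real.sin (Real.pi * ((√2 - 1) / 2)))) := by
  set L : ℂ → ℂ := fun u => Complex.log (1 - 2 * u ^ 2) / 2 with hLdef
  set ℓ : ℕ → ℝ := fun n => Real.log (1 + -2 / oddN n ^ 2) / 2 with hℓ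
  have hL : AnalyticAt ℂ L 0 := by
    refine AnalyticAt.div_const (AnalyticAt.clog ?_ ?_)
    · fun_prop
    · simp
  have hL0 : L 0 = 0 := by simp [hLdef]
  have hLd : HasDerivAt L 0 0 := by
    have h1 : HasDerivAt (fun u : ℂ => 1 - 2 * u ^ 2) 0 0 := by
      have := (((hasDerivAt_id (0 : ℂ)).pow 2).const_mul 2).const_sub 1
      simpa using this
    have := (h1.clog (by simp)).div_const 2
    simpa using this
  have hev : ∀ᶠ n in atTop, (ℓ n : ℂ) = L ((oddN n : ℂ)⁻¹) := by
    -- At n = 0 the argument of the logarithm is −1, where the real and complex logarithms disagree.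
    filter_upwards [eventually_ge_atTop 1] with n hn
    have h3 : (3 : ℝ) ≤ oddN n := by
      have : (1 : ℝ) ≤ n := by exact_mod_cast hn
      unfold oddN; linarith
    have hpos : 0 ≤ 1 + -2 / oddN n ^ 2 := by
      rw [one_sub_two_div_sq]
      exact div_nonneg (by nlinarith) (by positivity)
    simp only [hℓ, hLdef]
    push_cast [Complex.ofReal_log hpos]
    congr 2
    rw [inv_pow]; ring
  have hx := oddExpansion_exp hL hev
  obtain ⟨ζ, hs, hm, ha, h0, hd⟩ := exists_zeta hx (a := 3 / 2) (by norm_num) (c := 1)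
    (by funext s; rw [coeff_one_eq hL0 hLd]; simp) (fun s => coeff_zero_eq hL0 s) (by simp)
  have hexp : ∀ n, oddN n * |oddN n ^ 2 - 2| =
      Real.exp (3 * Real.log (oddN n) + 2 * ℓ n) := by
    intro n
    have hp := oddN_pos n
    rw [Real.exp_add, mul_comm 3, ← Real.rpow_def_of_pos hp]
    simp only [hℓ]
    rw [mul_div_cancel₀ _ two_ne_zero, Real.exp_log_eq_abs (one_sub_two_div_sq_ne n),
      one_sub_two_div_sq, abs_div, abs_of_pos (pow_pos hp 2)]
    norm_cast
    field_simp
  refine ⟨ζ, ⟨2, fun s hs2 => ?_⟩, hm, ha, h0, ?_⟩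
  · refine (hs s (by linarith)).congr_fun fun n => ?_
    simp only
    rw [hexp, Complex.ofReal_exp, Complex.cpow_def_of_ne_zero (oddN_ne_zero n),
      Complex.cpow_def_of_ne_zero (Complex.exp_ne_zero _), ← Complex.exp_add,
      ← Complex.ofReal_exp, ← Complex.ofReal_log (Real.exp_pos _).le, Real.log_exp,
      ← Complex.ofReal_log (oddN_pos n).le]
    congr 1; push_cast; ring
  · have hsp := sin_pos_value
    have h5 : ∑' n, deriv (fun s : ℂ => Complex.exp (-s * ℓ n)) 0 =
        ((-(Real.log (Real.sin (Real.pi * ((√2 - 1) / 2))) / 2) : ℝ) : ℂ) := by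
      rw [← tsum_log_one_sub, ← tsum_div_const, ← tsum_neg, Complex.ofReal_tsum]
      refine tsum_congr fun n => ?_
      rw [deriv_exp_neg_mul _ rfl]
      simp [hℓ]
    rw [hd, h5, Real.log_mul (by positivity) (by positivity), Real.log_rpow (by norm_num),
      Real.log_sqrt hsp.le]
    push_cast
    ring

/-- The logarithm of `√(1 + 9 u² / 8) + c u`. -/
def quadLog (c : ℂ) (u : ℂ) : ℂ :=
  Complex.log (Complex.exp (Complex.log (1 + 9 / 8 * u ^ 2) / 2) + c * u)

theorem quadLog_zero (c : ℂ) : quadLog c 0 = 0 := by simp [quadLog]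

theorem analyticAt_quadLog (c : ℂ) : AnalyticAt ℂ (quadLog c) 0 := by
  refine AnalyticAt.clog ?_ (by simp)
  refine AnalyticAt.add (AnalyticAt.cexp (AnalyticAt.div_const (AnalyticAt.clog ?_ (by simp)))) ?_
  · fun_prop
  · fun_prop

/-- The square root is even in u, so the slope comes from the linear term c u alone. -/
theorem hasDerivAt_quadLog (c : ℂ) : HasDerivAt (quadLog c) c 0 := by
  have h1 : HasDerivAt (fun u : ℂ => 1 + 9 / 8 * u ^ 2) 0 0 := by
    have := (((hasDerivAt_id (0 : ℂ)).pow 2).const_mul (9 / 8)).const_add 1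
    simpa using this
  have h2 := ((h1.clog (by simp)).div_const 2).cexp
  have h3 := (h2.add ((hasDerivAt_id (0 : ℂ)).const_mul c)).clog (by simp)
  have h4 : quadLog c = fun t => Complex.log
      (Complex.exp (Complex.log (1 + 9 / 8 * t ^ 2) / 2) + c * t) := rfl
  rw [h4]
  simpa using h3

/-- The factor `√(1 + 9 m⁻² / 8) + c m⁻¹` for odd `m`. -/
def quadFactor (c : ℝ) (n : ℕ) : ℝ := √(1 + 9 / 8 * (oddN n)⁻¹ ^ 2) + c * (oddN n)⁻¹

theorem eventually_quadFactor (c : ℝ) : ∀ᶠ n in atTop,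
    (Real.log (quadFactor c n) : ℂ) = quadLog c ((oddN n : ℂ)⁻¹) := by
  have h1 : Tendsto (fun n => quadFactor c n) atTop (𝓝 1) := by
    have h2 : Tendsto (fun u : ℝ => √(1 + 9 / 8 * u ^ 2) + c * u) (𝓝 0) (𝓝 1) := by
      have h3 : Continuous fun u : ℝ => √(1 + 9 / 8 * u ^ 2) + c * u := by fun_prop
      simpa using h3.tendsto 0
    exact h2.comp tendsto_oddN_inv
  filter_upwards [h1.eventually (lt_mem_nhds one_pos)] with n hn
  rw [Complex.ofReal_log hn.le, quadLog, quadFactor]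
  congr 1
  have h4 : (0 : ℝ) < 1 + 9 / 8 * (oddN n)⁻¹ ^ 2 := by positivity
  have h5 : √(1 + 9 / 8 * (oddN n)⁻¹ ^ 2) =
      Real.exp (Real.log (1 + 9 / 8 * (oddN n)⁻¹ ^ 2) / 2) := by
    rw [← Real.log_sqrt h4.le, Real.exp_log (Real.sqrt_pos.2 h4)]
  rw [h5]
  push_cast [Complex.ofReal_log h4.le]
  rfl

theorem quadFactor_eq (c : ℝ) (n : ℕ) : oddN n / √2 * quadFactor (c / √8) n =
    (√(8 * oddN n ^ 2 + 9) + c) / 4 := by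
  have hp := oddN_pos n
  have h8 : √8 = 2 * √2 := by
    rw [show (8 : ℝ) = 2 ^ 2 * 2 by norm_num, Real.sqrt_mul (by norm_num), Real.sqrt_sq (by norm_num)]
  have h2 : √2 * √2 = 2 := Real.mul_self_sqrt (by norm_num)
  have h20 : √2 ≠ 0 := by positivity
  have h9 : √(8 * oddN n ^ 2 + 9) = √8 * oddN n * √(1 + 9 / 8 * (oddN n)⁻¹ ^ 2) := by
    rw [← Real.sqrt_sq hp.le, mul_assoc, ← Real.sqrt_mul (by positivity),
      ← Real.sqrt_mul (by norm_num), Real.sqrt_sq hp.le]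
    congr 1
    field_simp
  rw [h9, quadFactor, h8]
  field_simp
  have : √2 ^ 2 = 2 := by rw [sq]; exact h2
  rw [this]; ring

/-- As (1 + 9/(8m²)) − 25/(8m²) = 1 − 2/m², the two branches together produce the same infinite
product as the cubic eigenvalues. -/
theorem quadFactor_mul (n : ℕ) :
    quadFactor (5 / √8) n * quadFactor (-5 / √8) n = 1 + -2 / oddN n ^ 2 := by
  have hp := (oddN_pos n).ne'
  have h8 : √8 ^ 2 = 8 := Real.sq_sqrt (by norm_num)
  have h80 : √8 ≠ 0 := by positivity
  have h : √(1 + 9 / 8 * (oddN n)⁻¹ ^ 2) ^ 2 = 1 + 9 / 8 * (oddN n)⁻¹ ^ 2 :=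
    Real.sq_sqrt (by positivity)
  unfold quadFactor
  have e : (√(1 + 9 / 8 * (oddN n)⁻¹ ^ 2) + 5 / √8 * (oddN n)⁻¹) *
      (√(1 + 9 / 8 * (oddN n)⁻¹ ^ 2) + -5 / √8 * (oddN n)⁻¹) =
      √(1 + 9 / 8 * (oddN n)⁻¹ ^ 2) ^ 2 - 25 / √8 ^ 2 * (oddN n)⁻¹ ^ 2 := by
    field_simp; ring
  rw [e, h, h8]
  field_simp
  ring

theorem quadFactor_ne (n : ℕ) : quadFactor (5 / √8) n ≠ 0 ∧ quadFactor (-5 / √8) n ≠ 0 := by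
  have := one_sub_two_div_sq_ne n
  rw [← quadFactor_mul] at this
  exact ⟨left_ne_zero_of_mul this, right_ne_zero_of_mul this⟩

/-- The eigenvalues of the second order operator, normalized. -/
def quadEigen (n : ℕ ⊕ ℕ) : ℝ :=
  Sum.elim (fun n => ((√(8 * oddN n ^ 2 + 9) + 5) / 4) ^ 2)
    (fun n => ((√(8 * oddN n ^ 2 + 9) - 5) / 4) ^ 2) n

/-- Each branch alone has a nonzero coefficient of 1/m. The coefficients for c = ±5/√8 are opposite,
so the branches are continued together with E(0, n) = 2. The common factor 1/√2 of the eigenvalue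
roots only contributes exp(s (log 2)/2), invisible because the zeta function vanishes at 0. -/
theorem isZetaDet_quad : IsZetaDet quadEigen (2 * Real.sin (Real.pi * ((√2 - 1) / 2))) := by
  have hexp : ∀ (c : ℝ) (n : ℕ), quadFactor (c / √8) n ≠ 0 → ∀ s : ℂ,
      ((((√(8 * oddN n ^ 2 + 9) + c) / 4) ^ 2 : ℝ) : ℂ) ^ (-s / 2) =
        Complex.exp (s * (Real.log 2 / 2 : ℝ)) * ((oddN n : ℂ) ^ (-(((1 : ℝ) : ℂ) * s)) *
          Complex.exp (-s * Real.log (quadFactor (c / √8) n))) := by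
    intro c n hne s
    have hp := oddN_pos n
    have h1 : ((√(8 * oddN n ^ 2 + 9) + c) / 4) ^ 2 =
        Real.exp (2 * Real.log (oddN n) - Real.log 2 + 2 * Real.log (quadFactor (c / √8) n)) := by
      rw [← quadFactor_eq, Real.exp_add, Real.exp_sub, Real.exp_log two_pos, mul_comm 2,
        mul_comm 2, Real.exp_mul, Real.exp_mul, Real.exp_log hp, Real.exp_log_eq_abs hne]
      norm_cast
      rw [sq_abs, mul_pow, div_pow, Real.sq_sqrt (by norm_num)]
    rw [h1, Complex.ofReal_exp, Complex.cpow_def_of_ne_zero (oddN_ne_zero n),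
      Complex.cpow_def_of_ne_zero (Complex.exp_ne_zero _), ← Complex.exp_add, ← Complex.exp_add,
      ← Complex.ofReal_exp, ← Complex.ofReal_log (Real.exp_pos _).le, Real.log_exp,
      ← Complex.ofReal_log (oddN_pos n).le]
    congr 1; push_cast; ring
  have hx := (oddExpansion_exp (analyticAt_quadLog _) (eventually_quadFactor (5 / √8))).add
    (oddExpansion_exp (analyticAt_quadLog _) (eventually_quadFactor (-5 / √8)))
  -- Separate convergence of each branch allows the sum over `ℕ ⊕ ℕ` to be assembled from the two
  -- halves.
  have hpart : ∀ c : ℝ, ∀ s : ℂ, 1 < s.re → Summable fun n => (oddN n : ℂ) ^ (-(((1 : ℝ) : ℂ) * s)) *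
      Complex.exp (-s * Real.log (quadFactor c n)) := by
    intro c s hs
    have := summable_zetaRem (K := 0) (a := 1)
      (oddExpansion_exp (analyticAt_quadLog _) (eventually_quadFactor c)) (s := s) (by simpa using hs)
    rwa [zetaRem_zero] at this
  obtain ⟨ζ, hs, hm, ha, h0, hd⟩ := exists_zeta hx (a := 1) (by norm_num) (c := 2)
    (by
      funext s
      rw [coeff_one_eq (quadLog_zero _) (hasDerivAt_quadLog _),
        coeff_one_eq (quadLog_zero _) (hasDerivAt_quadLog _)]
      push_cast
      simp only [Pi.zero_apply]
      ring)
    (fun s => by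
      rw [coeff_zero_eq (quadLog_zero _), coeff_zero_eq (quadLog_zero _)]; norm_num)
    (by intro n; norm_num)
  have hED : Differentiable ℂ fun s : ℂ => Complex.exp (s * (Real.log 2 / 2 : ℝ)) := by fun_prop
  refine ⟨fun s => Complex.exp (s * (Real.log 2 / 2 : ℝ)) * ζ s, ⟨2, fun s hs2 => ?_⟩,
    fun x => ?_, ?_, by simp [h0], ?_⟩
  · have hs1 : 1 < s.re := by linarith
    have hsum := hs s (by linarith)
    have h1 := (hpart (5 / √8) s hs1).hasSum
    have h2 := (hpart (-5 / √8) s hs1).hasSum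
    have h3 := hsum.unique ((h1.add h2).congr_fun fun n => by ring)
    beta_reduce
    rw [h3, mul_add]
    refine HasSum.sum ?_ ?_
    · refine (h1.mul_left _).congr_fun fun n => ?_
      simp only [Function.comp_apply, quadEigen, Sum.elim_inl]
      rw [hexp 5 n (quadFactor_ne n).1]
    · refine (h2.mul_left _).congr_fun fun n => ?_
      simp only [Function.comp_apply, quadEigen, Sum.elim_inr]
      have := hexp (-5) n (quadFactor_ne n).2 s
      rwa [← sub_eq_add_neg] at this
  · exact (hED.analyticAt x).meromorphicAt.mul (hm x)
  · exact (hED.analyticAt 0).mul ha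
  · have hsp := sin_pos_value
    have h5 : ∑' n, deriv (fun s : ℂ => Complex.exp (-s * Real.log (quadFactor (5 / √8) n)) +
        Complex.exp (-s * Real.log (quadFactor (-5 / √8) n))) 0 =
        ((-Real.log (Real.sin (Real.pi * ((√2 - 1) / 2))) : ℝ) : ℂ) := by
      rw [← tsum_log_one_sub, ← tsum_neg, Complex.ofReal_tsum]
      refine tsum_congr fun n => ?_
      rw [deriv_fun_add (by fun_prop) (by fun_prop), deriv_exp_neg_mul _ rfl,
        deriv_exp_neg_mul _ rfl, ← quadFactor_mul,
        Real.log_mul (quadFactor_ne n).1 (quadFactor_ne n).2]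
      push_cast; ring
    rw [((hED 0).hasDerivAt.fun_mul ha.differentiableAt.hasDerivAt).deriv, h0, hd, h5,
      Real.log_mul (by norm_num) hsp.ne']
    push_cast
    simp
    ring
end

/-! ### Eigenvectors on a dense core and Parseval's identity. -/

noncomputable section

open scoped InnerProductSpace

section eigensystem

variable {K X : Type*} [NormedAddCommGroup K] [InnerProductSpace ℂ K] [AddCommGroup X] [Module ℂ X]

/-- An orthogonal family `E` of eigenvectors of `T` with positive eigenvalues `lam`, which together
with the kernel of `T` spans a space containing the core `B`. -/
structure EigenSystem (J : X →ₗ[ℂ] K) (T : X →ₗ[ℂ] X) (B : Submodule ℂ X) {ι : Type}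
    (E : ι → X) (lam : ι → ℝ) : Prop where
  pos : ∀ i, 0 < lam i
  eigen : ∀ i, T (E i) = (lam i : ℂ) • E i
  ne : ∀ i, E i ≠ 0
  orth : ∀ i j, i ≠ j → ⟪J (E i), J (E j)⟫_ℂ = 0
  span : B ≤ Submodule.span ℂ (Set.range E) ⊔ LinearMap.ker T

theorem inner_eq_zero_of_eigen {J : X →ₗ[ℂ] K} {U : X →ₗ[ℂ] X}
    (hU : ∀ x y, ⟪J (U x), J y⟫_ℂ = ⟪J x, J (U y)⟫_ℂ) {x y : X} {s t : ℝ} (hst : s ≠ t)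
    (hx : U x = (s : ℂ) • x) (hy : U y = (t : ℂ) • y) : ⟪J x, J y⟫_ℂ = 0 := by
  have h := hU x y
  rw [hx, hy, map_smul, map_smul, inner_smul_left, inner_smul_right, Complex.conj_ofReal] at h
  have h2 : ((s : ℂ) - t) * ⟪J x, J y⟫_ℂ = 0 := by rw [sub_mul, h, sub_self]
  exact (mul_eq_zero.1 h2).resolve_left fun h => hst (by exact_mod_cast sub_eq_zero.1 h)

/-- Extend the orthonormal family to a Hilbert basis: the added vectors are orthogonal to the closed
span and contribute nothing to Parseval's identity. -/
theorem hasSum_norm_inner_sq_of_mem_closure [CompleteSpace K] {ι : Type*} {e : ι → K}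
    (he : Orthonormal ℂ e) {ψ : K} (hψ : ψ ∈ (Submodule.span ℂ (Set.range e)).topologicalClosure) :
    HasSum (fun i => ‖⟪e i, ψ⟫_ℂ‖ ^ 2) (‖ψ‖ ^ 2) := by
  obtain ⟨w, b, hw, hb⟩ := he.toSubtypeRange.exists_hilbertBasis_extension
  have h1 := b.hasSum_inner_mul_inner ψ ψ
  have h2 : HasSum (fun i : w => ‖⟪(i : K), ψ⟫_ℂ‖ ^ 2) (‖ψ‖ ^ 2) := by
    have h3 := Complex.hasSum_re h1
    rw [inner_self_eq_norm_sq_to_K] at h3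
    convert h3 using 1
    · funext i
      rw [hb, show ⟪ψ, (i : K)⟫_ℂ = (starRingEnd ℂ) ⟪(i : K), ψ⟫_ℂ from (inner_conj_symm _ _).symm,
        mul_comm, Complex.mul_conj, Complex.normSq_eq_norm_sq, Complex.ofReal_re]
    · norm_cast
  let σ : ι → w := fun i => ⟨e i, hw (Set.mem_range_self i)⟩
  have hσ : Function.Injective σ := fun i k h => he.linearIndependent.injective (congrArg Subtype.val h)
  refine (hσ.hasSum_iff fun i hi => ?_).2 h2
  have hperp : ∀ k, ⟪e k, (i : K)⟫_ℂ = 0 := by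
    intro k
    have hne : σ k ≠ i := fun h => hi ⟨k, h⟩
    have := b.orthonormal.2 hne
    rwa [hb] at this
  have hK : (i : K) ∈ (Submodule.span ℂ (Set.range e))ᗮ := by
    rw [Submodule.mem_orthogonal]
    intro u hu
    induction hu using Submodule.span_induction with
    | mem x hx => obtain ⟨k, rfl⟩ := hx; exact hperp k
    | zero => simp
    | add x y _ _ hx hy => rw [inner_add_left, hx, hy, add_zero]
    | smul c x _ hx => rw [inner_smul_left, hx, mul_zero]
  have h4 : ⟪(i : K), ψ⟫_ℂ = 0 := by
    rw [← Submodule.orthogonal_closure] at hK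
    exact Submodule.inner_left_of_mem_orthogonal hψ hK
  simp [h4]

/-- The component r of a range vector orthogonal to all eigenvectors is also orthogonal to the
kernel, hence to the total core, and so vanishes. No closedness or self-adjointness of T is needed,
only symmetry. -/
theorem EigenSystem.hasSum [CompleteSpace K] {J : X →ₗ[ℂ] K} {T : X →ₗ[ℂ] X} {B : Submodule ℂ X}
    {ι : Type} {E : ι → X} {lam : ι → ℝ} (h : EigenSystem J T B E lam)
    (hT : ∀ x y, ⟪J (T x), J y⟫_ℂ = ⟪J x, J (T y)⟫_ℂ)
    (hB : ∀ r : K, (∀ b ∈ B, ⟪J b, r⟫_ℂ = 0) → r = 0)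
    (hE : Orthonormal ℂ fun i => J (E i)) (φ : X) :
    HasSum (fun i => ‖⟪J (E i), J (T φ)⟫_ℂ‖ ^ 2) (‖J (T φ)‖ ^ 2) := by
  refine hasSum_norm_inner_sq_of_mem_closure hE ?_
  set S := (Submodule.span ℂ (Set.range fun i => J (E i))).topologicalClosure with hS
  have : CompleteSpace S := (Submodule.isClosed_topologicalClosure _).completeSpace_coe
  have hES : ∀ i, J (E i) ∈ S := fun i =>
    Submodule.le_topologicalClosure _ (Submodule.subset_span ⟨i, rfl⟩)
  set ψ := J (T φ) with hψ
  set r := ψ - S.starProjection ψ with hr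
  have hrS : ∀ x ∈ S, ⟪x, r⟫_ℂ = 0 := fun x hx =>
    Submodule.inner_right_of_mem_orthogonal hx (S.sub_starProjection_mem_orthogonal ψ)
  -- Symmetry makes kernel vectors orthogonal to the range, and to every eigenvector since its
  -- eigenvalue is nonzero; both pieces of r are covered.
  have hker : ∀ y ∈ LinearMap.ker T, ⟪J y, r⟫_ℂ = 0 := by
    intro y hy
    have hy0 : T y = 0 := hy
    have h1 : ⟪J y, ψ⟫_ℂ = 0 := by rw [hψ, ← hT, hy0]; simp
    have h2 : ∀ i, ⟪J (E i), J y⟫_ℂ = 0 := by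
      intro i
      have h3 := hT (E i) y
      rw [hy0, h.eigen, map_smul, inner_smul_left, map_zero, inner_zero_right] at h3
      refine (mul_eq_zero.1 h3).resolve_left ?_
      rw [Complex.conj_ofReal]
      exact_mod_cast (h.pos i).ne'
    have h4 : J y ∈ Sᗮ := by
      rw [hS, Submodule.orthogonal_closure, Submodule.mem_orthogonal]
      intro u hu
      induction hu using Submodule.span_induction with
      | mem x hx => obtain ⟨k, rfl⟩ := hx; exact h2 k
      | zero => simp
      | add x y _ _ hx hy => rw [inner_add_left, hx, hy, add_zero]
      | smul c x _ hx => rw [inner_smul_left, hx, mul_zero]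
    rw [hr, inner_sub_right, h1, Submodule.inner_left_of_mem_orthogonal
      (S.starProjection_apply_mem ψ) h4, sub_zero]
  have hr0 : r = 0 := by
    refine hB r fun b hb => ?_
    obtain ⟨x, hx, y, hy, rfl⟩ := Submodule.mem_sup.1 (h.span hb)
    rw [map_add, inner_add_left, hker y hy, add_zero]
    refine hrS _ ?_
    clear hb
    induction hx using Submodule.span_induction with
    | mem x hx => obtain ⟨k, rfl⟩ := hx; exact hES k
    | zero => simp
    | add x y _ _ hx hy => rw [map_add]; exact S.add_mem hx hy
    | smul c x _ hx => rw [map_smul]; exact S.smul_mem c hx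
  rw [sub_eq_zero.1 hr0]
  exact S.starProjection_apply_mem ψ

/-- D maps the nonzero eigenspaces of D'D onto those of DD'. This turns the spectra in degrees 1 and
0 into those in degrees 3 and 4. -/
theorem EigenSystem.dual {K' Y : Type*} [NormedAddCommGroup K'] [InnerProductSpace ℂ K']
    [AddCommGroup Y] [Module ℂ Y] {J : X →ₗ[ℂ] K} {J' : Y →ₗ[ℂ] K'} (hJ : Function.Injective J)
    (hJ' : Function.Injective J')
    {D : X →ₗ[ℂ] Y} {D' : Y →ₗ[ℂ] X} (hD : ∀ x y, ⟪J' (D x), J' y⟫_ℂ = ⟪J x, J (D' y)⟫_ℂ)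
    {B : Submodule ℂ X} {ι : Type} {E : ι → X} {lam : ι → ℝ}
    (h : EigenSystem J (D' ∘ₗ D) B E lam) {B' : Submodule ℂ Y} (hB : B' ≤ B.comap D') :
    EigenSystem J' (D ∘ₗ D') B' (fun i => D (E i)) lam := by
  have heig : ∀ i, D' (D (E i)) = (lam i : ℂ) • E i := h.eigen
  have hlam : ∀ i, (lam i : ℂ) ≠ 0 := fun i => by exact_mod_cast (h.pos i).ne'
  refine ⟨h.pos, fun i => ?_, fun i h0 => ?_, fun i k hik => ?_, fun b hb => ?_⟩
  · simp [heig]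
  · have := heig i
    rw [h0, map_zero] at this
    exact (smul_ne_zero (hlam i) (h.ne i)) this.symm
  · rw [hD, heig, map_smul, inner_smul_right, h.orth i k hik, mul_zero]
  · obtain ⟨x, hx, n, hn, hxn⟩ := Submodule.mem_sup.1 (h.span (hB hb))
    have hrange : ∀ x ∈ Submodule.span ℂ (Set.range E), ∃ y ∈ Submodule.span ℂ
        (Set.range fun i => D (E i)), D' y = x := by
      intro x hx
      induction hx using Submodule.span_induction with
      | mem x hx =>
        obtain ⟨i, rfl⟩ := hx
        refine ⟨(lam i : ℂ)⁻¹ • D (E i), Submodule.smul_mem _ _ (Submodule.subset_span ⟨i, rfl⟩), ?_⟩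
        rw [map_smul, heig, inv_smul_smul₀ (hlam i)]
      | zero => exact ⟨0, Submodule.zero_mem _, map_zero _⟩
      | add x y _ _ hx hy =>
        obtain ⟨p, hp, rfl⟩ := hx
        obtain ⟨q, hq, rfl⟩ := hy
        exact ⟨p + q, Submodule.add_mem _ hp hq, map_add _ _ _⟩
      | smul c x _ hx =>
        obtain ⟨p, hp, rfl⟩ := hx
        exact ⟨c • p, Submodule.smul_mem _ _ hp, map_smul _ _ _⟩
    obtain ⟨y, hy, rfl⟩ := hrange x hx
    have hDn : D n = 0 := by
      have h1 : D' (D n) = 0 := hn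
      have h2 := hD n (D n)
      rw [h1, map_zero, inner_zero_right, inner_self_eq_zero] at h2
      exact hJ' (by rw [h2, map_zero])
    -- The vector n lies both in the kernel of D and in the range of D', which are orthogonal.
    have hn0 : n = 0 := by
      have h1 : n = D' (b - y) := by rw [map_sub, ← hxn, add_sub_cancel_left]
      have h2 := hD n (b - y)
      rw [hDn, map_zero, inner_zero_left, ← h1] at h2
      exact hJ (by rw [inner_self_eq_zero.1 h2.symm, map_zero])
    refine Submodule.mem_sup.2 ⟨y, hy, b - y, ?_, by abel⟩
    rw [LinearMap.mem_ker, LinearMap.comp_apply, map_sub, ← hxn, hn0, add_zero, sub_self, map_zero]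

end eigensystem
end

/-! ### Harmonic oscillators and the model complex. -/

noncomputable section

open scoped InnerProductSpace

/-- A harmonic oscillator: lowering and raising operators `a` and `ad` on a dense subspace `V` of a
Hilbert space, and the states `H n = ad ^ n (H 0)` which are total. -/
structure Oscillator {V K : Type*} [AddCommGroup V] [Module ℂ V] [NormedAddCommGroup K]
    [InnerProductSpace ℂ K] (j : V →ₗ[ℂ] K) (a ad : V →ₗ[ℂ] V) (H : ℕ → V) : Prop where
  inj : Function.Injective j
  comm : ∀ f, a (ad f) = ad (a f) + f
  adj : ∀ f g, ⟪j (a f), j g⟫_ℂ = ⟪j f, j (ad g)⟫_ℂ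
  lower_zero : a (H 0) = 0
  raise : ∀ n, ad (H n) = H (n + 1)
  ne_zero : H 0 ≠ 0
  total : ∀ r, (∀ n, ⟪j (H n), r⟫_ℂ = 0) → r = 0

namespace Oscillator

variable {V K : Type*} [AddCommGroup V] [Module ℂ V] [NormedAddCommGroup K]
    [InnerProductSpace ℂ K] {j : V →ₗ[ℂ] K} {a ad : V →ₗ[ℂ] V} {H : ℕ → V}

section basics

variable (h : Oscillator j a ad H)
include h

theorem adj' (f g : V) : ⟪j (ad f), j g⟫_ℂ = ⟪j f, j (a g)⟫_ℂ := by
  rw [← inner_conj_symm, ← h.adj, inner_conj_symm]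

theorem lower (n : ℕ) : a (H (n + 1)) = ((n : ℂ) + 1) • H n := by
  induction n with
  | zero => rw [← h.raise, h.comm, h.lower_zero, map_zero]; simp
  | succ n ih => rw [← h.raise, h.comm, ih, map_smul, h.raise]; push_cast; module

theorem number (n : ℕ) : ad (a (H n)) = (n : ℂ) • H n := by
  rcases n with _ | n
  · simp [h.lower_zero]
  · rw [h.lower, map_smul, h.raise]; push_cast; rfl

/-- The commutation relation lowers the number eigenvalue by one. Leaving `a x` unevaluated avoids
separate treatment of the lowest states in the block computations. -/
theorem number_lower {x : V} {c : ℂ} (hx : ad (a x) = c • x) : ad (a (a x)) = (c - 1) • a x := by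
  have := h.comm (a x)
  rw [hx, map_smul] at this
  rw [sub_smul, one_smul, this, add_sub_cancel_right]

theorem number₂ (n : ℕ) : ad (a (a (H n))) = ((n : ℂ) - 1) • a (H n) :=
  h.number_lower (h.number n)

theorem number₃ (n : ℕ) : ad (a (a (a (H n)))) = ((n : ℂ) - 2) • a (a (H n)) := by
  rw [h.number_lower (h.number₂ n)]; congr 1; ring

theorem H_ne (n : ℕ) : H n ≠ 0 := by
  induction n with
  | zero => exact h.ne_zero
  | succ n ih =>
    intro h0
    have := h.lower n
    rw [h0, map_zero] at this
    exact (smul_ne_zero (by exact_mod_cast n.succ_ne_zero) ih) this.symm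

end basics

/-- The Hilbert space valued embedding of pairs. -/
def J2 (j : V →ₗ[ℂ] K) : V × V →ₗ[ℂ] PiLp 2 (fun _ : Fin 2 => K) :=
  (WithLp.linearEquiv 2 ℂ (Fin 2 → K)).symm.toLinearMap ∘ₗ
    LinearMap.pi ![j ∘ₗ LinearMap.fst ℂ V V, j ∘ₗ LinearMap.snd ℂ V V]

/-- The Hilbert space valued embedding of symmetric `2`-tensors. -/
def J3 (j : V →ₗ[ℂ] K) : V × V × V →ₗ[ℂ] PiLp 2 (fun _ : Fin 3 => K) :=
  (WithLp.linearEquiv 2 ℂ (Fin 3 → K)).symm.toLinearMap ∘ₗ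
    LinearMap.pi ![j ∘ₗ LinearMap.fst ℂ V (V × V),
      ((√2 : ℝ) : ℂ) • (j ∘ₗ LinearMap.fst ℂ V V ∘ₗ LinearMap.snd ℂ V (V × V)),
      j ∘ₗ LinearMap.snd ℂ V V ∘ₗ LinearMap.snd ℂ V (V × V)]

theorem J2_apply (j : V →ₗ[ℂ] K) (x : V × V) : J2 j x = WithLp.toLp 2 ![j x.1, j x.2] := by
  ext i; fin_cases i <;> rfl

theorem J3_apply (j : V →ₗ[ℂ] K) (x : V × V × V) :
    J3 j x = WithLp.toLp 2 ![j x.1, ((√2 : ℝ) : ℂ) • j x.2.1, j x.2.2] := by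
  ext i; fin_cases i <;> rfl

theorem inner_J2 (x y : V × V) :
    ⟪J2 j x, J2 j y⟫_ℂ = ⟪j x.1, j y.1⟫_ℂ + ⟪j x.2, j y.2⟫_ℂ := by
  rw [J2_apply, J2_apply, PiLp.inner_apply, Fin.sum_univ_two]; rfl

/-- The weight 2 records that the mixed coefficient of a symmetric 2-tensor occurs twice. It is also
the weight for which `d1'` is adjoint to `d1` and `d2` is symmetric. -/
theorem inner_J3 (x y : V × V × V) :
    ⟪J3 j x, J3 j y⟫_ℂ =
      ⟪j x.1, j y.1⟫_ℂ + 2 * ⟪j x.2.1, j y.2.1⟫_ℂ + ⟪j x.2.2, j y.2.2⟫_ℂ := by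
  rw [J3_apply, J3_apply, PiLp.inner_apply, Fin.sum_univ_three]
  have h2 : ((√2 : ℝ) : ℂ) * ((√2 : ℝ) : ℂ) = 2 := by
    rw [← Complex.ofReal_mul, Real.mul_self_sqrt (by norm_num)]; simp
  simp only [Matrix.cons_val_zero, Matrix.cons_val_one, Matrix.cons_val]
  rw [inner_smul_left, inner_smul_right, Complex.conj_ofReal, ← mul_assoc, h2]

theorem J2_injective (hj : Function.Injective j) : Function.Injective (J2 j) := by
  intro x y hxy
  rw [J2_apply, J2_apply] at hxy
  have h := (WithLp.toLp_injective 2) hxy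
  have h0 := congrFun h 0
  have h1 := congrFun h 1
  exact Prod.ext (hj h0) (hj h1)

theorem J3_injective (hj : Function.Injective j) : Function.Injective (J3 j) := by
  intro x y hxy
  rw [J3_apply, J3_apply] at hxy
  have h := (WithLp.toLp_injective 2) hxy
  have h0 := congrFun h 0
  have h1 := congrFun h 1
  have h2 := congrFun h 2
  have h20 : ((√2 : ℝ) : ℂ) ≠ 0 := by
    rw [Ne, Complex.ofReal_eq_zero, Real.sqrt_eq_zero (by norm_num)]; norm_num
  exact Prod.ext (hj h0) (Prod.ext (hj (smul_right_injective _ h20 h1)) (hj h2))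

/-- The span of the states `H n`. -/
def core (H : ℕ → V) : Submodule ℂ V := Submodule.span ℂ (Set.range H)

theorem mem_core (H : ℕ → V) (n : ℕ) : H n ∈ core H := Submodule.subset_span ⟨n, rfl⟩

/-- The span of the states in the space of pairs. -/
def core2 (H : ℕ → V) : Submodule ℂ (V × V) := (core H).prod (core H)

/-- The span of the states in the space of triples. -/
def core3 (H : ℕ → V) : Submodule ℂ (V × V × V) := (core H).prod ((core H).prod (core H))

theorem core2_le {H : ℕ → V} {S : Submodule ℂ (V × V)} (h1 : ∀ n, (H n, 0) ∈ S)
    (h2 : ∀ n, (0, H n) ∈ S) : core2 H ≤ S := by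
  rintro ⟨x, y⟩ ⟨hx, hy⟩
  have hx' : core H ≤ S.comap (LinearMap.inl ℂ V V) := by
    refine Submodule.span_le.2 ?_
    rintro _ ⟨n, rfl⟩
    exact h1 n
  have hy' : core H ≤ S.comap (LinearMap.inr ℂ V V) := by
    refine Submodule.span_le.2 ?_
    rintro _ ⟨n, rfl⟩
    exact h2 n
  simpa using S.add_mem (hx' hx) (hy' hy)

theorem core3_le {H : ℕ → V} {S : Submodule ℂ (V × V × V)} (h1 : ∀ n, (H n, 0, 0) ∈ S)
    (h2 : ∀ n, (0, H n, 0) ∈ S) (h3 : ∀ n, (0, 0, H n) ∈ S) : core3 H ≤ S := by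
  rintro ⟨x, y⟩ ⟨hx, hy⟩
  have hx' : core H ≤ S.comap (LinearMap.inl ℂ V (V × V)) := by
    refine Submodule.span_le.2 ?_
    rintro _ ⟨n, rfl⟩
    exact h1 n
  have hy' : core2 H ≤ S.comap (LinearMap.inr ℂ V (V × V)) :=
    core2_le (fun n => h2 n) (fun n => h3 n)
  simpa using S.add_mem (hx' hx) (hy' hy)

theorem total1 (h : Oscillator j a ad H) (r : K) (hr : ∀ b ∈ core H, ⟪j b, r⟫_ℂ = 0) : r = 0 :=
  h.total r fun n => hr _ (mem_core H n)

theorem total2 (h : Oscillator j a ad H) (r : PiLp 2 (fun _ : Fin 2 => K))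
    (hr : ∀ b ∈ core2 H, ⟪J2 j b, r⟫_ℂ = 0) : r = 0 := by
  ext i
  refine h.total _ fun n => ?_
  fin_cases i
  · simpa [J2_apply, PiLp.inner_apply, Fin.sum_univ_two] using
      hr (H n, 0) ⟨mem_core H n, Submodule.zero_mem _⟩
  · simpa [J2_apply, PiLp.inner_apply, Fin.sum_univ_two] using
      hr (0, H n) ⟨Submodule.zero_mem _, mem_core H n⟩

theorem total3 (h : Oscillator j a ad H) (r : PiLp 2 (fun _ : Fin 3 => K))
    (hr : ∀ b ∈ core3 H, ⟪J3 j b, r⟫_ℂ = 0) : r = 0 := by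
  ext i
  refine h.total _ fun n => ?_
  fin_cases i
  · simpa [J3_apply, PiLp.inner_apply, Fin.sum_univ_three] using
      hr (H n, 0, 0) ⟨mem_core H n, Submodule.zero_mem _, Submodule.zero_mem _⟩
  · have := hr (0, H n, 0) ⟨Submodule.zero_mem _, mem_core H n, Submodule.zero_mem _⟩
    rw [J3_apply, PiLp.inner_apply, Fin.sum_univ_three] at this
    simp only [Matrix.cons_val_zero, Matrix.cons_val_one, Matrix.cons_val, map_zero,
      inner_zero_left, zero_add, add_zero] at this
    rw [inner_smul_left, Complex.conj_ofReal] at this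
    refine (mul_eq_zero.1 this).resolve_left ?_
    rw [Complex.ofReal_eq_zero, Real.sqrt_eq_zero (by norm_num)]
    norm_num
  · simpa [J3_apply, PiLp.inner_apply, Fin.sum_univ_three] using
      hr (0, 0, H n) ⟨Submodule.zero_mem _, Submodule.zero_mem _, mem_core H n⟩

section operators

variable (a ad)

/-- The model of the Rumin differential in degree `0`. -/
def d0 : V →ₗ[ℂ] V × V := ad.prod (-a)

/-- The formal adjoint of `d0`. -/
def d0' : V × V →ₗ[ℂ] V := a ∘ₗ LinearMap.fst ℂ V V - ad ∘ₗ LinearMap.snd ℂ V V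

/-- The model of the Rumin differential in degree `1`. -/
def d1 : V × V →ₗ[ℂ] V × V × V :=
  let g : V × V →ₗ[ℂ] V := a ∘ₗ LinearMap.fst ℂ V V + ad ∘ₗ LinearMap.snd ℂ V V
  (ad ∘ₗ (ad ∘ₗ g - LinearMap.fst ℂ V V)).prod
    ((-(ad ∘ₗ (a ∘ₗ g + LinearMap.snd ℂ V V))).prod (a ∘ₗ (a ∘ₗ g + LinearMap.snd ℂ V V)))

/-- The formal adjoint of `d1`. -/
def d1' : V × V × V →ₗ[ℂ] V × V :=
  let P : V × V × V →ₗ[ℂ] V := a ∘ₗ LinearMap.fst ℂ V (V × V) -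
    ad ∘ₗ LinearMap.fst ℂ V V ∘ₗ LinearMap.snd ℂ V (V × V)
  let Q : V × V × V →ₗ[ℂ] V := a ∘ₗ LinearMap.fst ℂ V V ∘ₗ LinearMap.snd ℂ V (V × V) -
    ad ∘ₗ LinearMap.snd ℂ V V ∘ₗ LinearMap.snd ℂ V (V × V)
  (ad ∘ₗ (a ∘ₗ P - ad ∘ₗ Q) - P).prod (a ∘ₗ (a ∘ₗ P - ad ∘ₗ Q) - Q)

/-- The model of the Rumin differential in degree `2`, a symmetric operator. -/
def d2 : V × V × V →ₗ[ℂ] V × V × V :=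
  let A : V × V × V →ₗ[ℂ] V := LinearMap.fst ℂ V (V × V)
  let B : V × V × V →ₗ[ℂ] V := LinearMap.fst ℂ V V ∘ₗ LinearMap.snd ℂ V (V × V)
  let C : V × V × V →ₗ[ℂ] V := LinearMap.snd ℂ V V ∘ₗ LinearMap.snd ℂ V (V × V)
  (ad ∘ₗ a ∘ₗ A - A + ad ∘ₗ ad ∘ₗ B).prod
    (((1 / 2 : ℂ) • (a ∘ₗ a ∘ₗ A - ad ∘ₗ ad ∘ₗ C) + (3 / 2 : ℂ) • B).prod
      (-(a ∘ₗ a ∘ₗ B) - (ad ∘ₗ a ∘ₗ C + (2 : ℂ) • C)))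

theorem d0_apply (f : V) : d0 a ad f = (ad f, -a f) := rfl

theorem d0'_apply (u v : V) : d0' a ad (u, v) = a u - ad v := rfl

theorem d1_apply (u v : V) : d1 a ad (u, v) = (ad (ad (a u + ad v) - u),
    -ad (a (a u + ad v) + v), a (a (a u + ad v) + v)) := rfl

theorem d1'_apply (A B C : V) : d1' a ad (A, B, C) =
    (ad (a (a A - ad B) - ad (a B - ad C)) - (a A - ad B),
      a (a (a A - ad B) - ad (a B - ad C)) - (a B - ad C)) := rfl

theorem d2_apply (A B C : V) : d2 a ad (A, B, C) = (ad (a A) - A + ad (ad B),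
    (1 / 2 : ℂ) • (a (a A) - ad (ad C)) + (3 / 2 : ℂ) • B,
    -(a (a B)) - (ad (a C) + (2 : ℂ) • C)) := rfl

end operators

section adjoints

variable (h : Oscillator j a ad H)
include h

theorem d0_adj (x : V) (y : V × V) : ⟪J2 j (d0 a ad x), J2 j y⟫_ℂ = ⟪j x, j (d0' a ad y)⟫_ℂ := by
  obtain ⟨u, v⟩ := y
  simp only [inner_J2, d0_apply, d0'_apply, map_neg, map_sub, inner_neg_left, inner_sub_right,
    h.adj, h.adj']
  ring

theorem d1_adj (x : V × V) (y : V × V × V) :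
    ⟪J3 j (d1 a ad x), J3 j y⟫_ℂ = ⟪J2 j x, J2 j (d1' a ad y)⟫_ℂ := by
  obtain ⟨u, v⟩ := x
  obtain ⟨A, B, C⟩ := y
  simp only [inner_J2, inner_J3, d1_apply, d1'_apply, map_neg, map_sub, map_add, inner_neg_left,
    inner_sub_right, inner_add_left, inner_sub_left, inner_add_right, h.adj, h.adj', h.comm]
  ring

theorem d2_adj (x y : V × V × V) :
    ⟪J3 j (d2 a ad x), J3 j y⟫_ℂ = ⟪J3 j x, J3 j (d2 a ad y)⟫_ℂ := by
  obtain ⟨A, B, C⟩ := x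
  obtain ⟨A', B', C'⟩ := y
  simp only [inner_J3, d2_apply, map_neg, map_sub, map_add, inner_neg_left, inner_neg_right,
    inner_sub_right, inner_add_left, inner_sub_left, inner_add_right, h.adj, h.adj', map_smul,
    inner_smul_left, inner_smul_right, map_div₀, map_one, map_ofNat]
  ring

/-- The complex property, here and for `d2_d1`, supplies kernel vectors: images of one differential
complete the eigenvectors of the next to a spanning set. -/
theorem d1_d0 (f : V) : d1 a ad (d0 a ad f) = 0 := by
  simp only [d0_apply, d1_apply, map_neg, map_sub, map_add, h.comm, Prod.mk_eq_zero]
  refine ⟨?_, ?_, ?_⟩ <;> abel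

theorem d2_d1 (x : V × V) : d2 a ad (d1 a ad x) = 0 := by
  obtain ⟨u, v⟩ := x
  simp only [d2_apply, d1_apply, map_neg, map_sub, map_add, h.comm, Prod.mk_eq_zero]
  refine ⟨?_, ?_, ?_⟩ <;> module

theorem d1'_mem : core3 H ≤ (core2 H).comap (d1' a ad) := by
  have hcore : core H ≤ (core H).comap a := by
    refine Submodule.span_le.2 ?_
    rintro _ ⟨n, rfl⟩
    rcases n with _ | n
    · simp [h.lower_zero]
    · simpa [h.lower] using (core H).smul_mem _ (mem_core H n)
  have hcore' : core H ≤ (core H).comap ad := by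
    refine Submodule.span_le.2 ?_
    rintro _ ⟨n, rfl⟩
    simpa [h.raise] using mem_core H (n + 1)
  rintro ⟨A, B, C⟩ ⟨hA, hB, hC⟩
  have hP := (core H).sub_mem (hcore hA) (hcore' hB)
  have hQ := (core H).sub_mem (hcore hB) (hcore' hC)
  have hR := (core H).sub_mem (hcore hP) (hcore' hQ)
  exact ⟨(core H).sub_mem (hcore' hR) hP, (core H).sub_mem (hcore hR) hQ⟩

theorem d0'_mem : core2 H ≤ (core H).comap (d0' a ad) := by
  refine core2_le (fun n => ?_) (fun n => ?_)
  · rw [Submodule.mem_comap, d0'_apply, map_zero, sub_zero]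
    rcases n with _ | n
    · simp [h.lower_zero]
    · simpa [h.lower] using (core H).smul_mem _ (mem_core H n)
  · rw [Submodule.mem_comap, d0'_apply, map_zero, zero_sub, h.raise]
    exact (core H).neg_mem (mem_core H _)

end adjoints

end Oscillator
end

/-! ### Spectra of the model operators. -/

noncomputable section

open scoped InnerProductSpace

namespace Oscillator

variable {V K : Type*} [AddCommGroup V] [Module ℂ V] [NormedAddCommGroup K]
    [InnerProductSpace ℂ K] {j : V →ₗ[ℂ] K} {a ad : V →ₗ[ℂ] V} {H : ℕ → V}

theorem oddN_injective : Function.Injective oddN := by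
  intro m n h
  simpa [oddN] using h

/-- Here `d0' ∘ d0` is a∘ad + ad∘a, that is, twice the number operator plus one. -/
theorem eigenSystem_d0 (h : Oscillator j a ad H) :
    EigenSystem j (d0' a ad ∘ₗ d0 a ad) (core H) H oddN := by
  have heig : ∀ n, (d0' a ad ∘ₗ d0 a ad) (H n) = (oddN n : ℂ) • H n := by
    intro n
    simp only [LinearMap.comp_apply, d0_apply, d0'_apply, map_neg, h.comm, h.number, oddN]
    push_cast
    module
  have hsym : ∀ x y, ⟪j ((d0' a ad ∘ₗ d0 a ad) x), j y⟫_ℂ =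
      ⟪j x, j ((d0' a ad ∘ₗ d0 a ad) y)⟫_ℂ := by
    intro x y
    rw [LinearMap.comp_apply, LinearMap.comp_apply, ← h.d0_adj, ← inner_conj_symm, ← h.d0_adj,
      inner_conj_symm]
  exact ⟨oddN_pos, heig, h.H_ne,
    fun m n hmn => inner_eq_zero_of_eigen hsym (oddN_injective.ne hmn) (heig m) (heig n),
    le_sup_left⟩

/-- Eigenvectors of `d1' ∘ d1`. -/
def state1 (H : ℕ → V) : ℕ → V × V
  | 0 => (H 0, 0)
  | n + 1 => (H (n + 2), ((n : ℂ) + 2) • H n)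

/-- The normalized eigenvalues of the third order operators. -/
def cubicEigen (n : ℕ) : ℝ := oddN n * |oddN n ^ 2 - 2|

theorem cubicEigen_succ (n : ℕ) :
    cubicEigen (n + 1) = (2 * n + 3) * ((2 * n + 3) ^ 2 - 2) := by
  have h0 : (0 : ℝ) ≤ n := n.cast_nonneg
  have h1 : oddN (n + 1) = 2 * n + 3 := by unfold oddN; push_cast; ring
  rw [cubicEigen, h1, abs_of_pos (by nlinarith)]

theorem cubicEigen_zero : cubicEigen 0 = 1 := by
  norm_num [cubicEigen, oddN]

theorem cubicEigen_pos (n : ℕ) : 0 < cubicEigen n :=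
  mul_pos (oddN_pos n) (abs_pos.2 (oddN_sq_sub_two_ne n))

/-- Simple eigenvalues make the eigenvectors of the symmetric operator automatically orthogonal. The
exceptional value 1 at n = 0 still lies below the next one, 21. -/
theorem cubicEigen_strictMono : StrictMono cubicEigen := by
  refine strictMono_nat_of_lt_succ fun n => ?_
  rcases n with _ | n
  · rw [cubicEigen_succ, cubicEigen_zero]; norm_num
  · rw [cubicEigen_succ, cubicEigen_succ]
    have h0 : (0 : ℝ) ≤ n := n.cast_nonneg
    push_cast
    gcongr <;> nlinarith

/-- The plane of (H (n+2), 0) and (0, H n) is invariant and contains `d0 (H (n+1))` as a kernel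
vector; the state of index n + 1 spans its orthogonal complement there, as the norms squared of the
H k are proportional to k!. Outside these planes there remain (H 0, 0), the eigenvector with
eigenvalue 1, and (H 1, 0) = `d0 (H 0)`, in the kernel. -/
theorem eigenSystem_d1 (h : Oscillator j a ad H) :
    EigenSystem (J2 j) (d1' a ad ∘ₗ d1 a ad) (core2 H) (state1 H) cubicEigen := by
  have heig : ∀ n, (d1' a ad ∘ₗ d1 a ad) (state1 H n) = (cubicEigen n : ℂ) • state1 H n := by
    intro n
    rcases n with _ | n
    · rw [cubicEigen_zero]
      simp only [state1, LinearMap.comp_apply, d1_apply, d1'_apply, map_zero, map_neg, map_sub,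
        map_add, h.comm, h.lower_zero, Prod.smul_mk]
      simp
    · rw [cubicEigen_succ]
      simp only [state1, LinearMap.comp_apply, d1_apply, d1'_apply, map_neg, map_sub,
        map_add, map_smul, h.lower, h.number, h.raise, Prod.smul_mk]
      refine Prod.ext ?_ ?_ <;> simp only <;> push_cast <;> module
  have hsym : ∀ x y, ⟪J2 j ((d1' a ad ∘ₗ d1 a ad) x), J2 j y⟫_ℂ =
      ⟪J2 j x, J2 j ((d1' a ad ∘ₗ d1 a ad) y)⟫_ℂ := by
    intro x y
    rw [LinearMap.comp_apply, LinearMap.comp_apply, ← h.d1_adj, ← inner_conj_symm, ← h.d1_adj,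
      inner_conj_symm]
  refine ⟨cubicEigen_pos, heig, fun n => ?_, fun m n hmn => inner_eq_zero_of_eigen hsym
    (cubicEigen_strictMono.injective.ne hmn) (heig m) (heig n), ?_⟩
  · rcases n with _ | n <;> exact fun h0 => h.H_ne _ (congrArg Prod.fst h0)
  set S := Submodule.span ℂ (Set.range (state1 H)) ⊔ LinearMap.ker (d1' a ad ∘ₗ d1 a ad)
  have hE : ∀ n, state1 H n ∈ S := fun n => Submodule.mem_sup_left (Submodule.subset_span ⟨n, rfl⟩)
  have hker : ∀ f, d0 a ad f ∈ S := fun f => Submodule.mem_sup_right (by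
    rw [LinearMap.mem_ker, LinearMap.comp_apply, h.d1_d0, map_zero])
  -- This is (n+1) + (n+2), the determinant of the eigenvector and the kernel vector in the plane.
  have h3 : ∀ n : ℕ, (2 * (n : ℂ) + 3) ≠ 0 := fun n => by
    have : (0 : ℝ) < 2 * n + 3 := by positivity
    exact_mod_cast this.ne'
  refine core2_le (fun n => ?_) (fun n => ?_)
  · rcases n with _ | _ | n
    · exact hE 0
    · have := hker (H 0)
      rwa [d0_apply, h.lower_zero, neg_zero, h.raise] at this
    · have e : (H (n + 2), (0 : V)) = (2 * (n : ℂ) + 3)⁻¹ • (((n : ℂ) + 1) • state1 H (n + 1) +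
          ((n : ℂ) + 2) • d0 a ad (H (n + 1))) := by
        rw [eq_inv_smul_iff₀ (h3 n), d0_apply, h.lower, h.raise]
        refine Prod.ext ?_ ?_ <;> simp [state1] <;> module
      rw [e]
      exact S.smul_mem _ (S.add_mem (S.smul_mem _ (hE _)) (S.smul_mem _ (hker _)))
  · have e : ((0 : V), H n) = (2 * (n : ℂ) + 3)⁻¹ • (state1 H (n + 1) - d0 a ad (H (n + 1))) := by
      rw [eq_inv_smul_iff₀ (h3 n), d0_apply, h.lower, h.raise]
      refine Prod.ext ?_ ?_
      · simp [state1]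
      · simp [state1]
        module
    rw [e]
    exact S.smul_mem _ (S.sub_mem (hE _) (hker _))

/-- The eigenvalues of `d2`. -/
def root : ℕ ⊕ ℕ → ℝ :=
  Sum.elim (fun n => (5 + √(8 * oddN n ^ 2 + 9)) / 4) (fun n => (5 - √(8 * oddN n ^ 2 + 9)) / 4)

theorem root_sq (i : ℕ ⊕ ℕ) : root i * root i = quadEigen i := by
  rcases i with n | n <;> simp only [root, quadEigen, Sum.elim_inl, Sum.elim_inr] <;> ring

theorem sqrt_pos_aux (n : ℕ) : 0 < √(8 * oddN n ^ 2 + 9) := Real.sqrt_pos.2 (by positivity)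

theorem root_add (n : ℕ) : root (.inl n) + root (.inr n) = 5 / 2 := by
  simp only [root, Sum.elim_inl, Sum.elim_inr]; ring

theorem root_mul (n : ℕ) : root (.inl n) * root (.inr n) = -(oddN n ^ 2 - 2) / 2 := by
  have := Real.sq_sqrt (show 0 ≤ 8 * oddN n ^ 2 + 9 by positivity)
  simp only [root, Sum.elim_inl, Sum.elim_inr]
  linear_combination (-1 / 16 : ℝ) * this

theorem root_lt (m n : ℕ) : root (.inr m) < root (.inl n) := by
  have h1 := sqrt_pos_aux m
  have h2 := sqrt_pos_aux n
  simp only [root, Sum.elim_inl, Sum.elim_inr]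
  linarith

theorem root_injective : Function.Injective root := by
  have key : ∀ m n : ℕ, √(8 * oddN m ^ 2 + 9) = √(8 * oddN n ^ 2 + 9) → m = n := by
    intro m n h
    rw [Real.sqrt_inj (by positivity) (by positivity)] at h
    refine oddN_injective ((sq_eq_sq₀ (oddN_pos m).le (oddN_pos n).le).1 ?_)
    linarith
  rintro (m | m) (n | n) h
  · simp only [root, Sum.elim_inl] at h
    rw [key m n (by linarith)]
  · exact absurd h (root_lt n m).ne'
  · exact absurd h (root_lt m n).ne
  · simp only [root, Sum.elim_inr] at h
    rw [key m n (by linarith)]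

theorem root_inl_pos (n : ℕ) : 0 < root (.inl n) := by
  have := sqrt_pos_aux n
  simp only [root, Sum.elim_inl]; linarith

theorem root_inr_one : root (.inr 1) = -1 := by
  have : √(8 * oddN 1 ^ 2 + 9) = 9 := by
    rw [show 8 * oddN 1 ^ 2 + 9 = 9 ^ 2 by norm_num [oddN], Real.sqrt_sq (by norm_num)]
  simp only [root, Sum.elim_inr, this]; norm_num

/-- If −n were a root, sum and product of the roots would give (n − 1)(2n + 1) = 0. The quantity is
the leading coefficient of the second-branch state, so n = 1 is the only degenerate index. -/
theorem root_inr_ne (n : ℕ) (hn : n ≠ 1) : (n : ℝ) + root (.inr n) ≠ 0 := by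
  intro h0
  have h1 := root_add n
  have h2 := root_mul n
  have h3 : root (.inr n) = -n := by linarith
  rw [show root (.inl n) = 5 / 2 + n by linarith, h3] at h2
  have h4 : ((n : ℝ) - 1) * (2 * n + 1) = 0 := by unfold oddN at h2; nlinarith
  have h5 : (2 * (n : ℝ) + 1) ≠ 0 := by positivity
  have h6 : (n : ℝ) = 1 := by linarith [(mul_eq_zero.1 h4).resolve_right h5]
  exact hn (by exact_mod_cast h6)

theorem root_ne_zero (i : ℕ ⊕ ℕ) : root i ≠ 0 := by
  have h : ∀ n, root (.inl n) * root (.inr n) ≠ 0 := fun n => by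
    rw [root_mul]
    exact div_ne_zero (neg_ne_zero.2 (oddN_sq_sub_two_ne n)) two_ne_zero
  rcases i with n | n
  · exact left_ne_zero_of_mul (h n)
  · exact right_ne_zero_of_mul (h n)

section

variable (h : Oscillator j a ad H)
include h

theorem d2_mid (n : ℕ) : d2 a ad (0, H n, 0) =
    (H (n + 2), (3 / 2 : ℂ) • H n, -a (a (H n))) := by
  simp [d2_apply, h.raise]

theorem d2_d2_mid (n : ℕ) : d2 a ad (d2 a ad (0, H n, 0)) =
    (((n : ℂ) + 5 / 2) • H (n + 2), ((n : ℂ) ^ 2 + n + 13 / 4) • H n,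
      ((n : ℂ) - 3 / 2) • a (a (H n))) := by
  rw [d2_mid h, d2_apply]
  simp only [map_smul, map_neg, h.lower, h.raise, h.number, h.number₂, h.number₃]
  refine Prod.ext ?_ (Prod.ext ?_ ?_) <;> simp only <;> push_cast <;> module

/-- The vectors (H (n+2), 0, 0), (0, H n, 0), (0, 0, a²H n) span an invariant block; for n ≥ 2 this
is its Cayley–Hamilton relation. The root 0 belongs to the image of `d1`, the others are `root`. -/
theorem d2_cubic (n : ℕ) : d2 a ad (d2 a ad (d2 a ad (0, H n, 0))) =
    (5 / 2 : ℂ) • d2 a ad (d2 a ad (0, H n, 0)) +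
      (((oddN n ^ 2 - 2) / 2 : ℝ) : ℂ) • d2 a ad (0, H n, 0) := by
  rw [d2_d2_mid h, d2_mid h, d2_apply]
  simp only [map_smul, h.lower, h.raise, h.number, h.number₂, h.number₃, oddN]
  refine Prod.ext ?_ (Prod.ext ?_ ?_) <;> simp only [Prod.fst_add, Prod.snd_add, Prod.smul_fst,
    Prod.smul_snd] <;> push_cast <;> module

/-- The projection of a state to an eigenspace of `d2`; `mu` is the complementary root. -/
def quadState (a ad : V →ₗ[ℂ] V) (H : ℕ → V) (n : ℕ) (mu : ℝ) : V × V × V :=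
  d2 a ad (d2 a ad (0, H n, 0)) - (mu : ℂ) • d2 a ad (0, H n, 0)

/-- With s, t the two nonzero roots and y = (0, H n, 0), the cubic reads (d2 − s) d2 (d2 − t) y = 0,
so d2 (d2 − t) y is an eigenvector for s. -/
theorem quadState_eigen {n : ℕ} {s t : ℝ} (hst : s + t = 5 / 2)
    (hst' : s * t = -(oddN n ^ 2 - 2) / 2) :
    d2 a ad (quadState a ad H n t) = (s : ℂ) • quadState a ad H n t := by
  rw [quadState, map_sub, map_smul, d2_cubic h,
    show (oddN n ^ 2 - 2) / 2 = -(s * t) by linarith, show (5 / 2 : ℂ) = ((s + t : ℝ) : ℂ) by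
      rw [hst]; norm_num]
  push_cast
  module

theorem quadState_fst (n : ℕ) (t : ℝ) :
    (quadState a ad H n t).1 = ((n : ℂ) + 5 / 2 - t) • H (n + 2) := by
  rw [quadState, d2_d2_mid h, d2_mid h]
  simp only [Prod.fst_sub, Prod.smul_fst]
  module

/-- As a²H 1 = 0, the block n = 1 has dimension two, with eigenvalues 0 and 7/2; the root −1 does
not occur in it. -/
theorem quadState_one_eq_zero : quadState a ad H 1 (root (.inl 1)) = 0 := by
  have h1 : root (.inl 1) = 7 / 2 := by linarith [root_add 1, root_inr_one]
  have h2 : a (a (H 1)) = 0 := by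
    rw [h.lower, map_smul, h.lower_zero, smul_zero]
  rw [quadState, d2_d2_mid h, d2_mid h, h1, h2]
  refine Prod.ext ?_ (Prod.ext ?_ ?_) <;> simp only [Prod.fst_sub, Prod.snd_sub, Prod.smul_fst,
    Prod.smul_snd, Prod.fst_zero, Prod.snd_zero] <;> push_cast <;> module

end

/-- Eigenvectors of `d2`. -/
def state2 (a ad : V →ₗ[ℂ] V) (H : ℕ → V) : ℕ ⊕ ℕ → V × V × V
  | .inl n => quadState a ad H n (root (.inr n))
  | .inr n => if n = 1 then (H 0, 0, 0) else quadState a ad H n (root (.inl n))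

/-- The eigenvalue −1 absent from the block n = 1 occurs on (H 0, 0, 0), which belongs to no block,
so the list is uniform in n after all. Orthogonality is derived from `d2` rather than its square,
because the signed roots are pairwise distinct. -/
theorem eigenSystem_d2 (h : Oscillator j a ad H) :
    EigenSystem (J3 j) (d2 a ad ∘ₗ d2 a ad) (core3 H) (state2 a ad H) quadEigen := by
  have heig : ∀ i, d2 a ad (state2 a ad H i) = (root i : ℂ) • state2 a ad H i := by
    rintro (n | n)
    · exact quadState_eigen h (root_add n) (root_mul n)
    · rcases eq_or_ne n 1 with rfl | hn
      · rw [state2, if_pos rfl, root_inr_one, d2_apply]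
        simp [h.lower_zero]
      · rw [state2, if_neg hn]
        exact quadState_eigen h (by linarith [root_add n]) (by rw [mul_comm]; exact root_mul n)
  refine ⟨fun i => ?_, fun i => ?_, ?_, fun m n hmn => inner_eq_zero_of_eigen h.d2_adj
    (root_injective.ne hmn) (heig m) (heig n), ?_⟩
  · rw [← root_sq]
    exact mul_self_pos.2 (root_ne_zero i)
  · rw [LinearMap.comp_apply, heig, map_smul, heig, smul_smul, ← root_sq]
    push_cast; rfl
  · rintro (n | n) h0
    · have h1 := congrArg Prod.fst h0
      rw [state2, quadState_fst h] at h1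
      refine smul_ne_zero ?_ (h.H_ne _) h1
      have h2 : (0 : ℝ) < n + 5 / 2 - root (.inr n) := by
        have := root_inl_pos n
        have := root_add n
        have : (0 : ℝ) ≤ n := n.cast_nonneg
        linarith
      have h3 := Complex.ofReal_ne_zero.2 h2.ne'
      push_cast at h3
      exact h3
    · rcases eq_or_ne n 1 with rfl | hn
      · rw [state2, if_pos rfl] at h0
        exact h.ne_zero (congrArg Prod.fst h0)
      · rw [state2, if_neg hn] at h0
        have h1 := congrArg Prod.fst h0
        rw [quadState_fst h] at h1
        refine smul_ne_zero ?_ (h.H_ne _) h1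
        have h2 : (n + 5 / 2 - root (.inl n) : ℝ) ≠ 0 := by
          have := root_inr_ne n hn
          have := root_add n
          rwa [show (n + 5 / 2 - root (.inl n) : ℝ) = n + root (.inr n) by linarith]
        have h3 := Complex.ofReal_ne_zero.2 h2
        push_cast at h3
        exact h3
  set S := Submodule.span ℂ (Set.range (state2 a ad H)) ⊔ LinearMap.ker (d2 a ad ∘ₗ d2 a ad)
  have hE : ∀ n, state2 a ad H n ∈ S := fun n =>
    Submodule.mem_sup_left (Submodule.subset_span ⟨n, rfl⟩)
  have hker : ∀ x, d2 a ad x = 0 → x ∈ S := fun x hx => Submodule.mem_sup_right (by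
    rw [LinearMap.mem_ker, LinearMap.comp_apply, hx, map_zero])
  have hminus : ∀ n, quadState a ad H n (root (.inl n)) ∈ S := by
    intro n
    rcases eq_or_ne n 1 with rfl | hn
    · rw [quadState_one_eq_zero h]; exact S.zero_mem
    · have := hE (.inr n)
      rwa [state2, if_neg hn] at this
  -- The two projections of the middle vector differ by a nonzero multiple of its image under `d2`.
  have hU : ∀ n, d2 a ad (0, H n, 0) ∈ S := by
    intro n
    have h1 : ((root (.inl n) : ℂ) - root (.inr n)) ≠ 0 := by
      rw [← Complex.ofReal_sub, Ne, Complex.ofReal_eq_zero, sub_eq_zero]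
      exact (root_lt n n).ne'
    have h2 : d2 a ad (0, H n, 0) = ((root (.inl n) : ℂ) - root (.inr n))⁻¹ •
        (quadState a ad H n (root (.inr n)) - quadState a ad H n (root (.inl n))) := by
      rw [eq_inv_smul_iff₀ h1, quadState, quadState]; module
    rw [h2]
    exact S.smul_mem _ (S.sub_mem (hE (.inl n)) (hminus n))
  have hUU : ∀ n, d2 a ad (d2 a ad (0, H n, 0)) ∈ S := by
    intro n
    have h2 : d2 a ad (d2 a ad (0, H n, 0)) = quadState a ad H n (root (.inr n)) +
        (root (.inr n) : ℂ) • d2 a ad (0, H n, 0) := by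
      rw [quadState]; module
    rw [h2]
    exact S.add_mem (hE (.inl n)) (S.smul_mem _ (hU n))
  -- The cubic without its factor x maps the middle vector into the kernel; its constant term q is
  -- nonzero, so the vector can be solved for.
  have hy : ∀ n, (0, H n, 0) ∈ S := by
    intro n
    set q : ℂ := (((oddN n ^ 2 - 2) / 2 : ℝ) : ℂ) with hq
    have hq0 : q ≠ 0 := by
      rw [hq, Ne, Complex.ofReal_eq_zero]
      exact div_ne_zero (oddN_sq_sub_two_ne n) two_ne_zero
    have hw : d2 a ad (d2 a ad (0, H n, 0)) - (5 / 2 : ℂ) • d2 a ad (0, H n, 0) -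
        q • (0, H n, 0) ∈ S := by
      refine hker _ ?_
      rw [map_sub, map_sub, map_smul, map_smul, d2_cubic h]
      abel
    have h3 := S.sub_mem (S.sub_mem (hUU n) (S.smul_mem (5 / 2 : ℂ) (hU n))) hw
    rw [sub_sub_cancel] at h3
    have := S.smul_mem q⁻¹ h3
    rwa [inv_smul_smul₀ hq0] at this
  -- In the block of index n + 2, the image of (H (n+3), 0) under `d1` is a kernel vector. Together
  -- with the middle vector and its image under `d2` it spans the block; elimination leaves the
  -- pivot (n+2)(n+1)(2n+5).
  have hxz : ∀ n : ℕ, (H (n + 4), (0 : V), (0 : V)) ∈ S ∧ ((0 : V), (0 : V), H n) ∈ S := by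
    intro n
    have h1 := hU (n + 2)
    have h2 := hker _ (h.d2_d1 (H (n + 3), 0))
    rw [d2_mid h, h.lower, map_smul, h.lower] at h1
    have e2 : d1 a ad (H (n + 3), 0) = (((n : ℂ) + 2) • H (n + 4),
        -(((n : ℂ) + 3) * (n + 2)) • H (n + 2), (((n : ℂ) + 3) * (n + 2) * (n + 1)) • H n) := by
      simp only [d1_apply, map_zero, map_sub, map_add, map_smul, h.lower, h.raise]
      refine Prod.ext ?_ (Prod.ext ?_ ?_) <;> simp only <;> push_cast <;> module
    rw [e2] at h2
    have hn0 : (0 : ℝ) ≤ n := n.cast_nonneg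
    have hne : (((n : ℂ) + 2) * (n + 1) * (2 * n + 5)) ≠ 0 := by
      have : (0 : ℝ) < (n + 2) * (n + 1) * (2 * n + 5) := by positivity
      exact_mod_cast this.ne'
    have hz : ((0 : V), (0 : V), H n) ∈ S := by
      have h3 := S.add_mem (S.sub_mem h2 (S.smul_mem ((n : ℂ) + 2) h1))
        (S.smul_mem (((n : ℂ) + 3) * (n + 2) + 3 / 2 * (n + 2)) (hy (n + 2)))
      have h4 := S.smul_mem (((n : ℂ) + 2) * (n + 1) * (2 * n + 5))⁻¹ h3
      convert h4 using 1
      rw [eq_inv_smul_iff₀ hne]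
      refine Prod.ext ?_ (Prod.ext ?_ ?_) <;> simp only [Prod.fst_add, Prod.snd_add, Prod.fst_sub,
        Prod.snd_sub, Prod.smul_fst, Prod.smul_snd] <;> push_cast <;> module
    refine ⟨?_, hz⟩
    have h3 := S.add_mem (S.sub_mem h1 (S.smul_mem (3 / 2 : ℂ) (hy (n + 2))))
      (S.smul_mem (((n : ℂ) + 2) * (n + 1)) hz)
    convert h3 using 1
    refine Prod.ext ?_ (Prod.ext ?_ ?_) <;> simp only [Prod.fst_add, Prod.snd_add, Prod.fst_sub,
      Prod.snd_sub, Prod.smul_fst, Prod.smul_snd] <;> push_cast <;> module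
  refine core3_le (fun n => ?_) hy fun n => (hxz n).2
  -- Low cases: H 0 gives the extra eigenvector, H 1 the kernel, and H 2, H 3 sit in the blocks n =
  -- 0, 1, where a²H n = 0.
  rcases n with _ | _ | _ | _ | n
  · have := hE (.inr 1)
    rwa [state2, if_pos rfl] at this
  · refine hker _ ?_
    rw [d2_apply, h.lower, map_smul, map_smul, h.raise]
    simp [h.lower_zero]
  · have h1 := S.sub_mem (hU 0) (S.smul_mem (3 / 2 : ℂ) (hy 0))
    rw [d2_mid h, h.lower_zero] at h1
    convert h1 using 1
    simp
  · have h1 := S.sub_mem (hU 1) (S.smul_mem (3 / 2 : ℂ) (hy 1))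
    rw [d2_mid h, h.lower, map_smul, h.lower_zero] at h1
    convert h1 using 1
    simp
  · exact (hxz n).1

end Oscillator
end

/-! ### Complex Gaussians and the moment problem. -/

noncomputable section

open scoped SchwartzMap ComplexConjugate InnerProductSpace FourierTransform
open MeasureTheory

section gaussian

variable (γ : ℂ)

/-- The complex Gaussian `exp (-γ θ² / 2)`. -/
def gaussFun (θ : ℝ) : ℂ := Complex.exp (-γ * (θ : ℂ) ^ 2 / 2)

theorem hasDerivAt_gaussFun (θ : ℝ) : HasDerivAt (gaussFun γ) (-γ * θ * gaussFun γ θ) θ := by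
  have h1 : HasDerivAt (fun z : ℂ => Complex.exp (-γ * z ^ 2 / 2))
      (Complex.exp (-γ * (θ : ℂ) ^ 2 / 2) * (-γ * (2 * (θ : ℂ)) / 2)) (θ : ℂ) := by
    have := ((((hasDerivAt_id (θ : ℂ)).pow 2).const_mul (-γ)).div_const 2).cexp
    simpa using this
  have h2 := h1.comp_ofReal
  have h3 : -γ * θ * gaussFun γ θ =
      Complex.exp (-γ * (θ : ℂ) ^ 2 / 2) * (-γ * (2 * (θ : ℂ)) / 2) := by
    unfold gaussFun; ring
  rw [h3]
  exact h2

theorem contDiff_gaussFun : ContDiff ℝ (⊤ : ℕ∞) (gaussFun γ) := by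
  unfold gaussFun
  have : ContDiff ℝ (⊤ : ℕ∞) fun θ : ℝ => (θ : ℂ) := Complex.ofRealCLM.contDiff
  fun_prop

theorem norm_gaussFun (θ : ℝ) : ‖gaussFun γ θ‖ = Real.exp (-γ.re * θ ^ 2 / 2) := by
  rw [gaussFun, Complex.norm_exp]
  congr 1
  rw [show -γ * (θ : ℂ) ^ 2 / 2 = -γ * ((θ ^ 2 / 2 : ℝ) : ℂ) by push_cast; ring,
    Complex.mul_re, Complex.ofReal_re, Complex.ofReal_im, Complex.neg_re]
  ring

theorem iteratedDeriv_gaussFun (n : ℕ) : ∃ P : Polynomial ℂ, ∀ θ : ℝ,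
    iteratedDeriv n (gaussFun γ) θ = P.eval (θ : ℂ) * gaussFun γ θ := by
  induction n with
  | zero => exact ⟨1, fun θ => by simp⟩
  | succ n ih =>
    obtain ⟨P, hP⟩ := ih
    refine ⟨P.derivative - Polynomial.C γ * Polynomial.X * P, fun θ => ?_⟩
    rw [iteratedDeriv_succ, funext hP]
    have h1 : HasDerivAt (fun θ : ℝ => P.eval (θ : ℂ)) (P.derivative.eval (θ : ℂ)) θ :=
      (P.hasDerivAt (θ : ℂ)).comp_ofReal
    rw [(h1.fun_mul (hasDerivAt_gaussFun γ θ)).deriv]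
    simp only [Polynomial.eval_sub, Polynomial.eval_mul, Polynomial.eval_C, Polynomial.eval_X]
    ring

theorem pow_mul_exp_le {r : ℝ} (hr : 0 < r) (k : ℕ) : ∃ C, ∀ θ : ℝ,
    |θ| ^ k * Real.exp (-r * θ ^ 2 / 2) ≤ C := by
  refine ⟨1 + k.factorial * (2 / r) ^ k, fun θ => ?_⟩
  have h0 : 0 ≤ r * θ ^ 2 / 2 := by positivity
  have h1 := Real.pow_div_factorial_le_exp _ h0 k
  have h2 : Real.exp (-r * θ ^ 2 / 2) = (Real.exp (r * θ ^ 2 / 2))⁻¹ := by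
    rw [← Real.exp_neg]; congr 1; ring
  have h3 := Real.exp_pos (r * θ ^ 2 / 2)
  have h4 : 1 ≤ Real.exp (r * θ ^ 2 / 2) := Real.one_le_exp h0
  have hk : (0 : ℝ) < k.factorial := by exact_mod_cast k.factorial_pos
  rw [h2, ← div_eq_mul_inv, div_le_iff₀ h3]
  have h5 : |θ| ^ k ≤ 1 + (θ ^ 2) ^ k := by
    rw [← sq_abs, ← pow_mul, mul_comm 2, pow_mul]
    nlinarith [sq_nonneg (|θ| ^ k - 1), pow_nonneg (abs_nonneg θ) k]
  have h6 : (θ ^ 2) ^ k ≤ k.factorial * (2 / r) ^ k * Real.exp (r * θ ^ 2 / 2) := by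
    rw [div_le_iff₀ hk] at h1
    calc (θ ^ 2) ^ k = (2 / r) ^ k * (r * θ ^ 2 / 2) ^ k := by
          rw [← mul_pow]; congr 1; field_simp
      _ ≤ (2 / r) ^ k * (Real.exp (r * θ ^ 2 / 2) * k.factorial) := by gcongr
      _ = _ := by ring
  nlinarith

theorem polynomial_mul_gaussFun_le (hγ : 0 < γ.re) (P : Polynomial ℂ) : ∀ k : ℕ, ∃ C, ∀ θ : ℝ,
    |θ| ^ k * ‖P.eval (θ : ℂ) * gaussFun γ θ‖ ≤ C := by
  induction P using Polynomial.induction_on' with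
  | add P Q hP hQ =>
    intro k
    obtain ⟨C, hC⟩ := hP k
    obtain ⟨D, hD⟩ := hQ k
    refine ⟨C + D, fun θ => ?_⟩
    rw [Polynomial.eval_add, add_mul]
    calc _ ≤ |θ| ^ k * (‖P.eval (θ : ℂ) * gaussFun γ θ‖ + ‖Q.eval (θ : ℂ) * gaussFun γ θ‖) := by
          gcongr; exact norm_add_le _ _
      _ ≤ C + D := by rw [mul_add]; exact add_le_add (hC θ) (hD θ)
  | monomial n c =>
    intro k
    obtain ⟨C, hC⟩ := pow_mul_exp_le hγ (k + n)
    refine ⟨‖c‖ * C, fun θ => ?_⟩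
    rw [Polynomial.eval_monomial, norm_mul, norm_mul, norm_pow, Complex.norm_real, norm_gaussFun,
      Real.norm_eq_abs]
    calc _ = ‖c‖ * (|θ| ^ (k + n) * Real.exp (-γ.re * θ ^ 2 / 2)) := by rw [pow_add]; ring
      _ ≤ _ := by gcongr; exact hC θ

/-- The complex Gaussian as a Schwartz function. -/
def gauss {γ : ℂ} (hγ : 0 < γ.re) : 𝓢(ℝ, ℂ) where
  toFun := gaussFun γ
  smooth' := contDiff_gaussFun γ
  decay' k n := by
    obtain ⟨P, hP⟩ := iteratedDeriv_gaussFun γ n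
    obtain ⟨C, hC⟩ := polynomial_mul_gaussFun_le γ hγ P k
    refine ⟨C, fun θ => ?_⟩
    rw [norm_iteratedFDeriv_eq_norm_iteratedDeriv, hP, Real.norm_eq_abs]
    exact hC θ

theorem gauss_apply {γ : ℂ} (hγ : 0 < γ.re) (θ : ℝ) : gauss hγ θ = gaussFun γ θ := rfl

end gaussian

section moments

/-- Write a test function as the Fourier transform of a Schwartz function; the multiplication
formula moves the transform onto f, where it vanishes. -/
theorem ae_eq_zero_of_fourier {f : ℝ → ℂ} (hf : Integrable f) (h : ∀ ξ, 𝓕 f ξ = 0) :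
    ∀ᵐ x, f x = 0 := by
  refine ae_eq_zero_of_integral_contDiff_smul_eq_zero hf.locallyIntegrable fun g hg hs => ?_
  have hs' : HasCompactSupport fun x => (g x : ℂ) := hs.comp_left Complex.ofReal_zero
  have hg' : ContDiff ℝ (⊤ : ℕ∞) fun x => (g x : ℂ) := Complex.ofRealCLM.contDiff.comp hg
  let φ : 𝓢(ℝ, ℂ) := hs'.toSchwartzMap hg'
  have h1 : ∀ x, φ x = g x := fun x => rfl
  have h2 : 𝓕 (𝓕⁻ φ) = φ := FourierTransform.fourier_fourierInv_eq φ
  have h3 := VectorFourier.integral_fourierIntegral_smul_eq_flip (L := innerₗ ℝ)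
    (f := f) (g := (𝓕⁻ φ : 𝓢(ℝ, ℂ))) (μ := volume) (ν := volume)
    Real.continuous_fourierChar continuous_inner hf (𝓕⁻ φ : 𝓢(ℝ, ℂ)).integrable
  have h4 : ∀ ξ, VectorFourier.fourierIntegral Real.fourierChar volume (innerₗ ℝ) f ξ = 0 := h
  have h5 : ∀ x, VectorFourier.fourierIntegral Real.fourierChar volume (innerₗ ℝ).flip
      (𝓕⁻ φ : 𝓢(ℝ, ℂ)) x = g x := by
    intro x
    rw [← h1, ← h2, flip_innerₗ, SchwartzMap.fourier_coe, h2]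
    rfl
  simp_rw [h4, h5, zero_smul, integral_zero] at h3
  rw [h3]
  refine integral_congr_ae (Filter.Eventually.of_forall fun x => ?_)
  simp only [Complex.real_smul, smul_eq_mul, mul_comm]

/-- Finite exponential moments allow the exponential series to be integrated term by term, so the
Fourier transform of f is a series in its vanishing moments. -/
theorem ae_eq_zero_of_moments {f : ℝ → ℂ}
    (hf : ∀ c : ℝ, Integrable fun θ => Real.exp (c * |θ|) * ‖f θ‖)
    (hm : AEStronglyMeasurable f) (h : ∀ n : ℕ, ∫ θ : ℝ, (θ : ℂ) ^ n * f θ = 0) :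
    ∀ᵐ x, f x = 0 := by
  have hint : Integrable f := by
    have := hf 0
    simp only [zero_mul, Real.exp_zero, one_mul] at this
    exact (integrable_norm_iff hm).1 this
  refine ae_eq_zero_of_fourier hint fun ξ => ?_
  rw [Real.fourier_real_eq_integral_exp_smul]
  set z : ℂ := -2 * Real.pi * ξ * Complex.I with hz
  have h1 : ∀ θ : ℝ, Complex.exp (↑(-2 * Real.pi * θ * ξ) * Complex.I) • f θ =
      Complex.exp (z * θ) * f θ := by
    intro θ
    rw [smul_eq_mul, hz]; congr 2; push_cast; ring
  simp_rw [h1]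
  have hsum : ∀ θ : ℝ, HasSum (fun n : ℕ => (‖z‖ * |θ|) ^ n / n.factorial * ‖f θ‖)
      (Real.exp (‖z‖ * |θ|) * ‖f θ‖) := by
    intro θ
    have := NormedSpace.expSeries_div_hasSum_exp (‖z‖ * |θ|)
    rw [← Real.exp_eq_exp_ℝ] at this
    exact this.mul_right _
  have key := hasSum_integral_of_dominated_convergence (μ := volume)
    (F := fun (n : ℕ) (θ : ℝ) => (z * θ) ^ n / n.factorial * f θ)
    (f := fun θ : ℝ => Complex.exp (z * θ) * f θ)
    (fun n θ => (‖z‖ * |θ|) ^ n / n.factorial * ‖f θ‖) (fun n => ?_) (fun n => ?_) ?_ ?_ ?_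
  · have h2 : ∀ n : ℕ, ∫ θ : ℝ, (z * θ) ^ n / n.factorial * f θ = 0 := by
      intro n
      have : ∀ θ : ℝ, (z * θ) ^ n / n.factorial * f θ = z ^ n / n.factorial * ((θ : ℂ) ^ n * f θ) :=
        fun θ => by rw [mul_pow]; ring
      simp_rw [this]
      rw [integral_const_mul, h, mul_zero]
    simp_rw [h2] at key
    exact key.unique hasSum_zero
  · exact AEStronglyMeasurable.mul (Continuous.aestronglyMeasurable (by fun_prop)) hm
  · refine Filter.Eventually.of_forall fun θ => ?_
    simp [mul_pow]
  · exact Filter.Eventually.of_forall fun θ => (hsum θ).summable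
  · simp_rw [fun θ => (hsum θ).tsum_eq]
    exact hf ‖z‖
  · refine Filter.Eventually.of_forall fun θ => ?_
    have := NormedSpace.expSeries_div_hasSum_exp (z * θ)
    rw [← Complex.exp_eq_exp_ℂ] at this
    exact this.mul_right _

end moments
end

/-! ### The Schrödinger representation as an oscillator. -/

noncomputable section

open scoped SchwartzMap ComplexConjugate InnerProductSpace FourierTransform
open MeasureTheory

/-- The embedding of the Schwartz space in `L²(ℝ)`. -/
def schwartzToL2 : 𝓢(ℝ, ℂ) →ₗ[ℂ] Lp ℂ 2 (volume : Measure ℝ) :=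
  (SchwartzMap.toLpCLM ℂ ℂ 2 (volume : Measure ℝ)).toLinearMap

theorem inner_schwartzToL2 (f g : 𝓢(ℝ, ℂ)) :
    ⟪schwartzToL2 f, schwartzToL2 g⟫_ℂ = ∫ θ : ℝ, conj (f θ) * g θ := by
  refine (SchwartzMap.inner_toL2_toL2_eq f g volume).trans ?_
  refine integral_congr_ae (Filter.Eventually.of_forall fun x => ?_)
  exact mul_comm _ _

theorem schwartzToL2_injective : Function.Injective schwartzToL2 :=
  SchwartzMap.injective_toLp 2 volume

theorem mulTheta_sym (f g : 𝓢(ℝ, ℂ)) :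
    ⟪schwartzToL2 (mulTheta f), schwartzToL2 g⟫_ℂ = ⟪schwartzToL2 f, schwartzToL2 (mulTheta g)⟫_ℂ := by
  rw [inner_schwartzToL2, inner_schwartzToL2]
  refine integral_congr_ae (Filter.Eventually.of_forall fun x => ?_)
  simp only [mulTheta_apply, map_mul, Complex.conj_ofReal]
  ring

theorem dTheta_skew (f g : 𝓢(ℝ, ℂ)) :
    ⟪schwartzToL2 (dTheta f), schwartzToL2 g⟫_ℂ = -⟪schwartzToL2 f, schwartzToL2 (dTheta g)⟫_ℂ := by
  rw [inner_schwartzToL2, inner_schwartzToL2]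
  have := SchwartzMap.integral_bilinear_deriv_right_eq_neg_left f g
    ((ContinuousLinearMap.mul ℝ ℂ).comp (Complex.conjCLE : ℂ →L[ℝ] ℂ))
  simp only [ContinuousLinearMap.comp_apply, ContinuousLinearMap.mul_apply',
    ContinuousLinearEquiv.coe_coe, Complex.conjCLE_apply] at this
  simp only [dTheta_apply]
  rw [this, neg_neg]

theorem dTheta_mulTheta (f : 𝓢(ℝ, ℂ)) : dTheta (mulTheta f) = mulTheta (dTheta f) + f := by
  ext θ
  rw [add_apply, dTheta_apply, mulTheta_apply, dTheta_apply]
  have h1 : HasDerivAt (fun θ : ℝ => (θ : ℂ) * f θ) (1 * f θ + θ * deriv f θ) θ :=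
    (Complex.ofRealCLM.hasDerivAt (x := θ)).mul (f.hasDerivAt θ)
  rw [show ⇑(mulTheta f) = fun θ : ℝ => (θ : ℂ) * f θ from funext (mulTheta_apply f), h1.deriv]
  ring

section schrodinger

variable {ħ : ℝ}

theorem schrodinger_skew (ħ : ℝ) (i : Fin 5) (f g : 𝓢(ℝ, ℂ)) :
    ⟪schwartzToL2 (schrodinger ħ i f), schwartzToL2 g⟫_ℂ =
      -⟪schwartzToL2 f, schwartzToL2 (schrodinger ħ i g)⟫_ℂ := by
  fin_cases i
  · simp only [schrodinger, Fin.zero_eta, Matrix.cons_val_zero, LinearMap.smul_apply, map_smul,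
      inner_smul_left, inner_smul_right, dTheta_skew, Complex.conj_ofReal]
    ring
  · simp only [schrodinger, Fin.mk_one, Matrix.cons_val_one, Matrix.cons_val_zero,
      LinearMap.smul_apply, map_smul, map_mul,
      inner_smul_left, inner_smul_right, mulTheta_sym, Complex.conj_ofReal, Complex.conj_I]
    ring
  · simp only [schrodinger, Fin.reduceFinMk, Matrix.cons_val, LinearMap.id_apply,
      LinearMap.smul_apply, map_smul, map_mul,
      inner_smul_left, inner_smul_right, Complex.conj_ofReal, Complex.conj_I]
    ring
  · simp [schrodinger]
  · simp [schrodinger]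

theorem real_sign_mul_abs (ħ : ℝ) : Real.sign ħ * |ħ| = ħ := by
  rcases lt_trichotomy ħ 0 with h | rfl | h
  · rw [Real.sign_of_neg h, abs_of_neg h]; ring
  · simp
  · rw [Real.sign_of_pos h, abs_of_pos h]; ring

theorem schrodinger_comm (ħ : ℝ) (f : 𝓢(ℝ, ℂ)) :
    schrodinger ħ 0 (schrodinger ħ 1 f) - schrodinger ħ 1 (schrodinger ħ 0 f) =
      (Complex.I * ħ) • f := by
  simp only [schrodinger, Matrix.cons_val_one, Matrix.cons_val_zero, LinearMap.smul_apply, map_smul,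
    dTheta_mulTheta]
  have h1 : ((√|ħ| : ℝ) : ℂ) * ((√|ħ| : ℝ) : ℂ) = (|ħ| : ℝ) := by
    rw [← Complex.ofReal_mul, Real.mul_self_sqrt (abs_nonneg _)]
  have h2 : (Complex.I * (ħ : ℂ)) = Complex.I * ((Real.sign ħ : ℝ) : ℂ) *
      (((√|ħ| : ℝ) : ℂ) * ((√|ħ| : ℝ) : ℂ)) := by
    rw [h1, mul_assoc, ← Complex.ofReal_mul, real_sign_mul_abs]
  rw [h2]
  push_cast
  module

/-- The lowering operator of the frame `α`. -/
def lowerOp (ħ : ℝ) (α₁ α₂ : ℂ) : 𝓢(ℝ, ℂ) →ₗ[ℂ] 𝓢(ℝ, ℂ) :=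
  (Complex.I * ħ)⁻¹ • (α₂ • schrodinger ħ 0 - α₁ • schrodinger ħ 1)

/-- The raising operator of the frame `α`. -/
def raiseOp (ħ : ℝ) (α₁ α₂ : ℂ) : 𝓢(ℝ, ℂ) →ₗ[ℂ] 𝓢(ℝ, ℂ) :=
  (Complex.I * ħ)⁻¹ • (conj α₂ • schrodinger ħ 0 - conj α₁ • schrodinger ħ 1)

variable {α₁ α₂ : ℂ}

theorem I_mul_ne (hħ : ħ ≠ 0) : Complex.I * (ħ : ℂ) ≠ 0 :=
  mul_ne_zero Complex.I_ne_zero (Complex.ofReal_ne_zero.2 hħ)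

/-- Cramer's rule for the linear system defining the ladder operators, whose determinant is the area
iħ. -/
theorem schrodinger_zero_eq (hħ : ħ ≠ 0) (hα : α₁ * conj α₂ - conj α₁ * α₂ = Complex.I * ħ)
    (f : 𝓢(ℝ, ℂ)) :
    schrodinger ħ 0 f = α₁ • raiseOp ħ α₁ α₂ f - conj α₁ • lowerOp ħ α₁ α₂ f := by
  have : schrodinger ħ 0 f = (Complex.I * ħ)⁻¹ • (α₁ * conj α₂ - conj α₁ * α₂) •
      schrodinger ħ 0 f := by
    rw [hα, inv_smul_smul₀ (I_mul_ne hħ)]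
  rw [this]
  simp only [raiseOp, lowerOp, LinearMap.smul_apply, LinearMap.sub_apply]
  module

theorem schrodinger_one_eq (hħ : ħ ≠ 0) (hα : α₁ * conj α₂ - conj α₁ * α₂ = Complex.I * ħ)
    (f : 𝓢(ℝ, ℂ)) :
    schrodinger ħ 1 f = α₂ • raiseOp ħ α₁ α₂ f - conj α₂ • lowerOp ħ α₁ α₂ f := by
  have : schrodinger ħ 1 f = (Complex.I * ħ)⁻¹ • (α₁ * conj α₂ - conj α₁ * α₂) •
      schrodinger ħ 1 f := by
    rw [hα, inv_smul_smul₀ (I_mul_ne hħ)]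
  rw [this]
  simp only [raiseOp, lowerOp, LinearMap.smul_apply, LinearMap.sub_apply]
  module

theorem ladder_comm (hħ : ħ ≠ 0) (hα : α₁ * conj α₂ - conj α₁ * α₂ = Complex.I * ħ)
    (f : 𝓢(ℝ, ℂ)) :
    lowerOp ħ α₁ α₂ (raiseOp ħ α₁ α₂ f) = raiseOp ħ α₁ α₂ (lowerOp ħ α₁ α₂ f) + f := by
  have h0 := I_mul_ne hħ
  have h1 : f = ((Complex.I * (ħ : ℂ))⁻¹ * (Complex.I * (ħ : ℂ))⁻¹ *
      (α₁ * conj α₂ - conj α₁ * α₂)) • (schrodinger ħ 0 (schrodinger ħ 1 f) -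
        schrodinger ħ 1 (schrodinger ħ 0 f)) := by
    rw [schrodinger_comm, smul_smul, hα]
    rw [show (Complex.I * (ħ : ℂ))⁻¹ * (Complex.I * (ħ : ℂ))⁻¹ * (Complex.I * ħ) *
      (Complex.I * ħ) = 1 by
        rw [mul_assoc, mul_assoc, inv_mul_cancel_left₀ h0, inv_mul_cancel₀ h0], one_smul]
  rw [← sub_eq_iff_eq_add']
  refine Eq.trans ?_ h1.symm
  simp only [raiseOp, lowerOp, LinearMap.smul_apply, LinearMap.sub_apply, map_smul, map_sub]
  module

/-- The sign from skew-symmetry of ρ(X_i) is cancelled by the one from conjugating the imaginary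
factor 1/(iħ). -/
theorem lowerOp_adj (f g : 𝓢(ℝ, ℂ)) :
    ⟪schwartzToL2 (lowerOp ħ α₁ α₂ f), schwartzToL2 g⟫_ℂ =
      ⟪schwartzToL2 f, schwartzToL2 (raiseOp ħ α₁ α₂ g)⟫_ℂ := by
  simp only [raiseOp, lowerOp, LinearMap.smul_apply, LinearMap.sub_apply, map_smul, map_sub,
    inner_smul_left, inner_smul_right, inner_sub_left, inner_sub_right, schrodinger_skew,
    map_inv₀, map_mul, Complex.conj_I, Complex.conj_ofReal]
  ring

theorem im_frame (hα : α₁ * conj α₂ - conj α₁ * α₂ = Complex.I * ħ) :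
    (α₁ * conj α₂).im = ħ / 2 := by
  have h1 := congrArg Complex.im hα
  simp only [Complex.sub_im, Complex.mul_im, Complex.conj_re, Complex.conj_im, Complex.I_re,
    Complex.I_im, Complex.ofReal_re, Complex.ofReal_im] at h1
  simp only [Complex.mul_im, Complex.conj_re, Complex.conj_im]
  linarith

theorem frame_ne (hħ : ħ ≠ 0) (hα : α₁ * conj α₂ - conj α₁ * α₂ = Complex.I * ħ) : α₂ ≠ 0 := by
  rintro rfl
  have := im_frame hα
  simp only [map_zero, mul_zero, Complex.zero_im] at this
  exact hħ (by linarith)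

/-- The exponent of the ground state. -/
def groundExp (ħ : ℝ) (α₁ α₂ : ℂ) : ℂ := -(Complex.I * (Real.sign ħ : ℝ) * (α₁ / α₂))

/-- The real part is |ħ|/(2|α₂|²): the orientation prescribed by the area condition makes the ground
state decay for either sign of ħ. -/
theorem groundExp_pos (hħ : ħ ≠ 0) (hα : α₁ * conj α₂ - conj α₁ * α₂ = Complex.I * ħ) :
    0 < (groundExp ħ α₁ α₂).re := by
  have h2 := frame_ne hħ hα
  have h3 : 0 < Complex.normSq α₂ := Complex.normSq_pos.2 h2
  have h1 : groundExp ħ α₁ α₂ =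
      -(Complex.I * (α₁ * conj α₂)) * ((Real.sign ħ / Complex.normSq α₂ : ℝ) : ℂ) := by
    rw [groundExp]
    push_cast
    rw [← Complex.mul_conj]
    have : conj α₂ ≠ 0 := (map_ne_zero _).2 h2
    field_simp
  rw [h1, Complex.re_mul_ofReal, Complex.neg_re, Complex.I_mul_re, neg_neg, im_frame hα]
  have h4 : 0 < Real.sign ħ * ħ := by
    rw [← real_sign_mul_abs ħ]
    rcases hħ.lt_or_gt with h | h
    · rw [Real.sign_of_neg h, abs_of_neg h]
      simpa [Real.sign_of_neg h] using h
    · rw [Real.sign_of_pos h, abs_of_pos h]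
      simpa [Real.sign_of_pos h] using h
  have : ħ / 2 * (Real.sign ħ / Complex.normSq α₂) = Real.sign ħ * ħ / (2 * Complex.normSq α₂) := by
    field_simp
  rw [this]
  positivity

/-- The states of the oscillator. -/
def schrodingerState (hħ : ħ ≠ 0) (hα : α₁ * conj α₂ - conj α₁ * α₂ = Complex.I * ħ) :
    ℕ → 𝓢(ℝ, ℂ)
  | 0 => gauss (groundExp_pos hħ hα)
  | n + 1 => raiseOp ħ α₁ α₂ (schrodingerState hħ hα n)

theorem dTheta_gauss {γ : ℂ} (hγ : 0 < γ.re) : dTheta (gauss hγ) = -γ • mulTheta (gauss hγ) := by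
  ext θ
  rw [dTheta_apply, smul_apply, mulTheta_apply, gauss_apply]
  have := (hasDerivAt_gaussFun γ θ).deriv
  rw [show ⇑(gauss hγ) = gaussFun γ from rfl, this, smul_eq_mul, mul_assoc]

theorem lowerOp_ground (hħ : ħ ≠ 0) (hα : α₁ * conj α₂ - conj α₁ * α₂ = Complex.I * ħ) :
    lowerOp ħ α₁ α₂ (gauss (groundExp_pos hħ hα)) = 0 := by
  have h2 := frame_ne hħ hα
  simp only [lowerOp, schrodinger, Matrix.cons_val_one, Matrix.cons_val_zero,
    LinearMap.smul_apply, LinearMap.sub_apply, dTheta_gauss, smul_smul]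
  refine smul_eq_zero.2 (Or.inr ?_)
  rw [← sub_smul]
  refine smul_eq_zero.2 (Or.inl ?_)
  unfold groundExp
  push_cast
  field_simp
  ring

/-- Half of the Gaussian decay absorbs the exponential; completing the square gives the constant
exp(c²/Re γ). -/
theorem memLp_exp_mul_gauss {γ : ℂ} (hγ : 0 < γ.re) (c : ℝ) :
    MemLp (fun θ : ℝ => Real.exp (c * |θ|) * ‖gaussFun γ θ‖) 2 := by
  have hγ2 : 0 < (γ / 2).re := by
    rw [show γ / 2 = γ * ((1 / 2 : ℝ) : ℂ) by push_cast; ring, Complex.re_mul_ofReal]; positivity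
  have hre : (γ / 2).re = γ.re / 2 := by
    rw [show γ / 2 = γ * ((1 / 2 : ℝ) : ℂ) by push_cast; ring, Complex.re_mul_ofReal]; ring
  have h1 := (gauss hγ2).memLp 2 volume
  refine h1.of_le_mul (c := Real.exp (c ^ 2 / γ.re)) ?_ (Filter.Eventually.of_forall fun θ => ?_)
  · refine Continuous.aestronglyMeasurable ?_
    have := (contDiff_gaussFun γ).continuous
    fun_prop
  · rw [Real.norm_of_nonneg (by positivity), gauss_apply, norm_gaussFun, norm_gaussFun, hre,
      ← Real.exp_add, ← Real.exp_add, Real.exp_le_exp]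
    have h3 : c ^ 2 / γ.re - c * |θ| + γ.re * θ ^ 2 / 4 =
        (c - γ.re * |θ| / 2) ^ 2 / γ.re := by
      rw [← sq_abs θ]
      field_simp
      ring
    have h4 : 0 ≤ (c - γ.re * |θ| / 2) ^ 2 / γ.re := by positivity
    linarith

/-- Multiplication by θ is a combination of the ladder operators, so the span of the states contains
every θ^n times the ground state. A vector orthogonal to all of these, multiplied by the conjugate
ground state, has vanishing moments and hence is zero, because the Gaussian has no zeros. -/
theorem schrodinger_total (hħ : ħ ≠ 0) (hα : α₁ * conj α₂ - conj α₁ * α₂ = Complex.I * ħ)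
    (hl : ∀ n, lowerOp ħ α₁ α₂ (schrodingerState hħ hα n) ∈
      Oscillator.core (schrodingerState hħ hα))
    (r : Lp ℂ 2 (volume : Measure ℝ))
    (hr : ∀ n, ⟪schwartzToL2 (schrodingerState hħ hα n), r⟫_ℂ = 0) : r = 0 := by
  set H := schrodingerState hħ hα with hH
  set γ := groundExp ħ α₁ α₂ with hγdef
  have hγ : 0 < γ.re := groundExp_pos hħ hα
  have hs : ∀ f ∈ Oscillator.core H, mulTheta f ∈ Oscillator.core H := by
    intro f hf
    have hA : lowerOp ħ α₁ α₂ f ∈ Oscillator.core H := by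
      have : Oscillator.core H ≤ (Oscillator.core H).comap (lowerOp ħ α₁ α₂) := by
        refine Submodule.span_le.2 ?_
        rintro _ ⟨n, rfl⟩
        exact hl n
      exact this hf
    have hR : raiseOp ħ α₁ α₂ f ∈ Oscillator.core H := by
      have : Oscillator.core H ≤ (Oscillator.core H).comap (raiseOp ħ α₁ α₂) := by
        refine Submodule.span_le.2 ?_
        rintro _ ⟨n, rfl⟩
        exact Oscillator.mem_core H (n + 1)
      exact this hf
    have h1 := Submodule.sub_mem _ (Submodule.smul_mem _ α₂ hR) (Submodule.smul_mem _ (conj α₂) hA)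
    rw [← schrodinger_one_eq hħ hα] at h1
    have h2 : Complex.I * ((Real.sign ħ * √|ħ| : ℝ) : ℂ) ≠ 0 := by
      refine mul_ne_zero Complex.I_ne_zero (Complex.ofReal_ne_zero.2 (mul_ne_zero ?_ ?_))
      · intro h0; exact hħ (Real.sign_eq_zero_iff.1 h0)
      · exact (Real.sqrt_pos.2 (abs_pos.2 hħ)).ne'
    have h3 := Submodule.smul_mem _ (Complex.I * ((Real.sign ħ * √|ħ| : ℝ) : ℂ))⁻¹ h1
    simp only [schrodinger, Matrix.cons_val_one, Matrix.cons_val_zero, LinearMap.smul_apply] at h3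
    rwa [inv_smul_smul₀ h2] at h3
  have hpow : ∀ n : ℕ, (mulTheta ^ n) (gauss hγ) ∈ Oscillator.core H := by
    intro n
    induction n with
    | zero => exact Oscillator.mem_core H 0
    | succ n ih => rw [pow_succ', Module.End.mul_apply]; exact hs _ ih
  have hpa : ∀ (n : ℕ) (θ : ℝ), (mulTheta ^ n) (gauss hγ) θ = (θ : ℂ) ^ n * gaussFun γ θ := by
    intro n θ
    induction n with
    | zero => simp [gauss_apply]
    | succ n ih => rw [pow_succ', Module.End.mul_apply, mulTheta_apply, ih]; ring
  have horth : ∀ f ∈ Oscillator.core H, ⟪schwartzToL2 f, r⟫_ℂ = 0 := by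
    intro f hf
    induction hf using Submodule.span_induction with
    | mem x hx => obtain ⟨k, rfl⟩ := hx; exact hr k
    | zero => simp
    | add x y _ _ hx hy => rw [map_add, inner_add_left, hx, hy, add_zero]
    | smul c x _ hx => rw [map_smul, inner_smul_left, hx, mul_zero]
  have hrm := Lp.memLp r
  have hgm : AEStronglyMeasurable (fun θ : ℝ => conj (gaussFun γ θ)) volume :=
    (Complex.continuous_conj.comp (contDiff_gaussFun γ).continuous).aestronglyMeasurable
  have hz := ae_eq_zero_of_moments (f := fun θ => conj (gaussFun γ θ) * r θ) (fun c => ?_)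
    (hgm.mul hrm.aestronglyMeasurable) (fun n => ?_)
  · refine (Lp.eq_zero_iff_ae_eq_zero).2 ?_
    filter_upwards [hz] with θ hθ
    refine (mul_eq_zero.1 hθ).resolve_left ?_
    exact (map_ne_zero _).2 (Complex.exp_ne_zero _)
  · have h1 := (memLp_exp_mul_gauss hγ c).integrable_mul hrm.norm
    refine h1.congr (Filter.Eventually.of_forall fun θ => ?_)
    simp [mul_assoc]
  · have h1 := horth _ (hpow n)
    rw [L2.inner_def] at h1
    rw [← h1]
    refine integral_congr_ae ?_
    filter_upwards [SchwartzMap.coeFn_toLp ((mulTheta ^ n) (gauss hγ)) 2 volume] with θ hθ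
    have h2 : (schwartzToL2 ((mulTheta ^ n) (gauss hγ))) θ = (θ : ℂ) ^ n * gaussFun γ θ := by
      rw [← hpa]; exact hθ
    rw [h2]
    have h3 : ⟪(θ : ℂ) ^ n * gaussFun γ θ, r θ⟫_ℂ = r θ * conj ((θ : ℂ) ^ n * gaussFun γ θ) := rfl
    rw [h3, map_mul, map_pow, Complex.conj_ofReal]
    ring

theorem schrodinger_oscillator (hħ : ħ ≠ 0)
    (hα : α₁ * conj α₂ - conj α₁ * α₂ = Complex.I * ħ) :
    Oscillator schwartzToL2 (lowerOp ħ α₁ α₂) (raiseOp ħ α₁ α₂) (schrodingerState hħ hα) := by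
  have hlow : ∀ n, lowerOp ħ α₁ α₂ (schrodingerState hħ hα (n + 1)) =
      ((n : ℂ) + 1) • schrodingerState hħ hα n := by
    intro n
    induction n with
    | zero =>
      simp only [schrodingerState, ladder_comm hħ hα]
      rw [lowerOp_ground hħ hα]
      simp
    | succ n ih =>
      rw [schrodingerState, ladder_comm hħ hα, ih, map_smul, schrodingerState]
      push_cast
      module
  refine ⟨schwartzToL2_injective, ladder_comm hħ hα, lowerOp_adj, lowerOp_ground hħ hα,
    fun _ => rfl, fun h0 => ?_, schrodinger_total hħ hα fun n => ?_⟩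
  · have := DFunLike.congr_fun h0 0
    exact Complex.exp_ne_zero _ this
  · rcases n with _ | n
    · rw [schrodingerState, lowerOp_ground hħ hα]
      exact Submodule.zero_mem _
    · rw [hlow]
      exact Submodule.smul_mem _ _ (Oscillator.mem_core _ n)

end schrodinger
end

/-! ### The Gram matrix of the dual basis. -/

noncomputable section

open scoped ComplexConjugate
open Lie235

/-- The Gram matrix of the basis dual to `X₁, …, X₅` is block diagonal, with the blocks in degrees
`-1` and `-3` proportional to each other. -/
structure IsBlockCogram (g : LinearMap.BilinForm ℝ Lie235) (p r s k m : ℝ) : Prop where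
  inv_eq : (Matrix.of fun i j => g (X i) (X j))⁻¹ =
    !![p, r, 0, 0, 0; r, s, 0, 0, 0; 0, 0, k, 0, 0; 0, 0, 0, m * p, m * r; 0, 0, 0, m * r, m * s]
  p_pos : 0 < p
  det_pos : 0 < p * s - r ^ 2
  k_pos : 0 < k
  m_pos : 0 < m

theorem Lie235.X_ne_zero (i : Fin 5) : X i ≠ 0 := by
  intro h
  have := congrFun h i
  rw [X_apply, if_pos rfl] at this
  exact one_ne_zero this

theorem Lie235.X_mem_gr (i : Fin 5) : X i ∈ gr (wt i) := by
  intro j hj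
  rw [X_apply, if_neg]
  rintro rfl
  exact hj rfl

theorem Lie235.lie_X_zero_two : ⁅X 0, X 2⁆ = X 3 := by
  funext i
  fin_cases i <;> simp [bracket_apply, X_apply]

theorem Lie235.lie_X_one_two : ⁅X 1, X 2⁆ = X 4 := by
  funext i
  fin_cases i <;> simp [bracket_apply, X_apply]

/-- Since X₄ = [X₁, X₃] and X₅ = [X₂, X₃], the hypotheses on b express the Gram matrix of 𝔤₋₃ as μ
times that of 𝔤₋₁; inverting blockwise gives m = 1/μ. -/
theorem exists_isBlockCogram {g : LinearMap.BilinForm ℝ Lie235} (hg : IsGradedEuclidean g)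
    {b : LinearMap.BilinForm ℝ (Lie235.gr 1)}
    (hb : ∀ (x y : Lie235.gr 1) (z : Lie235.gr 2),
      g ⁅(x : Lie235), (z : Lie235)⁆ ⁅(y : Lie235), (z : Lie235)⁆ =
        g (z : Lie235) (z : Lie235) * b x y)
    (hprop : ∃ c : ℝ, ∀ x y : Lie235.gr 1, b x y = c * g (x : Lie235) (y : Lie235)) :
    ∃ p r s k m : ℝ, IsBlockCogram g p r s k m := by
  obtain ⟨c, hc⟩ := hprop
  have hz : ∀ i j, wt i ≠ wt j → g (X i) (X j) = 0 := fun i j hij =>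
    hg.graded _ _ hij _ (X_mem_gr i) _ (X_mem_gr j)
  have hp : ∀ i, 0 < g (X i) (X i) := fun i => hg.pos _ (X_ne_zero i)
  have h33 := hb ⟨X 0, X_mem_gr 0⟩ ⟨X 0, X_mem_gr 0⟩ ⟨X 2, X_mem_gr 2⟩
  have h34 := hb ⟨X 0, X_mem_gr 0⟩ ⟨X 1, X_mem_gr 1⟩ ⟨X 2, X_mem_gr 2⟩
  have h44 := hb ⟨X 1, X_mem_gr 1⟩ ⟨X 1, X_mem_gr 1⟩ ⟨X 2, X_mem_gr 2⟩
  simp only [hc, lie_X_zero_two, lie_X_one_two] at h33 h34 h44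
  have h10 : g (X 1) (X 0) = g (X 0) (X 1) := hg.symm _ _
  have h43 : g (X 4) (X 3) = g (X 3) (X 4) := hg.symm _ _
  have hdisc : 0 < g (X 0) (X 0) * g (X 1) (X 1) - g (X 0) (X 1) ^ 2 := by
    -- The square length of this vector is g(X 1, X 1) times the Gram determinant.
    have hv : g (X 1) (X 1) • X 0 - g (X 0) (X 1) • X 1 ≠ 0 := by
      intro h
      have h0 := congrArg (fun v => g (X 0) v) h
      have h1 := congrArg (fun v => g (X 1) v) h
      have := congrFun (sub_eq_zero.mp h) 0
      rw [smul_apply, smul_apply, X_apply, X_apply] at this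
      simp at this
      exact (hp 1).ne' this
    have h := hg.pos _ hv
    simp only [map_sub, map_smul, LinearMap.sub_apply, LinearMap.smul_apply, smul_eq_mul,
      h10] at h
    refine pos_of_mul_pos_right (a := g (X 1) (X 1)) ?_ (hp 1).le
    linarith
  -- Positivity follows from g(X 3, X 3) = μ g(X 0, X 0).
  have hμ : 0 < g (X 2) (X 2) * c := by
    refine pos_of_mul_pos_left (b := g (X 0) (X 0)) ?_ (hp 0).le
    linarith [hp 3]
  set μ := g (X 2) (X 2) * c with hμdef
  rw [← mul_assoc, ← hμdef] at h33 h34 h44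
  set x := g (X 0) (X 0)
  set y := g (X 0) (X 1)
  set z := g (X 1) (X 1)
  set Δ := x * z - y ^ 2 with hΔ
  have e1 : z / Δ * x - y / Δ * y = 1 := by
    rw [div_mul_eq_mul_div, div_mul_eq_mul_div, ← sub_div, div_eq_one_iff_eq hdisc.ne', hΔ]
    ring
  have hG : (Matrix.of fun i j => g (X i) (X j)) =
      !![x, y, 0, 0, 0; y, z, 0, 0, 0; 0, 0, g (X 2) (X 2), 0, 0; 0, 0, 0, μ * x, μ * y;
        0, 0, 0, μ * y, μ * z] := by
    ext i j
    fin_cases i <;> fin_cases j <;>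
      first
        | exact hz _ _ (by decide)
        | rfl
        | exact h10
        | exact h33
        | exact h34
        | exact h44
        | exact h43.trans h34
  refine ⟨z / Δ, -y / Δ, x / Δ, (g (X 2) (X 2))⁻¹, μ⁻¹, ?_, div_pos (hp 1) hdisc, ?_,
    inv_pos.2 (hp 2), inv_pos.2 hμ⟩
  · rw [hG]
    refine Matrix.inv_eq_right_inv ?_
    have hΔ' := hdisc.ne'
    have h2 := (hp 2).ne'
    have hμ' := hμ.ne'
    ext i j
    fin_cases i <;> fin_cases j <;>
      simp [Matrix.mul_apply, Fin.sum_univ_five] <;> field_simp <;> rw [hΔ] <;> ring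
  · have : z / Δ * (x / Δ) - (-y / Δ) ^ 2 = 1 / Δ := by
      field_simp
      rw [hΔ]
      ring
    rw [this]
    exact one_div_pos.2 hdisc

theorem isBlockCogram_of_orthonormal {g : LinearMap.BilinForm ℝ Lie235}
    (h : ∀ i j, g (X i) (X j) = if i = j then 1 else 0) : IsBlockCogram g 1 0 1 1 1 := by
  refine ⟨?_, one_pos, by norm_num, one_pos, one_pos⟩
  have : (Matrix.of fun i j => g (X i) (X j)) = 1 := by
    ext i j
    simp [h, Matrix.one_apply]
  rw [this, inv_one]
  ext i j
  fin_cases i <;> fin_cases j <;> simp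

end

/-! ### Minors: the induced inner product on basis forms. -/

noncomputable section

open scoped ComplexConjugate
open Lie235

/-- The increasing enumeration of a finite set is unique, so explicit lists of indices may be used
to compute minors. -/
theorem minor_eq_det (A : Matrix (Fin 5) (Fin 5) ℝ) {S T : Finset (Fin 5)} {n : ℕ}
    (f f' : Fin n → Fin 5) (hf : StrictMono f) (hf' : StrictMono f')
    (hS : Finset.univ.image f = S) (hT : Finset.univ.image f' = T) :
    minor A S T = (A.submatrix f f').det := by
  subst hS hT
  have hc : (Finset.univ.image f).card = n := by
    rw [Finset.card_image_of_injective _ hf.injective, Finset.card_univ, Fintype.card_fin]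
  have hc' : (Finset.univ.image f').card = n := by
    rw [Finset.card_image_of_injective _ hf'.injective, Finset.card_univ, Fintype.card_fin]
  have key : ∀ (m : ℕ) (hm : m = n) (h1 : (Finset.univ.image f).card = m)
      (h2 : (Finset.univ.image f').card = m),
      (A.submatrix ((Finset.univ.image f).orderEmbOfFin h1)
        ((Finset.univ.image f').orderEmbOfFin h2)).det = (A.submatrix f f').det := by
    rintro m rfl h1 h2
    rw [← Finset.orderEmbOfFin_unique h1 (fun x => Finset.mem_image_of_mem _ (Finset.mem_univ x))
      hf, ← Finset.orderEmbOfFin_unique h2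
      (fun x => Finset.mem_image_of_mem _ (Finset.mem_univ x)) hf']
  rw [minor, dif_pos (hc'.trans hc.symm)]
  exact key _ hc rfl (hc'.trans hc.symm)

theorem sum_orderEmbOfFin (w : Fin 5 → ℕ) (S : Finset (Fin 5)) {n : ℕ} (h : S.card = n) :
    ∑ i, w (S.orderEmbOfFin h i) = ∑ i ∈ S, w i := by
  have := Finset.sum_map Finset.univ (S.orderEmbOfFin h).toEmbedding w
  rw [Finset.map_orderEmbOfFin_univ] at this
  exact this.symm

/-- A nonzero term of the Leibniz expansion matches T with S by a weight-preserving bijection. -/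
theorem minor_eq_zero {A : Matrix (Fin 5) (Fin 5) ℝ} (w : Fin 5 → ℕ)
    (hA : ∀ i j, w i ≠ w j → A i j = 0) {S T : Finset (Fin 5)}
    (h : ¬ (S.card = T.card ∧ ∑ i ∈ S, w i = ∑ i ∈ T, w i)) : minor A S T = 0 := by
  unfold minor
  split_ifs with hc
  · have hw : ∑ i ∈ S, w i ≠ ∑ i ∈ T, w i := fun hw => h ⟨hc.symm, hw⟩
    rw [Matrix.det_apply]
    refine Finset.sum_eq_zero fun σ _ => ?_
    suffices ∃ i, w (S.orderEmbOfFin rfl (σ i)) ≠ w (T.orderEmbOfFin hc i) by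
      obtain ⟨i, hi⟩ := this
      rw [Finset.prod_eq_zero (Finset.mem_univ i) (by exact hA _ _ hi), smul_zero]
    by_contra! hcon
    refine hw ?_
    rw [← sum_orderEmbOfFin w S rfl, ← sum_orderEmbOfFin w T hc, ← Equiv.sum_comp σ]
    exact Finset.sum_congr rfl fun i _ => hcon i
  · rfl

theorem det_four {R : Type*} [CommRing R] (A : Matrix (Fin 4) (Fin 4) R) :
    A.det =
      A 0 0 * (A 1 1 * (A 2 2 * A 3 3 - A 2 3 * A 3 2) - A 1 2 * (A 2 1 * A 3 3 - A 2 3 * A 3 1)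
        + A 1 3 * (A 2 1 * A 3 2 - A 2 2 * A 3 1))
      - A 0 1 * (A 1 0 * (A 2 2 * A 3 3 - A 2 3 * A 3 2) - A 1 2 * (A 2 0 * A 3 3 - A 2 3 * A 3 0)
        + A 1 3 * (A 2 0 * A 3 2 - A 2 2 * A 3 0))
      + A 0 2 * (A 1 0 * (A 2 1 * A 3 3 - A 2 3 * A 3 1) - A 1 1 * (A 2 0 * A 3 3 - A 2 3 * A 3 0)
        + A 1 3 * (A 2 0 * A 3 1 - A 2 1 * A 3 0))
      - A 0 3 * (A 1 0 * (A 2 1 * A 3 2 - A 2 2 * A 3 1) - A 1 1 * (A 2 0 * A 3 2 - A 2 2 * A 3 0)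
        + A 1 2 * (A 2 0 * A 3 1 - A 2 1 * A 3 0)) := by
  rw [Matrix.det_succ_row_zero]
  simp only [Fin.sum_univ_four, Matrix.det_fin_three, Matrix.submatrix_apply]
  simp [Fin.succAbove, Fin.lt_def]
  ring

namespace IsBlockCogram

variable {g : LinearMap.BilinForm ℝ Lie235} {p r s k m : ℝ}

theorem lambdaGram_eq_zero (h : IsBlockCogram g p r s k m) {S T : Finset (Fin 5)}
    (hST : ¬ (S.card = T.card ∧ formWt S = formWt T)) : lambdaGram g S T = 0 := by
  refine minor_eq_zero wt ?_ hST
  rw [h.inv_eq]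
  intro i j hij
  fin_cases i <;> fin_cases j <;> first | rfl | exact absurd rfl hij

/-- The block of the metric in degrees `-1` and `-3`. -/
def block (p r s : ℝ) : Fin 2 → Fin 2 → ℝ := ![![p, r], ![r, s]]

theorem lambdaGram_eq_det (h : IsBlockCogram g p r s k m) {S T : Finset (Fin 5)} {n : ℕ}
    (f f' : Fin n → Fin 5) (hf : StrictMono f) (hf' : StrictMono f')
    (hS : Finset.univ.image f = S) (hT : Finset.univ.image f' = T) :
    lambdaGram g S T = (Matrix.submatrix
      (!![p, r, 0, 0, 0; r, s, 0, 0, 0; 0, 0, k, 0, 0; 0, 0, 0, m * p, m * r;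
        0, 0, 0, m * r, m * s] : Matrix (Fin 5) (Fin 5) ℝ) f f').det := by
  rw [lambdaGram, h.inv_eq, minor_eq_det _ f f' hf hf' hS hT]

theorem lambdaGram_empty (h : IsBlockCogram g p r s k m) : lambdaGram g ∅ ∅ = 1 := by
  rw [h.lambdaGram_eq_det (n := 0) ![] ![] (by decide) (by decide) (by decide) (by decide), Matrix.det_fin_zero]

/-- The vectors `X₁, X₂` spanning `𝔤₋₁`. -/
def low : Fin 2 → Fin 5 := ![0, 1]

/-- The vectors `X₄, X₅` spanning `𝔤₋₃`. -/
def high : Fin 2 → Fin 5 := ![3, 4]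

theorem lambdaGram_low (h : IsBlockCogram g p r s k m) (i j : Fin 2) :
    lambdaGram g {low i} {low j} = block p r s i j := by
  rw [h.lambdaGram_eq_det (n := 1) ![low i] ![low j] (by decide +revert) (by decide +revert)
    (by decide +revert) (by decide +revert)]
  simp only [Matrix.det_fin_one, Matrix.submatrix_apply]
  fin_cases i <;> fin_cases j <;> simp [low, block]

/-- Low and high indices do not mix, so the determinant is a product. Up to the factor m this is the
tensor square of the one block, which is what lets a single frame diagonalize it. -/
theorem lambdaGram_low_high (h : IsBlockCogram g p r s k m) (i i' j j' : Fin 2) :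
    lambdaGram g {low i, high i'} {low j, high j'} =
      m * (block p r s i j * block p r s i' j') := by
  rw [h.lambdaGram_eq_det (n := 2) ![low i, high i'] ![low j, high j'] (by decide +revert)
    (by decide +revert) (by decide +revert) (by decide +revert)]
  simp only [Matrix.det_fin_two, Matrix.submatrix_apply]
  fin_cases i <;> fin_cases i' <;> fin_cases j <;> fin_cases j' <;>
    simp [low, high, block] <;> ring

theorem lambdaGram_low_two_high (h : IsBlockCogram g p r s k m) (i i' j j' : Fin 2) :
    lambdaGram g {low i, 2, high i'} {low j, 2, high j'} =
      k * m * (block p r s i j * block p r s i' j') := by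
  rw [h.lambdaGram_eq_det (n := 3) ![low i, 2, high i'] ![low j, 2, high j'] (by decide +revert)
    (by decide +revert) (by decide +revert) (by decide +revert)]
  simp only [Matrix.det_fin_three, Matrix.submatrix_apply]
  fin_cases i <;> fin_cases i' <;> fin_cases j <;> fin_cases j' <;>
    simp [low, high, block] <;> ring

theorem lambdaGram_low_rest (h : IsBlockCogram g p r s k m) (i j : Fin 2) :
    lambdaGram g {low i, 2, 3, 4} {low j, 2, 3, 4} =
      k * m ^ 2 * (p * s - r ^ 2) * block p r s i j := by
  rw [h.lambdaGram_eq_det (n := 4) ![low i, 2, 3, 4] ![low j, 2, 3, 4] (by decide +revert)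
    (by decide +revert) (by decide +revert) (by decide +revert)]
  simp only [det_four, Matrix.submatrix_apply]
  fin_cases i <;> fin_cases j <;>
    simp [low, block] <;> ring

theorem lambdaGram_univ (h : IsBlockCogram g p r s k m) :
    lambdaGram g {0, 1, 2, 3, 4} {0, 1, 2, 3, 4} = k * m ^ 2 * (p * s - r ^ 2) ^ 2 := by
  rw [h.lambdaGram_eq_det (n := 5) id id (by decide) (by decide) (by decide) (by decide)]
  rw [Matrix.submatrix_id_id, Matrix.det_succ_row_zero]
  simp only [Fin.sum_univ_five, det_four, Matrix.submatrix_apply]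
  simp [Fin.succAbove, Fin.lt_def]
  ring

theorem lambdaGram_zero_one (h : IsBlockCogram g p r s k m) :
    lambdaGram g {0, 1} {0, 1} = p * s - r ^ 2 := by
  rw [h.lambdaGram_eq_det (n := 2) ![0, 1] ![0, 1] (by decide) (by decide)
    (by decide) (by decide)]
  simp only [Matrix.det_fin_two, Matrix.submatrix_apply]
  simp
  ring

theorem lambdaGram_low_two (h : IsBlockCogram g p r s k m) (i j : Fin 2) :
    lambdaGram g {low i, 2} {low j, 2} = k * block p r s i j := by
  rw [h.lambdaGram_eq_det (n := 2) ![low i, 2] ![low j, 2] (by decide +revert)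
    (by decide +revert) (by decide +revert) (by decide +revert)]
  simp only [Matrix.det_fin_two, Matrix.submatrix_apply]
  fin_cases i <;> fin_cases j <;> simp [low, block] <;> ring

theorem lambdaGram_zero_one_two (h : IsBlockCogram g p r s k m) :
    lambdaGram g {0, 1, 2} {0, 1, 2} = k * (p * s - r ^ 2) := by
  rw [h.lambdaGram_eq_det (n := 3) ![0, 1, 2] ![0, 1, 2] (by decide) (by decide)
    (by decide) (by decide)]
  simp only [Matrix.det_fin_three, Matrix.submatrix_apply]
  simp
  ring

theorem lambdaGram_zero_one_high (h : IsBlockCogram g p r s k m) (i j : Fin 2) :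
    lambdaGram g {0, 1, high i} {0, 1, high j} = m * (p * s - r ^ 2) * block p r s i j := by
  rw [h.lambdaGram_eq_det (n := 3) ![0, 1, high i] ![0, 1, high j] (by decide +revert)
    (by decide +revert) (by decide +revert) (by decide +revert)]
  simp only [Matrix.det_fin_three, Matrix.submatrix_apply]
  fin_cases i <;> fin_cases j <;> simp [high, block] <;> ring

theorem lambdaGram_zero_one_two_high (h : IsBlockCogram g p r s k m) (i j : Fin 2) :
    lambdaGram g {0, 1, 2, high i} {0, 1, 2, high j} =
      k * m * (p * s - r ^ 2) * block p r s i j := by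
  rw [h.lambdaGram_eq_det (n := 4) ![0, 1, 2, high i] ![0, 1, 2, high j] (by decide +revert)
    (by decide +revert) (by decide +revert) (by decide +revert)]
  simp only [det_four, Matrix.submatrix_apply]
  fin_cases i <;> fin_cases j <;>
    simp [high, block] <;> ring

theorem lambdaGram_zero_one_three_four (h : IsBlockCogram g p r s k m) :
    lambdaGram g {0, 1, 3, 4} {0, 1, 3, 4} = m ^ 2 * (p * s - r ^ 2) ^ 2 := by
  rw [h.lambdaGram_eq_det (n := 4) ![0, 1, 3, 4] ![0, 1, 3, 4] (by decide) (by decide)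
    (by decide) (by decide)]
  simp only [det_four, Matrix.submatrix_apply]
  simp
  ring

end IsBlockCogram

end

/-! ### The differentials in coordinates. -/

noncomputable section

open scoped ComplexConjugate
open Lie235

section Table

variable {V : Type*} [AddCommGroup V] [Module ℂ V] {ω : Form V}

/-- The conditions are bundled into one decidable proposition, so that each entry of the table below
is settled by `decide`. -/
theorem wedge_pos {i : Fin 5} {S T : Finset (Fin 5)}
    (h : i ∈ S ∧ S.erase i = T ∧ Even (S.filter (· < i)).card) : wedge V i ω S = ω T := by
  obtain ⟨h1, rfl, h2⟩ := h
  change (if i ∈ S then wedgeSign i S • ω (S.erase i) else 0) = _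
  rw [if_pos h1, wedgeSign, h2.neg_one_pow, one_smul]

theorem wedge_neg {i : Fin 5} {S T : Finset (Fin 5)}
    (h : i ∈ S ∧ S.erase i = T ∧ ¬ Even (S.filter (· < i)).card) : wedge V i ω S = -ω T := by
  obtain ⟨h1, rfl, h2⟩ := h
  change (if i ∈ S then wedgeSign i S • ω (S.erase i) else 0) = _
  rw [if_pos h1, wedgeSign, (Nat.not_even_iff_odd.1 h2).neg_one_pow, neg_smul, one_smul]

theorem wedge_zero {i : Fin 5} {S : Finset (Fin 5)} (h : i ∉ S) : wedge V i ω S = 0 :=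
  if_neg h

/-- `χ^i ∧ χ^j ∧ ι_{X_k} ω`. -/
def wwc (i j k : Fin 5) (ω : Form V) : Form V := wedge V i (wedge V j (contract V k ω))

theorem wwc_apply (i j k : Fin 5) (S : Finset (Fin 5)) :
    wwc i j k ω S = if i ∈ S ∧ j ∈ S.erase i ∧ k ∉ (S.erase i).erase j then
      (-1 : ℂ) ^ ((S.filter (· < i)).card + ((S.erase i).filter (· < j)).card +
        (((S.erase i).erase j).filter (· < k)).card) • ω (insert k ((S.erase i).erase j))
      else 0 := by
  change (if i ∈ S then wedgeSign i S • (if j ∈ S.erase i then wedgeSign j (S.erase i) •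
    (if k ∈ (S.erase i).erase j then 0 else wedgeSign k ((S.erase i).erase j) •
      ω (insert k ((S.erase i).erase j))) else 0) else 0) = _
  by_cases h1 : i ∈ S
  · by_cases h2 : j ∈ S.erase i
    · by_cases h3 : k ∈ (S.erase i).erase j
      · rw [if_pos h1, if_pos h2, if_pos h3, if_neg (fun h => h.2.2 h3), smul_zero, smul_zero]
      · rw [if_pos h1, if_pos h2, if_neg h3, if_pos ⟨h1, h2, h3⟩, wedgeSign, wedgeSign, wedgeSign,
          smul_smul, smul_smul, pow_add, pow_add, mul_assoc]
    · rw [if_pos h1, if_neg h2, if_neg (fun h => h2 h.2.1), smul_zero]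
  · rw [if_neg h1, if_neg (fun h => h1 h.1)]

theorem wwc_pos {i j k : Fin 5} {S A : Finset (Fin 5)}
    (h : (i ∈ S ∧ j ∈ S.erase i ∧ k ∉ (S.erase i).erase j) ∧
      insert k ((S.erase i).erase j) = A ∧
      Even ((S.filter (· < i)).card + ((S.erase i).filter (· < j)).card +
        (((S.erase i).erase j).filter (· < k)).card)) : wwc i j k ω S = ω A := by
  obtain ⟨h1, rfl, h2⟩ := h
  rw [wwc_apply, if_pos h1, h2.neg_one_pow, one_smul]

theorem wwc_neg {i j k : Fin 5} {S A : Finset (Fin 5)}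
    (h : (i ∈ S ∧ j ∈ S.erase i ∧ k ∉ (S.erase i).erase j) ∧
      insert k ((S.erase i).erase j) = A ∧
      ¬ Even ((S.filter (· < i)).card + ((S.erase i).filter (· < j)).card +
        (((S.erase i).erase j).filter (· < k)).card)) : wwc i j k ω S = -ω A := by
  obtain ⟨h1, rfl, h2⟩ := h
  rw [wwc_apply, if_pos h1, (Nat.not_even_iff_odd.1 h2).neg_one_pow, neg_smul, one_smul]

theorem wwc_zero {i j k : Fin 5} {S : Finset (Fin 5)}
    (h : ¬ (i ∈ S ∧ j ∈ S.erase i ∧ k ∉ (S.erase i).erase j)) : wwc i j k ω S = 0 := by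
  rw [wwc_apply, if_neg h]

/-- One term for each nonzero structure constant. -/
theorem ceDiff_eq (ω : Form V) :
    ceDiff V ω = -(wwc 0 1 2 ω + wwc 0 2 3 ω + wwc 1 2 4 ω) := by
  have hI : ∀ i : Fin 5, Finset.Ioi i = Finset.univ.filter (i < ·) := fun i => by
    ext j; simp
  simp only [ceDiff, hI, Finset.sum_filter, Fin.sum_univ_five, bracket_apply, X_apply]
  simp [wwc]

theorem deRham_apply {ρ : Fin 5 → V →ₗ[ℂ] V} (hρ : ρ 3 = 0 ∧ ρ 4 = 0) (S : Finset (Fin 5)) :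
    deRham ρ ω S = wedge V 0 (fun T => ρ 0 (ω T)) S + wedge V 1 (fun T => ρ 1 (ω T)) S +
      wedge V 2 (fun T => ρ 2 (ω T)) S +
      -(wwc 0 1 2 ω S + wwc 0 2 3 ω S + wwc 1 2 4 ω S) := by
  have h0 : ∀ i S, wedge V i (fun _ : Finset (Fin 5) => (0 : V)) S = 0 := fun i S =>
    congrFun (map_zero (wedge V i)) S
  rw [deRham, LinearMap.add_apply, ceDiff_eq, LinearMap.sum_apply, Fin.sum_univ_five]
  simp only [LinearMap.comp_apply, Pi.add_apply, Pi.neg_apply]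
  have h : ∀ i, (ρ i).compLeft (Finset (Fin 5)) ω = fun T => ρ i (ω T) := fun i => rfl
  rw [h, h, h, h, h, hρ.1, hρ.2]
  simp only [LinearMap.zero_apply, h0, add_zero]

/-- With this, the table for d also serves for ∂. -/
theorem ceDiff_eq_deRham : ceDiff V ω = deRham (0 : Fin 5 → V →ₗ[ℂ] V) ω := by
  funext S
  have h0 : ∀ i S, wedge V i (fun _ : Finset (Fin 5) => (0 : V)) S = 0 := fun i S =>
    congrFun (map_zero (wedge V i)) S
  rw [deRham_apply ⟨rfl, rfl⟩, ceDiff_eq]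
  simp only [Pi.zero_apply, LinearMap.zero_apply, h0, zero_add, Pi.add_apply, Pi.neg_apply]

theorem deRham_eq_zero {ρ : Fin 5 → V →ₗ[ℂ] V} (hρ : ρ 3 = 0 ∧ ρ 4 = 0) {q : ℕ}
    (hω : ∀ S, S.card ≠ q → ω S = 0) {S : Finset (Fin 5)} (hS : S.card ≠ q + 1) :
    deRham ρ ω S = 0 := by
  have hw : ∀ i, wedge V i (fun T => ρ i (ω T)) S = 0 := fun i => by
    by_cases hi : i ∈ S
    · change (if i ∈ S then wedgeSign i S • ρ i (ω (S.erase i)) else 0) = _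
      have hc := Finset.card_erase_add_one hi
      rw [if_pos hi, hω _ (by omega), map_zero, smul_zero]
    · exact wedge_zero hi
  have hc : ∀ i j k, wwc i j k ω S = 0 := fun i j k => by
    rw [wwc_apply]
    split_ifs with h
    · have h1 := Finset.card_erase_add_one h.1
      have h2 := Finset.card_erase_add_one h.2.1
      rw [hω _ (by rw [Finset.card_insert_of_notMem h.2.2]; omega), smul_zero]
    · rfl
  rw [deRham_apply hρ, hw, hw, hw, hc, hc, hc]
  simp

theorem ceDiff_eq_zero_of_card {q : ℕ} (hω : ∀ S, S.card ≠ q → ω S = 0) {S : Finset (Fin 5)}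
    (hS : S.card ≠ q + 1) : ceDiff V ω S = 0 := by
  rw [ceDiff_eq_deRham]
  exact deRham_eq_zero ⟨rfl, rfl⟩ hω hS

/-- Each term of ∂ replaces a covector by a product of two covectors of the same total weight. -/
theorem ceDiff_eq_zero_of_formWt {w : ℕ} (hω : ∀ S, formWt S ≠ w → ω S = 0)
    {S : Finset (Fin 5)} (hS : formWt S ≠ w) : ceDiff V ω S = 0 := by
  have hc : ∀ i j k, (∀ S : Finset (Fin 5), i ∈ S ∧ j ∈ S.erase i ∧ k ∉ (S.erase i).erase j →
      formWt (insert k ((S.erase i).erase j)) = formWt S) → wwc i j k ω S = 0 := by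
    intro i j k h
    rw [wwc_apply]
    split_ifs with h1
    · rw [hω _ (by rw [h S h1]; exact hS), smul_zero]
    · rfl
  rw [ceDiff_eq, Pi.neg_apply, Pi.add_apply, Pi.add_apply, hc 0 1 2 (by decide),
    hc 0 2 3 (by decide), hc 1 2 4 (by decide)]
  simp

variable {ρ : Fin 5 → V →ₗ[ℂ] V}

/-- In degree q + 1 the table lists the index sets of weight at most N_(q+1); higher components of
dω do not affect the Rumin differential. -/
theorem deRham_0 (hρ : ρ 3 = 0 ∧ ρ 4 = 0) :
    deRham ρ ω {0} = ρ 0 (ω ∅) := by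
  rw [deRham_apply hρ,
    wedge_pos (i := 0) (T := ∅) (by decide),
    wedge_zero (i := 1) (by decide),
    wedge_zero (i := 2) (by decide),
    wwc_zero (i := 0) (j := 1) (by decide),
    wwc_zero (i := 0) (j := 2) (by decide),
    wwc_zero (i := 1) (j := 2) (by decide)]
  abel

theorem deRham_1 (hρ : ρ 3 = 0 ∧ ρ 4 = 0) :
    deRham ρ ω {1} = ρ 1 (ω ∅) := by
  rw [deRham_apply hρ,
    wedge_zero (i := 0) (by decide),
    wedge_pos (i := 1) (T := ∅) (by decide),
    wedge_zero (i := 2) (by decide),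
    wwc_zero (i := 0) (j := 1) (by decide),
    wwc_zero (i := 0) (j := 2) (by decide),
    wwc_zero (i := 1) (j := 2) (by decide)]
  abel

theorem deRham_01 (hρ : ρ 3 = 0 ∧ ρ 4 = 0) :
    deRham ρ ω {0, 1} = ρ 0 (ω {1}) - ρ 1 (ω {0}) - ω {2} := by
  rw [deRham_apply hρ,
    wedge_pos (i := 0) (T := {1}) (by decide),
    wedge_neg (i := 1) (T := {0}) (by decide),
    wedge_zero (i := 2) (by decide),
    wwc_pos (i := 0) (A := {2}) (by decide),
    wwc_zero (i := 0) (j := 2) (by decide),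
    wwc_zero (i := 1) (j := 2) (by decide)]
  abel

theorem deRham_02 (hρ : ρ 3 = 0 ∧ ρ 4 = 0) :
    deRham ρ ω {0, 2} = ρ 0 (ω {2}) - ρ 2 (ω {0}) - ω {3} := by
  rw [deRham_apply hρ,
    wedge_pos (i := 0) (T := {2}) (by decide),
    wedge_zero (i := 1) (by decide),
    wedge_neg (i := 2) (T := {0}) (by decide),
    wwc_zero (i := 0) (j := 1) (by decide),
    wwc_pos (i := 0) (A := {3}) (by decide),
    wwc_zero (i := 1) (j := 2) (by decide)]
  abel

theorem deRham_03 (hρ : ρ 3 = 0 ∧ ρ 4 = 0) :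
    deRham ρ ω {0, 3} = ρ 0 (ω {3}) := by
  rw [deRham_apply hρ,
    wedge_pos (i := 0) (T := {3}) (by decide),
    wedge_zero (i := 1) (by decide),
    wedge_zero (i := 2) (by decide),
    wwc_zero (i := 0) (j := 1) (by decide),
    wwc_zero (i := 0) (j := 2) (by decide),
    wwc_zero (i := 1) (j := 2) (by decide)]
  abel

theorem deRham_04 (hρ : ρ 3 = 0 ∧ ρ 4 = 0) :
    deRham ρ ω {0, 4} = ρ 0 (ω {4}) := by
  rw [deRham_apply hρ,
    wedge_pos (i := 0) (T := {4}) (by decide),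
    wedge_zero (i := 1) (by decide),
    wedge_zero (i := 2) (by decide),
    wwc_zero (i := 0) (j := 1) (by decide),
    wwc_zero (i := 0) (j := 2) (by decide),
    wwc_zero (i := 1) (j := 2) (by decide)]
  abel

theorem deRham_12 (hρ : ρ 3 = 0 ∧ ρ 4 = 0) :
    deRham ρ ω {1, 2} = ρ 1 (ω {2}) - ρ 2 (ω {1}) - ω {4} := by
  rw [deRham_apply hρ,
    wedge_zero (i := 0) (by decide),
    wedge_pos (i := 1) (T := {2}) (by decide),
    wedge_neg (i := 2) (T := {1}) (by decide),
    wwc_zero (i := 0) (j := 1) (by decide),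
    wwc_zero (i := 0) (j := 2) (by decide),
    wwc_pos (i := 1) (A := {4}) (by decide)]
  abel

theorem deRham_13 (hρ : ρ 3 = 0 ∧ ρ 4 = 0) :
    deRham ρ ω {1, 3} = ρ 1 (ω {3}) := by
  rw [deRham_apply hρ,
    wedge_zero (i := 0) (by decide),
    wedge_pos (i := 1) (T := {3}) (by decide),
    wedge_zero (i := 2) (by decide),
    wwc_zero (i := 0) (j := 1) (by decide),
    wwc_zero (i := 0) (j := 2) (by decide),
    wwc_zero (i := 1) (j := 2) (by decide)]
  abel

theorem deRham_14 (hρ : ρ 3 = 0 ∧ ρ 4 = 0) :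
    deRham ρ ω {1, 4} = ρ 1 (ω {4}) := by
  rw [deRham_apply hρ,
    wedge_zero (i := 0) (by decide),
    wedge_pos (i := 1) (T := {4}) (by decide),
    wedge_zero (i := 2) (by decide),
    wwc_zero (i := 0) (j := 1) (by decide),
    wwc_zero (i := 0) (j := 2) (by decide),
    wwc_zero (i := 1) (j := 2) (by decide)]
  abel

theorem deRham_012 (hρ : ρ 3 = 0 ∧ ρ 4 = 0) :
    deRham ρ ω {0, 1, 2} = ρ 0 (ω {1, 2}) - ρ 1 (ω {0, 2}) + ρ 2 (ω {0, 1}) - ω {1, 3} + ω {0, 4} := by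
  rw [deRham_apply hρ,
    wedge_pos (i := 0) (T := {1, 2}) (by decide),
    wedge_neg (i := 1) (T := {0, 2}) (by decide),
    wedge_pos (i := 2) (T := {0, 1}) (by decide),
    wwc_zero (i := 0) (j := 1) (by decide),
    wwc_pos (i := 0) (A := {1, 3}) (by decide),
    wwc_neg (i := 1) (A := {0, 4}) (by decide)]
  abel

theorem deRham_013 (hρ : ρ 3 = 0 ∧ ρ 4 = 0) :
    deRham ρ ω {0, 1, 3} = ρ 0 (ω {1, 3}) - ρ 1 (ω {0, 3}) - ω {2, 3} := by
  rw [deRham_apply hρ,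
    wedge_pos (i := 0) (T := {1, 3}) (by decide),
    wedge_neg (i := 1) (T := {0, 3}) (by decide),
    wedge_zero (i := 2) (by decide),
    wwc_pos (i := 0) (A := {2, 3}) (by decide),
    wwc_zero (i := 0) (j := 2) (by decide),
    wwc_zero (i := 1) (j := 2) (by decide)]
  abel

theorem deRham_014 (hρ : ρ 3 = 0 ∧ ρ 4 = 0) :
    deRham ρ ω {0, 1, 4} = ρ 0 (ω {1, 4}) - ρ 1 (ω {0, 4}) - ω {2, 4} := by
  rw [deRham_apply hρ,
    wedge_pos (i := 0) (T := {1, 4}) (by decide),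
    wedge_neg (i := 1) (T := {0, 4}) (by decide),
    wedge_zero (i := 2) (by decide),
    wwc_pos (i := 0) (A := {2, 4}) (by decide),
    wwc_zero (i := 0) (j := 2) (by decide),
    wwc_zero (i := 1) (j := 2) (by decide)]
  abel

theorem deRham_023 (hρ : ρ 3 = 0 ∧ ρ 4 = 0) :
    deRham ρ ω {0, 2, 3} = ρ 0 (ω {2, 3}) - ρ 2 (ω {0, 3}) := by
  rw [deRham_apply hρ,
    wedge_pos (i := 0) (T := {2, 3}) (by decide),
    wedge_zero (i := 1) (by decide),
    wedge_neg (i := 2) (T := {0, 3}) (by decide),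
    wwc_zero (i := 0) (j := 1) (by decide),
    wwc_zero (i := 0) (j := 2) (by decide),
    wwc_zero (i := 1) (j := 2) (by decide)]
  abel

theorem deRham_024 (hρ : ρ 3 = 0 ∧ ρ 4 = 0) :
    deRham ρ ω {0, 2, 4} = ρ 0 (ω {2, 4}) - ρ 2 (ω {0, 4}) - ω {3, 4} := by
  rw [deRham_apply hρ,
    wedge_pos (i := 0) (T := {2, 4}) (by decide),
    wedge_zero (i := 1) (by decide),
    wedge_neg (i := 2) (T := {0, 4}) (by decide),
    wwc_zero (i := 0) (j := 1) (by decide),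
    wwc_pos (i := 0) (A := {3, 4}) (by decide),
    wwc_zero (i := 1) (j := 2) (by decide)]
  abel

theorem deRham_123 (hρ : ρ 3 = 0 ∧ ρ 4 = 0) :
    deRham ρ ω {1, 2, 3} = ρ 1 (ω {2, 3}) - ρ 2 (ω {1, 3}) + ω {3, 4} := by
  rw [deRham_apply hρ,
    wedge_zero (i := 0) (by decide),
    wedge_pos (i := 1) (T := {2, 3}) (by decide),
    wedge_neg (i := 2) (T := {1, 3}) (by decide),
    wwc_zero (i := 0) (j := 1) (by decide),
    wwc_zero (i := 0) (j := 2) (by decide),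
    wwc_neg (i := 1) (A := {3, 4}) (by decide)]
  abel

theorem deRham_124 (hρ : ρ 3 = 0 ∧ ρ 4 = 0) :
    deRham ρ ω {1, 2, 4} = ρ 1 (ω {2, 4}) - ρ 2 (ω {1, 4}) := by
  rw [deRham_apply hρ,
    wedge_zero (i := 0) (by decide),
    wedge_pos (i := 1) (T := {2, 4}) (by decide),
    wedge_neg (i := 2) (T := {1, 4}) (by decide),
    wwc_zero (i := 0) (j := 1) (by decide),
    wwc_zero (i := 0) (j := 2) (by decide),
    wwc_zero (i := 1) (j := 2) (by decide)]
  abel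

theorem deRham_0123 (hρ : ρ 3 = 0 ∧ ρ 4 = 0) :
    deRham ρ ω {0, 1, 2, 3} = ρ 0 (ω {1, 2, 3}) - ρ 1 (ω {0, 2, 3}) + ρ 2 (ω {0, 1, 3}) - ω {0, 3, 4} := by
  rw [deRham_apply hρ,
    wedge_pos (i := 0) (T := {1, 2, 3}) (by decide),
    wedge_neg (i := 1) (T := {0, 2, 3}) (by decide),
    wedge_pos (i := 2) (T := {0, 1, 3}) (by decide),
    wwc_zero (i := 0) (j := 1) (by decide),
    wwc_zero (i := 0) (j := 2) (by decide),
    wwc_pos (i := 1) (A := {0, 3, 4}) (by decide)]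
  abel

theorem deRham_0124 (hρ : ρ 3 = 0 ∧ ρ 4 = 0) :
    deRham ρ ω {0, 1, 2, 4} = ρ 0 (ω {1, 2, 4}) - ρ 1 (ω {0, 2, 4}) + ρ 2 (ω {0, 1, 4}) - ω {1, 3, 4} := by
  rw [deRham_apply hρ,
    wedge_pos (i := 0) (T := {1, 2, 4}) (by decide),
    wedge_neg (i := 1) (T := {0, 2, 4}) (by decide),
    wedge_pos (i := 2) (T := {0, 1, 4}) (by decide),
    wwc_zero (i := 0) (j := 1) (by decide),
    wwc_pos (i := 0) (A := {1, 3, 4}) (by decide),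
    wwc_zero (i := 1) (j := 2) (by decide)]
  abel

theorem deRham_0134 (hρ : ρ 3 = 0 ∧ ρ 4 = 0) :
    deRham ρ ω {0, 1, 3, 4} = ρ 0 (ω {1, 3, 4}) - ρ 1 (ω {0, 3, 4}) - ω {2, 3, 4} := by
  rw [deRham_apply hρ,
    wedge_pos (i := 0) (T := {1, 3, 4}) (by decide),
    wedge_neg (i := 1) (T := {0, 3, 4}) (by decide),
    wedge_zero (i := 2) (by decide),
    wwc_pos (i := 0) (A := {2, 3, 4}) (by decide),
    wwc_zero (i := 0) (j := 2) (by decide),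
    wwc_zero (i := 1) (j := 2) (by decide)]
  abel

theorem deRham_0234 (hρ : ρ 3 = 0 ∧ ρ 4 = 0) :
    deRham ρ ω {0, 2, 3, 4} = ρ 0 (ω {2, 3, 4}) - ρ 2 (ω {0, 3, 4}) := by
  rw [deRham_apply hρ,
    wedge_pos (i := 0) (T := {2, 3, 4}) (by decide),
    wedge_zero (i := 1) (by decide),
    wedge_neg (i := 2) (T := {0, 3, 4}) (by decide),
    wwc_zero (i := 0) (j := 1) (by decide),
    wwc_zero (i := 0) (j := 2) (by decide),
    wwc_zero (i := 1) (j := 2) (by decide)]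
  abel

theorem deRham_1234 (hρ : ρ 3 = 0 ∧ ρ 4 = 0) :
    deRham ρ ω {1, 2, 3, 4} = ρ 1 (ω {2, 3, 4}) - ρ 2 (ω {1, 3, 4}) := by
  rw [deRham_apply hρ,
    wedge_zero (i := 0) (by decide),
    wedge_pos (i := 1) (T := {2, 3, 4}) (by decide),
    wedge_neg (i := 2) (T := {1, 3, 4}) (by decide),
    wwc_zero (i := 0) (j := 1) (by decide),
    wwc_zero (i := 0) (j := 2) (by decide),
    wwc_zero (i := 1) (j := 2) (by decide)]
  abel

theorem deRham_01234 (hρ : ρ 3 = 0 ∧ ρ 4 = 0) :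
    deRham ρ ω {0, 1, 2, 3, 4} = ρ 0 (ω {1, 2, 3, 4}) - ρ 1 (ω {0, 2, 3, 4}) + ρ 2 (ω {0, 1, 3, 4}) := by
  rw [deRham_apply hρ,
    wedge_pos (i := 0) (T := {1, 2, 3, 4}) (by decide),
    wedge_neg (i := 1) (T := {0, 2, 3, 4}) (by decide),
    wedge_pos (i := 2) (T := {0, 1, 3, 4}) (by decide),
    wwc_zero (i := 0) (j := 1) (by decide),
    wwc_zero (i := 0) (j := 2) (by decide),
    wwc_zero (i := 1) (j := 2) (by decide)]
  abel

end Table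

end

/-! ### Harmonic forms. -/

noncomputable section

open scoped ComplexConjugate
open Lie235

/-- The index sets of the harmonic forms of degree `q`. -/
def harmSet (q : ℕ) : Finset (Finset (Fin 5)) :=
  Finset.univ.filter fun S => S.card = q ∧ formWt S = cohWt q

theorem harmSet_zero : harmSet 0 = {∅} := by decide
theorem harmSet_one : harmSet 1 = {{0}, {1}} := by decide
theorem harmSet_two : harmSet 2 = {{0, 3}, {0, 4}, {1, 3}, {1, 4}} := by decide
theorem harmSet_three : harmSet 3 = {{0, 2, 3}, {0, 2, 4}, {1, 2, 3}, {1, 2, 4}} := by decide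
theorem harmSet_four : harmSet 4 = {{0, 2, 3, 4}, {1, 2, 3, 4}} := by decide
theorem harmSet_five : harmSet 5 = {{0, 1, 2, 3, 4}} := by decide

open IsBlockCogram in
theorem sum_harmSet_two {M : Type*} [AddCommMonoid M] (f : Finset (Fin 5) → M) :
    ∑ S ∈ harmSet 2, f S = ∑ i : Fin 2, ∑ j : Fin 2, f {low i, high j} := by
  rw [harmSet_two, Finset.sum_insert (by decide), Finset.sum_insert (by decide),
    Finset.sum_insert (by decide), Finset.sum_singleton]
  simp [Fin.sum_univ_two, low, high, add_assoc]

open IsBlockCogram in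
theorem sum_harmSet_three {M : Type*} [AddCommMonoid M] (f : Finset (Fin 5) → M) :
    ∑ S ∈ harmSet 3, f S = ∑ i : Fin 2, ∑ j : Fin 2, f {low i, 2, high j} := by
  rw [harmSet_three, Finset.sum_insert (by decide), Finset.sum_insert (by decide),
    Finset.sum_insert (by decide), Finset.sum_singleton]
  simp [Fin.sum_univ_two, low, high, add_assoc]

/-- A set of index sets that is a union of classes of equal degree and weight. -/
def IsSaturated (A : Finset (Finset (Fin 5))) : Prop :=
  ∀ S T, S ∉ A → T ∈ A → ¬ (S.card = T.card ∧ formWt S = formWt T)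

instance (A : Finset (Finset (Fin 5))) : Decidable (IsSaturated A) := by
  unfold IsSaturated
  infer_instance

theorem isSaturated_harmSet (q : ℕ) : IsSaturated (harmSet q) := by
  intro S T hS hT h
  simp only [harmSet, Finset.mem_filter, Finset.mem_univ, true_and] at hS hT
  exact hS ⟨h.1.trans hT.1, h.2.trans hT.2⟩

section Harmonic

variable {V : Type*} [AddCommGroup V] [Module ℂ V] {g : LinearMap.BilinForm ℝ Lie235}
  {p r s k m : ℝ}

namespace IsBlockCogram

/-- The Gram matrix is block diagonal with respect to degree and weight, so a union of such classes
decouples from the rest. -/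
theorem sum_sum_eq {M : Type*} [AddCommMonoid M] (h : IsBlockCogram g p r s k m)
    {A : Finset (Finset (Fin 5))} (hA : IsSaturated A) (f : Finset (Fin 5) → Finset (Fin 5) → M)
    (h0 : ∀ S T, lambdaGram g S T = 0 → f S T = 0)
    (hf : ∀ S T, S ∉ A → T ∉ A → f S T = 0) :
    ∑ S, ∑ T, f S T = ∑ S ∈ A, ∑ T ∈ A, f S T := by
  refine (Finset.sum_subset (Finset.subset_univ A) fun S _ hS => ?_).symm.trans
    (Finset.sum_congr rfl fun S hS => ?_)
  · refine Finset.sum_eq_zero fun T _ => ?_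
    by_cases hT : T ∈ A
    · exact h0 _ _ (h.lambdaGram_eq_zero (hA S T hS hT))
    · exact hf S T hS hT
  · refine (Finset.sum_subset (Finset.subset_univ A) fun T _ hT => ?_).symm
    exact h0 _ _ (h.lambdaGram_eq_zero fun e => hA T S hT hS ⟨e.1.symm, e.2.symm⟩)

/-- Orthogonality is tested on the exact form ∂χ^B; the set A has to contain all index sets with its
degree and weight. -/
theorem harm_orthogonal (h : IsBlockCogram g p r s k m) {q : ℕ} {ω : Form V}
    (hω : ω ∈ Harm V g q) (B : Finset (Fin 5)) {A : Finset (Finset (Fin 5))}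
    (hA : IsSaturated A) (hB : ∀ S, S ∉ A → S.card ≠ B.card + 1 ∨ formWt S ≠ formWt B) :
    ∑ S ∈ A, ∑ T ∈ A, ((lambdaGram g S T : ℂ) * conj (ceDiff ℂ (Pi.single B 1) S)) • ω T = 0 := by
  rw [← h.sum_sum_eq hA _ (fun S T hST => by rw [hST]; simp)]
  · exact hω.2.2 _
  · intro S T hS _
    have hz : ceDiff ℂ (Pi.single B 1) S = 0 := by
      have hs : ∀ T, T ≠ B → (Pi.single B 1 : Form ℂ) T = 0 := fun T hT =>
        Pi.single_eq_of_ne hT _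
      rcases hB S hS with h1 | h1
      · exact ceDiff_eq_zero_of_card (q := B.card) (fun T hT => hs T (by rintro rfl; exact hT rfl))
          h1
      · exact ceDiff_eq_zero_of_formWt (w := formWt B)
          (fun T hT => hs T (by rintro rfl; exact hT rfl)) h1
    rw [hz]
    simp

theorem eq_zero_of_pair (h : IsBlockCogram g p r s k m) {u v : V}
    (h1 : (p : ℂ) • u + (r : ℂ) • v = 0) (h2 : (r : ℂ) • u + (s : ℂ) • v = 0) :
    u = 0 ∧ v = 0 := by
  have hd : ((p * s - r ^ 2 : ℝ) : ℂ) ≠ 0 := Complex.ofReal_ne_zero.2 h.det_pos.ne'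
  constructor
  · refine (smul_eq_zero_iff_right hd).1 ?_
    have : ((p * s - r ^ 2 : ℝ) : ℂ) • u =
        (s : ℂ) • ((p : ℂ) • u + (r : ℂ) • v) - (r : ℂ) • ((r : ℂ) • u + (s : ℂ) • v) := by
      push_cast
      module
    rw [this, h1, h2, smul_zero, smul_zero, sub_zero]
  · refine (smul_eq_zero_iff_right hd).1 ?_
    have : ((p * s - r ^ 2 : ℝ) : ℂ) • v =
        (p : ℂ) • ((r : ℂ) • u + (s : ℂ) • v) - (r : ℂ) • ((p : ℂ) • u + (r : ℂ) • v) := by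
      push_cast
      module
    rw [this, h1, h2, smul_zero, smul_zero, sub_zero]

/-- For a form concentrated in weight N_q, both conditions defining harmonicity need checking in
that weight only. -/
theorem mem_harm_of_support (h : IsBlockCogram g p r s k m) {q : ℕ} {ω : Form V}
    (hω : ∀ S, S ∉ harmSet q → ω S = 0)
    (hc : ∀ S : Finset (Fin 5), S.card = q + 1 → formWt S = cohWt q → ceDiff V ω S = 0)
    (ho : ∀ β : Form ℂ, ∑ S ∈ harmSet q, ∑ T ∈ harmSet q,
      ((lambdaGram g S T : ℂ) * conj (ceDiff ℂ β S)) • ω T = 0) : ω ∈ Harm V g q := by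
  have h1 : ∀ S, S.card ≠ q → ω S = 0 := fun S hS => hω S (by simp [harmSet, hS])
  refine ⟨h1, ?_, fun β => ?_⟩
  · funext S
    by_cases hS : S.card = q + 1
    · by_cases hw : formWt S = cohWt q
      · exact hc S hS hw
      · exact ceDiff_eq_zero_of_formWt (fun T hT => hω T (by simp [harmSet, hT])) hw
    · exact ceDiff_eq_zero_of_card h1 hS
  · rw [h.sum_sum_eq (isSaturated_harmSet q) _ (fun S T hST => by rw [hST]; simp)]
    · exact ho β
    · intro S T _ hT
      rw [hω T hT, smul_zero]

theorem mem_harm_zero (h : IsBlockCogram g p r s k m) {ω : Form V} :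
    ω ∈ Harm V g 0 ↔ ∀ S, S ∉ harmSet 0 → ω S = 0 := by
  refine ⟨fun hω S hS => hω.1 S ?_, fun hω => h.mem_harm_of_support hω
    (fun S h1 h2 => absurd h2 (by revert S; decide)) fun β => ?_⟩
  · revert S; decide
  · refine Finset.sum_eq_zero fun S hS => Finset.sum_eq_zero fun T _ => ?_
    rw [harmSet_zero, Finset.mem_singleton] at hS
    rw [hS, ceDiff_eq_deRham, deRham_apply ⟨rfl, rfl⟩, wedge_zero (by decide),
      wedge_zero (by decide), wedge_zero (by decide), wwc_zero (by decide), wwc_zero (by decide),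
      wwc_zero (by decide)]
    simp

theorem mem_harm_one (h : IsBlockCogram g p r s k m) {ω : Form V} :
    ω ∈ Harm V g 1 ↔ ∀ S, S ∉ harmSet 1 → ω S = 0 := by
  refine ⟨fun hω S hS => ?_, fun hω => h.mem_harm_of_support hω
    (fun S h1 h2 => absurd h2 (by revert S; decide)) fun β => ?_⟩
  · by_cases hc : S.card = 1
    · have hl : S = {2} ∨ S = {3} ∨ S = {4} := by revert S; decide
      have hcl := fun T => congrFun hω.2.1 T
      simp only [ceDiff_eq_deRham] at hcl
      have h1 := hcl {0, 1}
      have h2 := hcl {0, 2}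
      have h3 := hcl {1, 2}
      simp [deRham_01, deRham_02, deRham_12] at h1 h2 h3
      rcases hl with rfl | rfl | rfl <;> assumption
    · exact hω.1 S hc
  · refine Finset.sum_eq_zero fun S hS => Finset.sum_eq_zero fun T _ => ?_
    have hl : S = {0} ∨ S = {1} := by revert S; decide
    rw [ceDiff_eq_deRham]
    rcases hl with rfl | rfl <;> simp [deRham_0, deRham_1]

/-- Closedness removes the components of weight above 4 and, at {0, 1, 2}, forces the symmetry.
Orthogonality to ∂χ³, ∂χ⁴, ∂χ⁵ removes those of weight below 4. -/
theorem mem_harm_two (h : IsBlockCogram g p r s k m) {ω : Form V} :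
    ω ∈ Harm V g 2 ↔ (∀ S, S ∉ harmSet 2 → ω S = 0) ∧ ω {1, 3} = ω {0, 4} := by
  refine ⟨fun hω => ?_, fun ⟨hω, he⟩ => h.mem_harm_of_support hω ?_ fun β => ?_⟩
  · have hcl := fun T => congrFun hω.2.1 T
    simp only [ceDiff_eq_deRham] at hcl
    have h1 := hcl {0, 1, 2}
    have h2 := hcl {0, 1, 3}
    have h3 := hcl {0, 1, 4}
    have h4 := hcl {0, 2, 4}
    simp [deRham_012, deRham_013, deRham_014, deRham_024] at h1 h2 h3 h4
    refine ⟨fun S hS => ?_, (neg_add_eq_zero.1 h1)⟩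
    by_cases hc : S.card = 2
    · have hl : S = {0, 1} ∨ S = {0, 2} ∨ S = {1, 2} ∨ S = {2, 3} ∨ S = {2, 4} ∨ S = {3, 4} := by
        revert S; decide
      have hk : (k : ℂ) ≠ 0 := Complex.ofReal_ne_zero.2 h.k_pos.ne'
      have o1 := h.harm_orthogonal hω {2} (A := {{0, 1}}) (by decide) (by decide)
      have o2 := h.harm_orthogonal hω {3} (A := {{0, 2}, {1, 2}}) (by decide) (by decide)
      have o3 := h.harm_orthogonal hω {4} (A := {{0, 2}, {1, 2}}) (by decide) (by decide)
      have g00 : lambdaGram g {0, 2} {0, 2} = k * p := h.lambdaGram_low_two 0 0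
      have g01 : lambdaGram g {0, 2} {1, 2} = k * r := h.lambdaGram_low_two 0 1
      have g10 : lambdaGram g {1, 2} {0, 2} = k * r := h.lambdaGram_low_two 1 0
      have g11 : lambdaGram g {1, 2} {1, 2} = k * s := h.lambdaGram_low_two 1 1
      have hd : (p * s - r ^ 2 : ℂ) ≠ 0 := by exact_mod_cast h.det_pos.ne'
      have hne : ({0, 2} : Finset (Fin 5)) ≠ {1, 2} := by decide
      simp +decide [ceDiff_eq_deRham, deRham_01, deRham_02, deRham_12, h.lambdaGram_zero_one,
        g00, g01, g10, g11, Finset.sum_pair hne, mul_smul, hd, ← smul_add, ← neg_add, hk,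
        -Complex.coe_smul, -neg_add_rev] at o1 o2 o3
      obtain ⟨e1, e2⟩ := h.eq_zero_of_pair o2 o3
      rcases hl with rfl | rfl | rfl | rfl | rfl | rfl <;> assumption
    · exact hω.1 S hc
  · intro S h1 h2
    have hl : S = {0, 1, 2} := by revert S; decide
    subst hl
    simp [ceDiff_eq_deRham, deRham_012, he]
  · refine Finset.sum_eq_zero fun S hS => Finset.sum_eq_zero fun T _ => ?_
    have hl : S = {0, 3} ∨ S = {0, 4} ∨ S = {1, 3} ∨ S = {1, 4} := by revert S; decide
    rw [ceDiff_eq_deRham]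
    rcases hl with rfl | rfl | rfl | rfl <;> simp [deRham_03, deRham_04, deRham_13, deRham_14]

/-- Dually to degree 2, the symmetry now expresses orthogonality to ∂(χ⁴ ∧ χ⁵). The Gram
coefficients in that relation collapse to the determinant of the block, which is nonzero. -/
theorem mem_harm_three (h : IsBlockCogram g p r s k m) {ω : Form V} :
    ω ∈ Harm V g 3 ↔ (∀ S, S ∉ harmSet 3 → ω S = 0) ∧ ω {1, 2, 3} = ω {0, 2, 4} := by
  have hk : (k : ℂ) ≠ 0 := Complex.ofReal_ne_zero.2 h.k_pos.ne'
  have hm : (m : ℂ) ≠ 0 := Complex.ofReal_ne_zero.2 h.m_pos.ne'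
  have hd : ((p * s - r ^ 2 : ℝ) : ℂ) ≠ 0 := Complex.ofReal_ne_zero.2 h.det_pos.ne'
  refine ⟨fun hω => ?_, fun ⟨hω, he⟩ => h.mem_harm_of_support hω
    (fun S h1 h2 => absurd h2 (by revert S; decide)) fun β => ?_⟩
  · have hcl := fun T => congrFun hω.2.1 T
    simp only [ceDiff_eq_deRham] at hcl
    have h1 := hcl {0, 1, 2, 3}
    have h2 := hcl {0, 1, 2, 4}
    have h3 := hcl {0, 1, 3, 4}
    simp [deRham_0123, deRham_0124, deRham_0134] at h1 h2 h3
    constructor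
    · intro S hS
      by_cases hc : S.card = 3
      · have hl : S = {0, 1, 2} ∨ S = {0, 1, 3} ∨ S = {0, 1, 4} ∨ S = {0, 3, 4} ∨ S = {1, 3, 4} ∨
            S = {2, 3, 4} := by
          revert S; decide
        have o1 := h.harm_orthogonal hω {0, 4} (A := {{0, 1, 2}}) (by decide) (by decide)
        have o2 := h.harm_orthogonal hω {2, 3} (A := {{0, 1, 3}, {0, 1, 4}}) (by decide)
          (by decide)
        have o3 := h.harm_orthogonal hω {2, 4} (A := {{0, 1, 3}, {0, 1, 4}}) (by decide)
          (by decide)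
        have g00 : lambdaGram g {0, 1, 3} {0, 1, 3} = m * (p * s - r ^ 2) * p :=
          h.lambdaGram_zero_one_high 0 0
        have g01 : lambdaGram g {0, 1, 3} {0, 1, 4} = m * (p * s - r ^ 2) * r :=
          h.lambdaGram_zero_one_high 0 1
        have g10 : lambdaGram g {0, 1, 4} {0, 1, 3} = m * (p * s - r ^ 2) * r :=
          h.lambdaGram_zero_one_high 1 0
        have g11 : lambdaGram g {0, 1, 4} {0, 1, 4} = m * (p * s - r ^ 2) * s :=
          h.lambdaGram_zero_one_high 1 1
        have hne : ({0, 1, 3} : Finset (Fin 5)) ≠ {0, 1, 4} := by decide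
        push_cast at hd
        simp +decide [ceDiff_eq_deRham, deRham_012, deRham_013, deRham_014,
          h.lambdaGram_zero_one_two, g00, g01, g10, g11, Finset.sum_pair hne, mul_smul,
          ← smul_add, ← neg_add, hk, hm, hd, -Complex.coe_smul,
          -neg_add_rev] at o1 o2 o3
        obtain ⟨e1, e2⟩ := h.eq_zero_of_pair o2 o3
        rcases hl with rfl | rfl | rfl | rfl | rfl | rfl <;> assumption
      · exact hω.1 S hc
    · have o := h.harm_orthogonal hω {3, 4} (isSaturated_harmSet 3) (by decide)
      simp only [sum_harmSet_three, h.lambdaGram_low_two_high] at o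
      simp +decide [ceDiff_eq_deRham, Fin.sum_univ_two, low, high, block, deRham_023, deRham_024,
        deRham_123, deRham_124, -Complex.coe_smul] at o
      have e : ((k : ℂ) * m * ((p * s - r ^ 2 : ℝ) : ℂ)) • (ω {1, 2, 3} - ω {0, 2, 4}) = 0 := by
        rw [← o]
        push_cast
        module
      exact sub_eq_zero.1 ((smul_eq_zero_iff_right (mul_ne_zero (mul_ne_zero hk hm) hd)).1 e)
  · simp only [sum_harmSet_three, h.lambdaGram_low_two_high]
    simp [ceDiff_eq_deRham, Fin.sum_univ_two, low, high, block, deRham_023, deRham_024,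
      deRham_123, deRham_124, he, -Complex.coe_smul]
    module

theorem mem_harm_four (h : IsBlockCogram g p r s k m) {ω : Form V} :
    ω ∈ Harm V g 4 ↔ ∀ S, S ∉ harmSet 4 → ω S = 0 := by
  have hk : (k : ℂ) ≠ 0 := Complex.ofReal_ne_zero.2 h.k_pos.ne'
  have hm : (m : ℂ) ≠ 0 := Complex.ofReal_ne_zero.2 h.m_pos.ne'
  have hd : (p * s - r ^ 2 : ℂ) ≠ 0 := by exact_mod_cast h.det_pos.ne'
  refine ⟨fun hω S hS => ?_, fun hω => h.mem_harm_of_support hω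
    (fun S h1 h2 => absurd h2 (by revert S; decide)) fun β => ?_⟩
  · by_cases hc : S.card = 4
    · have hl : S = {0, 1, 2, 3} ∨ S = {0, 1, 2, 4} ∨ S = {0, 1, 3, 4} := by revert S; decide
      have o1 := h.harm_orthogonal hω {2, 3, 4} (A := {{0, 1, 3, 4}}) (by decide) (by decide)
      have o2 := h.harm_orthogonal hω {0, 3, 4} (A := {{0, 1, 2, 3}, {0, 1, 2, 4}}) (by decide)
        (by decide)
      have o3 := h.harm_orthogonal hω {1, 3, 4} (A := {{0, 1, 2, 3}, {0, 1, 2, 4}}) (by decide)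
        (by decide)
      have g00 : lambdaGram g {0, 1, 2, 3} {0, 1, 2, 3} = k * m * (p * s - r ^ 2) * p :=
        h.lambdaGram_zero_one_two_high 0 0
      have g01 : lambdaGram g {0, 1, 2, 3} {0, 1, 2, 4} = k * m * (p * s - r ^ 2) * r :=
        h.lambdaGram_zero_one_two_high 0 1
      have g10 : lambdaGram g {0, 1, 2, 4} {0, 1, 2, 3} = k * m * (p * s - r ^ 2) * r :=
        h.lambdaGram_zero_one_two_high 1 0
      have g11 : lambdaGram g {0, 1, 2, 4} {0, 1, 2, 4} = k * m * (p * s - r ^ 2) * s :=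
        h.lambdaGram_zero_one_two_high 1 1
      have hne : ({0, 1, 2, 3} : Finset (Fin 5)) ≠ {0, 1, 2, 4} := by decide
      simp +decide [ceDiff_eq_deRham, deRham_0123, deRham_0124, deRham_0134,
        h.lambdaGram_zero_one_three_four, g00, g01, g10, g11, Finset.sum_pair hne, mul_smul,
        ← smul_add, ← neg_add, hk, hm, hd, -Complex.coe_smul,
        -neg_add_rev] at o1 o2 o3
      obtain ⟨e1, e2⟩ := h.eq_zero_of_pair o2 o3
      rcases hl with rfl | rfl | rfl <;> assumption
    · exact hω.1 S hc
  · refine Finset.sum_eq_zero fun S hS => Finset.sum_eq_zero fun T _ => ?_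
    have hl : S = {0, 2, 3, 4} ∨ S = {1, 2, 3, 4} := by revert S; decide
    rw [ceDiff_eq_deRham]
    rcases hl with rfl | rfl <;> simp [deRham_0234, deRham_1234]

theorem mem_harm_five (h : IsBlockCogram g p r s k m) {ω : Form V} :
    ω ∈ Harm V g 5 ↔ ∀ S, S ∉ harmSet 5 → ω S = 0 := by
  refine ⟨fun hω S hS => hω.1 S ?_, fun hω => h.mem_harm_of_support hω
    (fun S h1 h2 => absurd h2 (by revert S; decide)) fun β => ?_⟩
  · revert S; decide
  · refine Finset.sum_eq_zero fun S hS => Finset.sum_eq_zero fun T _ => ?_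
    rw [harmSet_five, Finset.mem_singleton] at hS
    simp [hS, ceDiff_eq_deRham, deRham_01234]

end IsBlockCogram

end Harmonic

end

/-! ### Coordinates on harmonic forms. -/

noncomputable section

open scoped ComplexConjugate SchwartzMap InnerProductSpace
open Lie235 IsBlockCogram MeasureTheory

namespace IsBlockCogram

variable {V : Type*} [AddCommGroup V] [Module ℂ V] {g : LinearMap.BilinForm ℝ Lie235}
  {p r s k m : ℝ}

/-- `V ⊗ H⁰(𝔤) = V`. -/
def harmZero (h : IsBlockCogram g p r s k m) : Harm V g 0 ≃ₗ[ℂ] V where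
  toFun ω := ω.1 ∅
  map_add' _ _ := rfl
  map_smul' _ _ := rfl
  invFun f := ⟨fun S => if S = ∅ then f else 0, h.mem_harm_zero.2 fun S hS => by
    rw [harmSet_zero, Finset.mem_singleton] at hS
    rw [if_neg hS]⟩
  left_inv ω := by
    ext S
    by_cases hS : S ∈ harmSet 0
    · rw [harmSet_zero, Finset.mem_singleton] at hS
      simp [hS]
    · rw [h.mem_harm_zero.1 ω.2 S hS]
      rw [harmSet_zero, Finset.mem_singleton] at hS
      simp [hS]
  right_inv f := by simp

/-- `V ⊗ H¹(𝔤) = V χ¹ ⊕ V χ²`. -/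
def harmOne (h : IsBlockCogram g p r s k m) : Harm V g 1 ≃ₗ[ℂ] V × V where
  toFun ω := (ω.1 {0}, ω.1 {1})
  map_add' _ _ := rfl
  map_smul' _ _ := rfl
  invFun x := ⟨fun S => if S = {0} then x.1 else if S = {1} then x.2 else 0,
    h.mem_harm_one.2 fun S hS => by
      simp only [harmSet_one, Finset.mem_insert, Finset.mem_singleton, not_or] at hS
      rw [if_neg hS.1, if_neg hS.2]⟩
  left_inv ω := by
    ext S
    by_cases hS : S ∈ harmSet 1
    · simp only [harmSet_one, Finset.mem_insert, Finset.mem_singleton] at hS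
      rcases hS with rfl | rfl <;> simp +decide
    · rw [h.mem_harm_one.1 ω.2 S hS]
      simp only [harmSet_one, Finset.mem_insert, Finset.mem_singleton, not_or] at hS
      simp [hS]
  right_inv x := by simp +decide

/-- `V ⊗ H²(𝔤)` is the space of forms
`A χ¹ ∧ χ⁴ + B (χ¹ ∧ χ⁵ + χ² ∧ χ⁴) + C χ² ∧ χ⁵`. -/
def harmTwo (h : IsBlockCogram g p r s k m) : Harm V g 2 ≃ₗ[ℂ] V × V × V where
  toFun ω := (ω.1 {0, 3}, ω.1 {0, 4}, ω.1 {1, 4})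
  map_add' _ _ := rfl
  map_smul' _ _ := rfl
  invFun x := ⟨fun S => if S = {0, 3} then x.1 else if S = {0, 4} then x.2.1 else
      if S = {1, 3} then x.2.1 else if S = {1, 4} then x.2.2 else 0,
    h.mem_harm_two.2 ⟨fun S hS => by
      simp only [harmSet_two, Finset.mem_insert, Finset.mem_singleton, not_or] at hS
      rw [if_neg hS.1, if_neg hS.2.1, if_neg hS.2.2.1, if_neg hS.2.2.2], by simp +decide⟩⟩
  left_inv ω := by
    ext S
    by_cases hS : S ∈ harmSet 2
    · simp only [harmSet_two, Finset.mem_insert, Finset.mem_singleton] at hS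
      rcases hS with rfl | rfl | rfl | rfl <;> simp +decide
      exact (h.mem_harm_two.1 ω.2).2.symm
    · rw [(h.mem_harm_two.1 ω.2).1 S hS]
      simp only [harmSet_two, Finset.mem_insert, Finset.mem_singleton, not_or] at hS
      simp [hS]
  right_inv x := by simp +decide

/-- `V ⊗ H³(𝔤)` is the space of forms
`A χ¹ ∧ χ³ ∧ χ⁴ + B (χ¹ ∧ χ³ ∧ χ⁵ + χ² ∧ χ³ ∧ χ⁴) + C χ² ∧ χ³ ∧ χ⁵`. -/
def harmThree (h : IsBlockCogram g p r s k m) : Harm V g 3 ≃ₗ[ℂ] V × V × V where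
  toFun ω := (ω.1 {0, 2, 3}, ω.1 {0, 2, 4}, ω.1 {1, 2, 4})
  map_add' _ _ := rfl
  map_smul' _ _ := rfl
  invFun x := ⟨fun S => if S = {0, 2, 3} then x.1 else if S = {0, 2, 4} then x.2.1 else
      if S = {1, 2, 3} then x.2.1 else if S = {1, 2, 4} then x.2.2 else 0,
    h.mem_harm_three.2 ⟨fun S hS => by
      simp only [harmSet_three, Finset.mem_insert, Finset.mem_singleton, not_or] at hS
      rw [if_neg hS.1, if_neg hS.2.1, if_neg hS.2.2.1, if_neg hS.2.2.2], by simp +decide⟩⟩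
  left_inv ω := by
    ext S
    by_cases hS : S ∈ harmSet 3
    · simp only [harmSet_three, Finset.mem_insert, Finset.mem_singleton] at hS
      rcases hS with rfl | rfl | rfl | rfl <;> simp +decide
      exact (h.mem_harm_three.1 ω.2).2.symm
    · rw [(h.mem_harm_three.1 ω.2).1 S hS]
      simp only [harmSet_three, Finset.mem_insert, Finset.mem_singleton, not_or] at hS
      simp [hS]
  right_inv x := by simp +decide

/-- `V ⊗ H⁴(𝔤) = V χ¹ ∧ χ³ ∧ χ⁴ ∧ χ⁵ ⊕ V χ² ∧ χ³ ∧ χ⁴ ∧ χ⁵`. -/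
def harmFour (h : IsBlockCogram g p r s k m) : Harm V g 4 ≃ₗ[ℂ] V × V where
  toFun ω := (ω.1 {0, 2, 3, 4}, ω.1 {1, 2, 3, 4})
  map_add' _ _ := rfl
  map_smul' _ _ := rfl
  invFun x := ⟨fun S => if S = {0, 2, 3, 4} then x.1 else if S = {1, 2, 3, 4} then x.2 else 0,
    h.mem_harm_four.2 fun S hS => by
      simp only [harmSet_four, Finset.mem_insert, Finset.mem_singleton, not_or] at hS
      rw [if_neg hS.1, if_neg hS.2]⟩
  left_inv ω := by
    ext S
    by_cases hS : S ∈ harmSet 4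
    · simp only [harmSet_four, Finset.mem_insert, Finset.mem_singleton] at hS
      rcases hS with rfl | rfl <;> simp +decide
    · rw [h.mem_harm_four.1 ω.2 S hS]
      simp only [harmSet_four, Finset.mem_insert, Finset.mem_singleton, not_or] at hS
      simp [hS]
  right_inv x := by simp +decide

/-- `V ⊗ H⁵(𝔤) = V`. -/
def harmFive (h : IsBlockCogram g p r s k m) : Harm V g 5 ≃ₗ[ℂ] V where
  toFun ω := ω.1 {0, 1, 2, 3, 4}
  map_add' _ _ := rfl
  map_smul' _ _ := rfl
  invFun f := ⟨fun S => if S = {0, 1, 2, 3, 4} then f else 0, h.mem_harm_five.2 fun S hS => by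
    rw [harmSet_five, Finset.mem_singleton] at hS
    rw [if_neg hS]⟩
  left_inv ω := by
    ext S
    by_cases hS : S ∈ harmSet 5
    · rw [harmSet_five, Finset.mem_singleton] at hS
      simp [hS]
    · rw [h.mem_harm_five.1 ω.2 S hS]
      rw [harmSet_five, Finset.mem_singleton] at hS
      simp [hS]
  right_inv f := by simp

theorem apply_eq_zero (h : IsBlockCogram g p r s k m) {q : ℕ} (hq : q ≤ 5) (ω : Harm V g q)
    {S : Finset (Fin 5)} (hS : S ∉ harmSet q) : ω.1 S = 0 := by
  interval_cases q
  · exact h.mem_harm_zero.1 ω.2 S hS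
  · exact h.mem_harm_one.1 ω.2 S hS
  · exact (h.mem_harm_two.1 ω.2).1 S hS
  · exact (h.mem_harm_three.1 ω.2).1 S hS
  · exact h.mem_harm_four.1 ω.2 S hS
  · exact h.mem_harm_five.1 ω.2 S hS

theorem formInner_eq (h : IsBlockCogram g p r s k m) {q : ℕ} (hq : q ≤ 5)
    (α β : Harm 𝓢(ℝ, ℂ) g q) :
    formInner g α.1 β.1 = ∑ S ∈ harmSet q, ∑ T ∈ harmSet q,
      (lambdaGram g S T : ℂ) * ⟪schwartzToL2 (α.1 S), schwartzToL2 (β.1 T)⟫_ℂ := by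
  rw [← h.sum_sum_eq (isSaturated_harmSet q) _ (fun S T hST => by rw [hST]; simp)]
  · simp only [inner_schwartzToL2]
    rfl
  · intro S T _ hT
    rw [h.apply_eq_zero hq β hT, map_zero, inner_zero_right, mul_zero]

theorem formInner_zero (h : IsBlockCogram g p r s k m) (α β : Harm 𝓢(ℝ, ℂ) g 0) :
    formInner g α.1 β.1 = ⟪schwartzToL2 (h.harmZero α), schwartzToL2 (h.harmZero β)⟫_ℂ := by
  rw [h.formInner_eq (by norm_num), harmSet_zero, Finset.sum_singleton, Finset.sum_singleton,
    h.lambdaGram_empty, Complex.ofReal_one, one_mul]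
  rfl

/-- The Hermitian form on pairs given by the block of the metric. -/
def blockInner (p r s : ℝ) (x y : 𝓢(ℝ, ℂ) × 𝓢(ℝ, ℂ)) : ℂ :=
  p * ⟪schwartzToL2 x.1, schwartzToL2 y.1⟫_ℂ + r * ⟪schwartzToL2 x.1, schwartzToL2 y.2⟫_ℂ +
    r * ⟪schwartzToL2 x.2, schwartzToL2 y.1⟫_ℂ + s * ⟪schwartzToL2 x.2, schwartzToL2 y.2⟫_ℂ

/-- The Hermitian form on symmetric `2`-tensors given by the block of the metric. -/
def blockInnerSym (p r s : ℝ) (x y : 𝓢(ℝ, ℂ) × 𝓢(ℝ, ℂ) × 𝓢(ℝ, ℂ)) : ℂ :=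
  p * blockInner p r s (x.1, x.2.1) (y.1, y.2.1) + r * blockInner p r s (x.1, x.2.1) y.2 +
    r * blockInner p r s x.2 (y.1, y.2.1) + s * blockInner p r s x.2 y.2

theorem formInner_one (h : IsBlockCogram g p r s k m) (α β : Harm 𝓢(ℝ, ℂ) g 1) :
    formInner g α.1 β.1 = blockInner p r s (h.harmOne α) (h.harmOne β) := by
  have hne : ({0} : Finset (Fin 5)) ≠ {1} := by decide
  have g00 : lambdaGram g {0} {0} = p := h.lambdaGram_low 0 0
  have g01 : lambdaGram g {0} {1} = r := h.lambdaGram_low 0 1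
  have g10 : lambdaGram g {1} {0} = r := h.lambdaGram_low 1 0
  have g11 : lambdaGram g {1} {1} = s := h.lambdaGram_low 1 1
  rw [h.formInner_eq (by norm_num), harmSet_one, Finset.sum_pair hne, Finset.sum_pair hne,
    Finset.sum_pair hne, g00, g01, g10, g11]
  simp only [blockInner, harmOne, LinearEquiv.coe_mk, LinearMap.coe_mk, AddHom.coe_mk]
  ring

theorem formInner_two (h : IsBlockCogram g p r s k m) (α β : Harm 𝓢(ℝ, ℂ) g 2) :
    formInner g α.1 β.1 = m * blockInnerSym p r s (h.harmTwo α) (h.harmTwo β) := by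
  rw [h.formInner_eq (by norm_num)]
  simp only [sum_harmSet_two, h.lambdaGram_low_high]
  simp only [Fin.sum_univ_two, low, high, block, Matrix.cons_val_zero, Matrix.cons_val_one,
    (h.mem_harm_two.1 α.2).2, (h.mem_harm_two.1 β.2).2, blockInnerSym, blockInner, harmTwo,
    LinearEquiv.coe_mk, LinearMap.coe_mk, AddHom.coe_mk]
  push_cast
  ring

theorem formInner_three (h : IsBlockCogram g p r s k m) (α β : Harm 𝓢(ℝ, ℂ) g 3) :
    formInner g α.1 β.1 = k * m * blockInnerSym p r s (h.harmThree α) (h.harmThree β) := by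
  rw [h.formInner_eq (by norm_num)]
  simp only [sum_harmSet_three, h.lambdaGram_low_two_high]
  simp only [Fin.sum_univ_two, low, high, block, Matrix.cons_val_zero, Matrix.cons_val_one,
    (h.mem_harm_three.1 α.2).2, (h.mem_harm_three.1 β.2).2, blockInnerSym, blockInner, harmThree,
    LinearEquiv.coe_mk, LinearMap.coe_mk, AddHom.coe_mk]
  push_cast
  ring

theorem formInner_four (h : IsBlockCogram g p r s k m) (α β : Harm 𝓢(ℝ, ℂ) g 4) :
    formInner g α.1 β.1 = k * m ^ 2 * ((p * s - r ^ 2 : ℝ) : ℂ) *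
      blockInner p r s (h.harmFour α) (h.harmFour β) := by
  have hne : ({0, 2, 3, 4} : Finset (Fin 5)) ≠ {1, 2, 3, 4} := by decide
  have g00 : lambdaGram g {0, 2, 3, 4} {0, 2, 3, 4} = _ := h.lambdaGram_low_rest 0 0
  have g01 : lambdaGram g {0, 2, 3, 4} {1, 2, 3, 4} = _ := h.lambdaGram_low_rest 0 1
  have g10 : lambdaGram g {1, 2, 3, 4} {0, 2, 3, 4} = _ := h.lambdaGram_low_rest 1 0
  have g11 : lambdaGram g {1, 2, 3, 4} {1, 2, 3, 4} = _ := h.lambdaGram_low_rest 1 1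
  rw [h.formInner_eq (by norm_num), harmSet_four, Finset.sum_pair hne, Finset.sum_pair hne,
    Finset.sum_pair hne, g00, g01, g10, g11]
  simp only [blockInner, harmFour, LinearEquiv.coe_mk, LinearMap.coe_mk, AddHom.coe_mk, block,
    Matrix.cons_val_zero, Matrix.cons_val_one]
  push_cast
  ring

theorem formInner_five (h : IsBlockCogram g p r s k m) (α β : Harm 𝓢(ℝ, ℂ) g 5) :
    formInner g α.1 β.1 = k * m ^ 2 * ((p * s - r ^ 2 : ℝ) : ℂ) ^ 2 *
      ⟪schwartzToL2 (h.harmFive α), schwartzToL2 (h.harmFive β)⟫_ℂ := by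
  rw [h.formInner_eq (by norm_num), harmSet_five, Finset.sum_singleton, Finset.sum_singleton,
    h.lambdaGram_univ]
  simp only [harmFive, LinearEquiv.coe_mk, LinearMap.coe_mk, AddHom.coe_mk]
  push_cast
  ring

end IsBlockCogram

end

/-! ### Explicit Rumin differentials. -/

noncomputable section

open Lie235 IsBlockCogram

/-- The operators `ρ(X₁), …, ρ(X₅)` form a representation of `𝔤` that factors through the quotient
by the center. -/
structure IsHeisenbergRep {V : Type*} [AddCommGroup V] [Module ℂ V]
    (ρ : Fin 5 → V →ₗ[ℂ] V) : Prop where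
  center : ρ 3 = 0 ∧ ρ 4 = 0
  lie_zero_one : ∀ f, ρ 0 (ρ 1 f) - ρ 1 (ρ 0 f) = ρ 2 f
  comm_zero_two : ∀ f, ρ 2 (ρ 0 f) = ρ 0 (ρ 2 f)
  comm_one_two : ∀ f, ρ 2 (ρ 1 f) = ρ 1 (ρ 2 f)

/-- The form `σ` with the coefficients at `A`, `B`, `C` replaced by `u`, `v`, `w`. -/
def extendForm {V : Type*} (A B C : Finset (Fin 5)) (σ : Form V) (u v w : V) : Form V := fun S =>
  if S = A then u else if S = B then v else if S = C then w else σ S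

theorem extendForm_eq {V : Type*} {A B C : Finset (Fin 5)} {σ : Form V} {u v w : V}
    {S : Finset (Fin 5)} (h : S ≠ A ∧ S ≠ B ∧ S ≠ C) : extendForm A B C σ u v w S = σ S := by
  rw [extendForm, if_neg h.1, if_neg h.2.1, if_neg h.2.2]

namespace IsBlockCogram

variable {V : Type*} [AddCommGroup V] [Module ℂ V] {g : LinearMap.BilinForm ℝ Lie235}
  {p r s k m : ℝ} {ρ : Fin 5 → V →ₗ[ℂ] V}

/-- No exact correction is needed when the leading part of dω is itself the harmonic representative.
-/
theorem ruminRel_of_eq (h : IsBlockCogram g p r s k m) (hρ : IsHeisenbergRep ρ) {q : ℕ}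
    (hq : q < 5) {σ : Harm V g q} {τ : Harm V g (q + 1)} (ω : Form V)
    (h1 : ∀ S, S.card ≠ q → ω S = 0) (h2 : ∀ S, formWt S ≤ cohWt q → ω S = σ.1 S)
    (h3 : ∀ S : Finset (Fin 5), S.card = q + 1 → formWt S < cohWt (q + 1) → deRham ρ ω S = 0)
    (h4 : ∀ S ∈ harmSet (q + 1), τ.1 S = deRham ρ ω S) : RuminRel ρ q σ.1 τ.1 := by
  refine ⟨ω, h1, h2, fun S hS => ?_, 0, fun S hS => ?_⟩
  · by_cases hc : S.card = q + 1
    · exact h3 S hc hS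
    · exact deRham_eq_zero hρ.center h1 hc
  · rw [map_zero, Pi.zero_apply, add_zero]
    by_cases hc : S.card = q + 1
    · exact h4 S (by simp [harmSet, hc, hS])
    · rw [deRham_eq_zero hρ.center h1 hc, h.apply_eq_zero (by omega) τ (by simp [harmSet, hc])]

theorem isRuminDifferential_zero (h : IsBlockCogram g p r s k m) (hρ : IsHeisenbergRep ρ)
    {D : Harm V g 0 →ₗ[ℂ] Harm V g 1}
    (hD : ∀ σ, h.harmOne (D σ) = (ρ 0 (h.harmZero σ), ρ 1 (h.harmZero σ))) :
    IsRuminDifferential ρ g 0 D := by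
  have hc := hρ.center
  intro σ τ
  constructor
  · rintro rfl
    refine h.ruminRel_of_eq hρ (by norm_num) σ.1 σ.2.1 (fun _ _ => rfl)
      (fun S h1 h2 => absurd h2 (by revert S; decide)) fun S hS => ?_
    have hl : S = {0} ∨ S = {1} := by revert S; decide
    rcases hl with rfl | rfl
    · rw [deRham_0 hc]
      exact congrArg Prod.fst (hD σ)
    · rw [deRham_1 hc]
      exact congrArg Prod.snd (hD σ)
  · rintro ⟨ω, -, h2, -, β, h4⟩
    have e0 := h4 {0} (by decide)
    have e1 := h4 {1} (by decide)
    have s0 := h2 ∅ (by decide)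
    rw [ceDiff_eq_deRham] at e0 e1
    rw [deRham_0 hc, deRham_0 ⟨rfl, rfl⟩, s0] at e0
    rw [deRham_1 hc, deRham_1 ⟨rfl, rfl⟩, s0] at e1
    refine h.harmOne.injective ((hD σ).trans (Prod.ext ?_ ?_))
    · exact (e0.trans (add_zero _)).symm
    · exact (e1.trans (add_zero _)).symm

/-- Vanishing of dω in weights 2 and 3 determines successively the coefficients of χ³ and of χ⁴, χ⁵
in the lift. The differential is then read off in weight 4. -/
theorem isRuminDifferential_one (h : IsBlockCogram g p r s k m) (hρ : IsHeisenbergRep ρ)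
    {D : Harm V g 1 →ₗ[ℂ] Harm V g 2}
    (hD : ∀ σ u v, h.harmOne σ = (u, v) → ∀ w, w = ρ 0 v - ρ 1 u →
      h.harmTwo (D σ) = (ρ 0 (ρ 0 w - ρ 2 u), ρ 0 (ρ 1 w - ρ 2 v), ρ 1 (ρ 1 w - ρ 2 v))) :
    IsRuminDifferential ρ g 1 D := by
  have hc := hρ.center
  intro σ τ
  have hD' := hD σ _ _ rfl _ rfl
  set w := ρ 0 (σ.1 {1}) - ρ 1 (σ.1 {0}) with hw
  constructor
  · rintro rfl
    refine h.ruminRel_of_eq hρ (by norm_num) (extendForm {2} {3} {4} σ.1 w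
      (ρ 0 w - ρ 2 (σ.1 {0})) (ρ 1 w - ρ 2 (σ.1 {1}))) (fun S hS => ?_) (fun S hS => ?_)
      (fun S h1 h2 => ?_) fun S hS => ?_
    · rw [extendForm_eq (by revert S; decide)]
      exact σ.2.1 S hS
    · exact extendForm_eq (by revert S; decide)
    · have hl : S = {0, 1} ∨ S = {0, 2} ∨ S = {1, 2} := by revert S; decide
      rcases hl with rfl | rfl | rfl
      · simp +decide [deRham_01 hc, extendForm, hw]
      · simp +decide [deRham_02 hc, extendForm]
      · simp +decide [deRham_12 hc, extendForm]
    · have hl : S = {0, 3} ∨ S = {0, 4} ∨ S = {1, 3} ∨ S = {1, 4} := by revert S; decide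
      have e1 : (D σ).1 {0, 3} = _ := congrArg Prod.fst hD'
      have e2 : (D σ).1 {0, 4} = _ := congrArg (fun x => x.2.1) hD'
      have e3 : (D σ).1 {1, 4} = _ := congrArg (fun x => x.2.2) hD'
      rcases hl with rfl | rfl | rfl | rfl
      · simp +decide [deRham_03 hc, extendForm, e1]
      · simp +decide [deRham_04 hc, extendForm, e2]
      · rw [(h.mem_harm_two.1 (D σ).2).2]
        simp +decide [deRham_13 hc, extendForm, e2]
        -- The two mixed coefficients agree because [X₁, X₂] = X₃ and X₃ acts centrally.
        have a1 := hρ.lie_zero_one w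
        have a2 := hρ.comm_zero_two (σ.1 {1})
        have a3 := hρ.comm_one_two (σ.1 {0})
        have a4 : ρ 2 w = ρ 2 (ρ 0 (σ.1 {1})) - ρ 2 (ρ 1 (σ.1 {0})) := by rw [hw, map_sub]
        change ρ 0 (ρ 1 w) - ρ 0 (ρ 2 (σ.1 {1})) = _
        rw [← a2, ← a3, sub_eq_sub_iff_sub_eq_sub, a1, a4]
      · simp +decide [deRham_14 hc, extendForm, e3]
  · rintro ⟨ω, -, h2, h3, β, h4⟩
    have s0 := h2 {0} (by decide)
    have s1 := h2 {1} (by decide)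
    have c1 := h3 {0, 1} (by decide)
    have c2 := h3 {0, 2} (by decide)
    have c3 := h3 {1, 2} (by decide)
    rw [deRham_01 hc, s0, s1, ← hw, sub_eq_zero] at c1
    rw [deRham_02 hc, s0, ← c1, sub_eq_zero] at c2
    rw [deRham_12 hc, s1, ← c1, sub_eq_zero] at c3
    have e1 := h4 {0, 3} (by decide)
    have e2 := h4 {0, 4} (by decide)
    have e3 := h4 {1, 4} (by decide)
    rw [ceDiff_eq_deRham] at e1 e2 e3
    rw [deRham_03 hc, deRham_03 ⟨rfl, rfl⟩, ← c2] at e1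
    rw [deRham_04 hc, deRham_04 ⟨rfl, rfl⟩, ← c3] at e2
    rw [deRham_14 hc, deRham_14 ⟨rfl, rfl⟩, ← c3] at e3
    refine h.harmTwo.injective (hD'.trans (Prod.ext ?_ (Prod.ext ?_ ?_)))
    · exact (e1.trans (add_zero _)).symm
    · exact (e2.trans (add_zero _)).symm
    · exact (e3.trans (add_zero _)).symm

/-- The coefficients at {2, 3} and {2, 4} are forced in weight 5. The one at {3, 4} has weight N_3 =
6 and is free, changing the result by a multiple of ∂(χ⁴ ∧ χ⁵); it is chosen to make the result
symmetric. -/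
theorem isRuminDifferential_two (h : IsBlockCogram g p r s k m) (hρ : IsHeisenbergRep ρ)
    {D : Harm V g 2 →ₗ[ℂ] Harm V g 3}
    (hD : ∀ σ A B C, h.harmTwo σ = (A, B, C) → ∀ u v, u = ρ 0 B - ρ 1 A → v = ρ 0 C - ρ 1 B →
      h.harmThree (D σ) = (ρ 0 u - ρ 2 A, (2⁻¹ : ℂ) • (ρ 0 v + ρ 1 u - (2 : ℂ) • ρ 2 B),
        ρ 1 v - ρ 2 C)) :
    IsRuminDifferential ρ g 2 D := by
  have hc := hρ.center
  intro σ τ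
  have hD' := hD σ _ _ _ rfl _ _ rfl rfl
  have hσ := (h.mem_harm_two.1 σ.2).2
  set u := ρ 0 (σ.1 {0, 4}) - ρ 1 (σ.1 {0, 3}) with hu
  set v := ρ 0 (σ.1 {1, 4}) - ρ 1 (σ.1 {0, 4}) with hv
  constructor
  · rintro rfl
    have z1 : σ.1 {0, 1} = 0 := h.apply_eq_zero (by norm_num) σ (by decide)
    have z2 : σ.1 {0, 2} = 0 := h.apply_eq_zero (by norm_num) σ (by decide)
    have z3 : σ.1 {1, 2} = 0 := h.apply_eq_zero (by norm_num) σ (by decide)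
    refine h.ruminRel_of_eq hρ (by norm_num) (extendForm {2, 3} {2, 4} {3, 4} σ.1 u v
      ((2⁻¹ : ℂ) • (ρ 0 v - ρ 1 u))) (fun S hS => ?_) (fun S hS => ?_)
      (fun S h1 h2 => ?_) fun S hS => ?_
    · rw [extendForm_eq (by revert S; decide)]
      exact σ.2.1 S hS
    · exact extendForm_eq (by revert S; decide)
    · have hl : S = {0, 1, 2} ∨ S = {0, 1, 3} ∨ S = {0, 1, 4} := by revert S; decide
      rcases hl with rfl | rfl | rfl
      · simp +decide [deRham_012 hc, extendForm, hσ, z1, z2, z3]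
      · simp +decide [deRham_013 hc, extendForm, hσ, hu]
      · simp +decide [deRham_014 hc, extendForm, hv]
    · have hl : S = {0, 2, 3} ∨ S = {0, 2, 4} ∨ S = {1, 2, 3} ∨ S = {1, 2, 4} := by
        revert S; decide
      have e1 : (D σ).1 {0, 2, 3} = ρ 0 u - ρ 2 (σ.1 {0, 3}) := congrArg Prod.fst hD'
      have e2 : (D σ).1 {0, 2, 4} =
          (2⁻¹ : ℂ) • (ρ 0 v + ρ 1 u - (2 : ℂ) • ρ 2 (σ.1 {0, 4})) :=
        congrArg (fun x => x.2.1) hD'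
      have e3 : (D σ).1 {1, 2, 4} = ρ 1 v - ρ 2 (σ.1 {1, 4}) := congrArg (fun x => x.2.2) hD'
      rcases hl with rfl | rfl | rfl | rfl
      · simp +decide [deRham_023 hc, extendForm, e1]
      · simp +decide [deRham_024 hc, extendForm, e2]
        module
      · rw [(h.mem_harm_three.1 (D σ).2).2]
        simp +decide [deRham_123 hc, extendForm, e2, hσ]
        module
      · simp +decide [deRham_124 hc, extendForm, e3]
  · rintro ⟨ω, -, h2, h3, β, h4⟩
    have s1 := h2 {0, 3} (by decide)
    have s2 := h2 {0, 4} (by decide)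
    have s3 := h2 {1, 3} (by decide)
    have s4 := h2 {1, 4} (by decide)
    have c1 := h3 {0, 1, 3} (by decide)
    have c2 := h3 {0, 1, 4} (by decide)
    rw [deRham_013 hc, s1, s3, hσ, ← hu, sub_eq_zero] at c1
    rw [deRham_014 hc, s2, s4, ← hv, sub_eq_zero] at c2
    have e1 := h4 {0, 2, 3} (by decide)
    have e2 := h4 {0, 2, 4} (by decide)
    have e3 := h4 {1, 2, 3} (by decide)
    have e4 := h4 {1, 2, 4} (by decide)
    rw [ceDiff_eq_deRham] at e1 e2 e3 e4
    rw [deRham_023 hc, deRham_023 ⟨rfl, rfl⟩, ← c1, s1] at e1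
    rw [deRham_024 hc, deRham_024 ⟨rfl, rfl⟩, ← c2, s2] at e2
    rw [deRham_123 hc, deRham_123 ⟨rfl, rfl⟩, ← c1, s3, hσ, (h.mem_harm_three.1 τ.2).2] at e3
    rw [deRham_124 hc, deRham_124 ⟨rfl, rfl⟩, ← c2, s4] at e4
    simp only [Pi.zero_apply, LinearMap.zero_apply, sub_zero, zero_sub, zero_add, add_zero]
      at e1 e2 e3 e4
    refine h.harmThree.injective (hD'.trans (Prod.ext ?_ (Prod.ext ?_ ?_)))
    · exact e1.symm
    · change _ = τ.1 {0, 2, 4}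
      -- Averaging the equations at {0, 2, 4} and {1, 2, 3} cancels both the free coefficient of ω
      -- and that of β.
      have : τ.1 {0, 2, 4} = (2⁻¹ : ℂ) • (τ.1 {0, 2, 4} + τ.1 {0, 2, 4}) := by module
      rw [this]
      nth_rewrite 1 [e2]
      rw [e3]
      change (2⁻¹ : ℂ) • (ρ 0 v + ρ 1 u - (2 : ℂ) • ρ 2 (σ.1 {0, 4})) = _
      module
    · exact e4.symm

/-- The lift is forced first in weight 7, giving u and v, and then in weight 8, giving w. -/
theorem isRuminDifferential_three (h : IsBlockCogram g p r s k m) (hρ : IsHeisenbergRep ρ)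
    {D : Harm V g 3 →ₗ[ℂ] Harm V g 4}
    (hD : ∀ σ A B C, h.harmThree σ = (A, B, C) → ∀ u v w, u = ρ 0 B - ρ 1 A →
      v = ρ 0 C - ρ 1 B → w = ρ 0 v - ρ 1 u →
      h.harmFour (D σ) = (ρ 0 w - ρ 2 u, ρ 1 w - ρ 2 v)) :
    IsRuminDifferential ρ g 3 D := by
  have hc := hρ.center
  intro σ τ
  have hD' := hD σ _ _ _ rfl _ _ _ rfl rfl rfl
  have hσ := (h.mem_harm_three.1 σ.2).2
  set u := ρ 0 (σ.1 {0, 2, 4}) - ρ 1 (σ.1 {0, 2, 3}) with hu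
  set v := ρ 0 (σ.1 {1, 2, 4}) - ρ 1 (σ.1 {0, 2, 4}) with hv
  set w := ρ 0 v - ρ 1 u with hw
  have z1 : σ.1 {0, 1, 3} = 0 := h.apply_eq_zero (by norm_num) σ (by decide)
  have z2 : σ.1 {0, 1, 4} = 0 := h.apply_eq_zero (by norm_num) σ (by decide)
  constructor
  · rintro rfl
    refine h.ruminRel_of_eq hρ (by norm_num) (extendForm {0, 3, 4} {1, 3, 4} {2, 3, 4} σ.1 u v w)
      (fun S hS => ?_) (fun S hS => ?_) (fun S h1 h2 => ?_) fun S hS => ?_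
    · rw [extendForm_eq (by revert S; decide)]
      exact σ.2.1 S hS
    · exact extendForm_eq (by revert S; decide)
    · have hl : S = {0, 1, 2, 3} ∨ S = {0, 1, 2, 4} ∨ S = {0, 1, 3, 4} := by revert S; decide
      rcases hl with rfl | rfl | rfl
      · simp +decide [deRham_0123 hc, extendForm, hσ, z1, hu]
      · simp +decide [deRham_0124 hc, extendForm, z2, hv]
      · simp +decide [deRham_0134 hc, extendForm, hw]
    · have hl : S = {0, 2, 3, 4} ∨ S = {1, 2, 3, 4} := by revert S; decide
      have e1 : (D σ).1 {0, 2, 3, 4} = ρ 0 w - ρ 2 u := congrArg Prod.fst hD'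
      have e2 : (D σ).1 {1, 2, 3, 4} = ρ 1 w - ρ 2 v := congrArg Prod.snd hD'
      rcases hl with rfl | rfl
      · simp +decide [deRham_0234 hc, extendForm, e1]
      · simp +decide [deRham_1234 hc, extendForm, e2]
  · rintro ⟨ω, -, h2, h3, β, h4⟩
    have s1 := h2 {0, 2, 3} (by decide)
    have s2 := h2 {0, 2, 4} (by decide)
    have s3 := h2 {1, 2, 3} (by decide)
    have s4 := h2 {1, 2, 4} (by decide)
    have s5 := (h2 {0, 1, 3} (by decide)).trans z1
    have s6 := (h2 {0, 1, 4} (by decide)).trans z2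
    have c1 := h3 {0, 1, 2, 3} (by decide)
    have c2 := h3 {0, 1, 2, 4} (by decide)
    have c3 := h3 {0, 1, 3, 4} (by decide)
    rw [deRham_0123 hc, s1, s3, s5, hσ, ← hu, map_zero, add_zero, sub_eq_zero] at c1
    rw [deRham_0124 hc, s2, s4, s6, ← hv, map_zero, add_zero, sub_eq_zero] at c2
    rw [deRham_0134 hc, ← c1, ← c2, ← hw, sub_eq_zero] at c3
    have e1 := h4 {0, 2, 3, 4} (by decide)
    have e2 := h4 {1, 2, 3, 4} (by decide)
    rw [ceDiff_eq_deRham] at e1 e2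
    rw [deRham_0234 hc, deRham_0234 ⟨rfl, rfl⟩, ← c1, ← c3] at e1
    rw [deRham_1234 hc, deRham_1234 ⟨rfl, rfl⟩, ← c2, ← c3] at e2
    simp only [Pi.zero_apply, LinearMap.zero_apply, sub_zero, add_zero] at e1 e2
    exact h.harmFour.injective (hD'.trans (Prod.ext e1.symm e2.symm))

theorem isRuminDifferential_four (h : IsBlockCogram g p r s k m) (hρ : IsHeisenbergRep ρ)
    {D : Harm V g 4 →ₗ[ℂ] Harm V g 5}
    (hD : ∀ σ u v, h.harmFour σ = (u, v) → h.harmFive (D σ) = ρ 0 v - ρ 1 u) :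
    IsRuminDifferential ρ g 4 D := by
  have hc := hρ.center
  intro σ τ
  have hz : ∀ {S}, S ∉ harmSet 4 → σ.1 S = 0 := fun hS => h.apply_eq_zero (by norm_num) σ hS
  have hD' := hD σ _ _ rfl
  constructor
  · rintro rfl
    refine h.ruminRel_of_eq hρ (by norm_num) σ.1 σ.2.1 (fun _ _ => rfl)
      (fun S h1 h2 => absurd h2 (by revert S; decide)) fun S hS => ?_
    have hl : S = {0, 1, 2, 3, 4} := by revert S; decide
    subst hl
    rw [deRham_01234 hc, hz (S := {0, 1, 3, 4}) (by decide), map_zero, add_zero]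
    exact hD'
  · rintro ⟨ω, -, h2, -, β, h4⟩
    have s0 := h2 {0, 2, 3, 4} (by decide)
    have s1 := h2 {1, 2, 3, 4} (by decide)
    have s2 := (h2 {0, 1, 3, 4} (by decide)).trans (hz (by decide))
    have e := h4 {0, 1, 2, 3, 4} (by decide)
    rw [ceDiff_eq_deRham, deRham_01234 hc, deRham_01234 ⟨rfl, rfl⟩, s0, s1, s2] at e
    simp only [Pi.zero_apply, LinearMap.zero_apply, sub_zero, add_zero, map_zero] at e
    exact h.harmFive.injective (hD'.trans e.symm)

end IsBlockCogram

end

/-! ### Isotropic frames and reduction to the model complex. -/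

noncomputable section

open scoped ComplexConjugate SchwartzMap InnerProductSpace
open Lie235 IsBlockCogram Oscillator

section frames

variable {V : Type*} [AddCommGroup V] [Module ℂ V]

/-- The pairs `u α + v β`, for a basis `α, β` of `ℂ²`. -/
def pairFrame {α₀ α₁ β₀ β₁ : ℂ} (hc : α₀ * β₁ - β₀ * α₁ ≠ 0) : (V × V) ≃ₗ[ℂ] V × V where
  toFun x := (α₀ • x.1 + β₀ • x.2, α₁ • x.1 + β₁ • x.2)
  map_add' x y := by ext <;> simp <;> module
  map_smul' c x := by ext <;> simp <;> module
  invFun y := ((α₀ * β₁ - β₀ * α₁)⁻¹ • (β₁ • y.1 - β₀ • y.2),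
    (α₀ * β₁ - β₀ * α₁)⁻¹ • (α₀ • y.2 - α₁ • y.1))
  left_inv x := by
    ext
    · refine (inv_smul_eq_iff₀ hc).2 ?_
      module
    · refine (inv_smul_eq_iff₀ hc).2 ?_
      module
  right_inv y := by
    ext
    · refine Eq.trans ?_ (inv_smul_smul₀ hc y.1)
      module
    · refine Eq.trans ?_ (inv_smul_smul₀ hc y.2)
      module

/-- The symmetric `2`-tensors `A α² + 2 B α β + C β²`, for a basis `α, β` of `ℂ²`. -/
def symFrame {α₀ α₁ β₀ β₁ : ℂ} (hc : α₀ * β₁ - β₀ * α₁ ≠ 0) :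
    (V × V × V) ≃ₗ[ℂ] V × V × V where
  toFun x := (α₀ ^ 2 • x.1 + (2 * α₀ * β₀) • x.2.1 + β₀ ^ 2 • x.2.2,
    (α₀ * α₁) • x.1 + (α₀ * β₁ + β₀ * α₁) • x.2.1 + (β₀ * β₁) • x.2.2,
    α₁ ^ 2 • x.1 + (2 * α₁ * β₁) • x.2.1 + β₁ ^ 2 • x.2.2)
  map_add' x y := by ext <;> simp <;> module
  map_smul' c x := by ext <;> simp <;> module
  invFun y := (((α₀ * β₁ - β₀ * α₁) ^ 2)⁻¹ •
      (β₁ ^ 2 • y.1 - (2 * β₀ * β₁) • y.2.1 + β₀ ^ 2 • y.2.2),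
    ((α₀ * β₁ - β₀ * α₁) ^ 2)⁻¹ •
      ((α₀ * β₁ + β₀ * α₁) • y.2.1 - (α₁ * β₁) • y.1 - (α₀ * β₀) • y.2.2),
    ((α₀ * β₁ - β₀ * α₁) ^ 2)⁻¹ •
      (α₁ ^ 2 • y.1 - (2 * α₀ * α₁) • y.2.1 + α₀ ^ 2 • y.2.2))
  left_inv x := by
    have hc' := pow_ne_zero 2 hc
    refine Prod.ext ?_ (Prod.ext ?_ ?_) <;> refine (inv_smul_eq_iff₀ hc').2 ?_ <;> module
  right_inv y := by
    have hc' := pow_ne_zero 2 hc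
    refine Prod.ext ?_ (Prod.ext ?_ ?_)
    · refine Eq.trans ?_ (inv_smul_smul₀ hc' y.1)
      module
    · refine Eq.trans ?_ (inv_smul_smul₀ hc' y.2.1)
      module
    · refine Eq.trans ?_ (inv_smul_smul₀ hc' y.2.2)
      module

theorem pairFrame_apply {α₀ α₁ β₀ β₁ : ℂ} (hc : α₀ * β₁ - β₀ * α₁ ≠ 0) (u v : V) :
    pairFrame hc (u, v) = (α₀ • u + β₀ • v, α₁ • u + β₁ • v) := rfl

theorem symFrame_apply {α₀ α₁ β₀ β₁ : ℂ} (hc : α₀ * β₁ - β₀ * α₁ ≠ 0) (A B C : V) :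
    symFrame hc (A, B, C) = (α₀ ^ 2 • A + (2 * α₀ * β₀) • B + β₀ ^ 2 • C,
      (α₀ * α₁) • A + (α₀ * β₁ + β₀ * α₁) • B + (β₀ * β₁) • C,
      α₁ ^ 2 • A + (2 * α₁ * β₁) • B + β₁ ^ 2 • C) := rfl

/-- The involution `diag(1, -1)` of the space of pairs. -/
def flipPair : (V × V) ≃ₗ[ℂ] V × V :=
  LinearEquiv.prodCongr (LinearEquiv.refl ℂ V) (LinearEquiv.neg ℂ)

/-- The involution `diag(1, -1, 1)` of the space of symmetric `2`-tensors. -/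
def flipSym : (V × V × V) ≃ₗ[ℂ] V × V × V :=
  LinearEquiv.prodCongr (LinearEquiv.refl ℂ V)
    (LinearEquiv.prodCongr (LinearEquiv.neg ℂ) (LinearEquiv.refl ℂ V))

theorem flipPair_apply (u v : V) : flipPair (u, v) = (u, -v) := rfl

theorem flipSym_apply (A B C : V) : flipSym (A, B, C) = (A, -B, C) := rfl

theorem flipPair_flipPair (x : V × V) : flipPair (flipPair x) = x :=
  Prod.ext rfl (neg_neg _)

theorem flipSym_flipSym (x : V × V × V) : flipSym (flipSym x) = x :=
  Prod.ext rfl (Prod.ext (neg_neg _) rfl)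

end frames

section identities

variable {V : Type*} [AddCommGroup V] [Module ℂ V] {a ad : V →ₗ[ℂ] V} {α₀ α₁ β₀ β₁ : ℂ}
  {ρ : Fin 5 → V →ₗ[ℂ] V}

/-- The operators `ρ(X_i)` in terms of the ladder operators of the frame `α, β`. -/
structure IsLadder (ρ : Fin 5 → V →ₗ[ℂ] V) (a ad : V →ₗ[ℂ] V) (α₀ α₁ β₀ β₁ : ℂ) : Prop where
  ne : α₀ * β₁ - β₀ * α₁ ≠ 0
  comm : ∀ f, a (ad f) = ad (a f) + f
  zero : ∀ f, ρ 0 f = α₀ • ad f - β₀ • a f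
  one : ∀ f, ρ 1 f = α₁ • ad f - β₁ • a f
  two : ∀ f, ρ 2 f = (α₀ * β₁ - β₀ * α₁) • f
  center : ρ 3 = 0 ∧ ρ 4 = 0

namespace IsLadder

theorem isHeisenbergRep (h : IsLadder ρ a ad α₀ α₁ β₀ β₁) : IsHeisenbergRep ρ where
  center := h.center
  lie_zero_one f := by
    simp only [h.zero, h.one, h.two, map_sub, map_smul, h.comm]
    module
  comm_zero_two f := by rw [h.two, h.two, map_smul]
  comm_one_two f := by rw [h.two, h.two, map_smul]

theorem pairFrame_d0 (h : IsLadder ρ a ad α₀ α₁ β₀ β₁) (f : V) :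
    pairFrame h.ne (d0 a ad f) = (ρ 0 f, ρ 1 f) := by
  rw [d0_apply, pairFrame_apply, h.zero, h.one]
  simp only [smul_neg, sub_eq_add_neg]

theorem symFrame_d1 (h : IsLadder ρ a ad α₀ α₁ β₀ β₁) {x : V × V} {u v w : V}
    (hx : pairFrame h.ne x = (u, v)) (hw : w = ρ 0 v - ρ 1 u) :
    symFrame h.ne ((α₀ * β₁ - β₀ * α₁) • d1 a ad x) =
      (ρ 0 (ρ 0 w - ρ 2 u), ρ 0 (ρ 1 w - ρ 2 v), ρ 1 (ρ 1 w - ρ 2 v)) := by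
  obtain ⟨x, y⟩ := x
  rw [pairFrame_apply, Prod.mk.injEq] at hx
  rw [hw, ← hx.1, ← hx.2, map_smul, d1_apply, symFrame_apply]
  refine Prod.ext ?_ (Prod.ext ?_ ?_) <;>
    simp only [h.zero, h.one, h.two, map_sub, map_add, map_smul, h.comm, Prod.smul_mk] <;> module

/-- In a common frame the middle differential is `d2` only up to the sign of the mixed component.
Building this flip into the model in degree 3 leaves the symmetric operator. -/
theorem symFrame_d2 (h : IsLadder ρ a ad α₀ α₁ β₀ β₁) {x : V × V × V} {A B C u v : V}
    (hx : symFrame h.ne x = (A, B, C)) (hu : u = ρ 0 B - ρ 1 A) (hv : v = ρ 0 C - ρ 1 B) :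
    symFrame h.ne ((α₀ * β₁ - β₀ * α₁) • flipSym (d2 a ad x)) =
      (ρ 0 u - ρ 2 A, (2⁻¹ : ℂ) • (ρ 0 v + ρ 1 u - (2 : ℂ) • ρ 2 B), ρ 1 v - ρ 2 C) := by
  obtain ⟨x, y, z⟩ := x
  rw [symFrame_apply, Prod.mk.injEq, Prod.mk.injEq] at hx
  rw [hu, hv, ← hx.1, ← hx.2.1, ← hx.2.2, map_smul, d2_apply, flipSym_apply, symFrame_apply]
  refine Prod.ext ?_ (Prod.ext ?_ ?_) <;>
    simp only [h.zero, h.one, h.two, map_sub, map_add, map_smul, h.comm, Prod.smul_mk] <;> module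

/-- Hodge duality in explicit form: up to a constant and sign flips, the differential in degree 3 is
the adjoint of the one in degree 1. -/
theorem pairFrame_d1' (h : IsLadder ρ a ad α₀ α₁ β₀ β₁) {x : V × V × V} {A B C u v w : V}
    (hx : symFrame h.ne x = (A, B, C)) (hu : u = ρ 0 B - ρ 1 A) (hv : v = ρ 0 C - ρ 1 B)
    (hw : w = ρ 0 v - ρ 1 u) :
    pairFrame h.ne ((α₀ * β₁ - β₀ * α₁) ^ 2 • flipPair (d1' a ad (flipSym x))) =
      (ρ 0 w - ρ 2 u, ρ 1 w - ρ 2 v) := by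
  obtain ⟨x, y, z⟩ := x
  rw [symFrame_apply, Prod.mk.injEq, Prod.mk.injEq] at hx
  rw [hw, hu, hv, ← hx.1, ← hx.2.1, ← hx.2.2, map_smul, flipSym_apply, d1'_apply, flipPair_apply,
    pairFrame_apply]
  refine Prod.ext ?_ ?_ <;>
    simp only [h.zero, h.one, h.two, map_sub, map_add, map_smul, map_neg, h.comm, Prod.smul_mk] <;>
    module

theorem smul_d0' (h : IsLadder ρ a ad α₀ α₁ β₀ β₁) {x : V × V} {u v : V}
    (hx : pairFrame h.ne x = (u, v)) :
    (α₀ * β₁ - β₀ * α₁) • d0' a ad (flipPair x) = ρ 0 v - ρ 1 u := by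
  obtain ⟨x, y⟩ := x
  rw [pairFrame_apply, Prod.mk.injEq] at hx
  rw [← hx.1, ← hx.2, flipPair_apply, d0'_apply]
  simp only [h.zero, h.one, map_add, map_smul, map_neg]
  module

end IsLadder

end identities

section isotropic

/-- A vector `α ∈ ℂ²` that is isotropic for the block of the metric. -/
structure IsIsotropicFrame (p r s κ ħ : ℝ) (α₀ α₁ : ℂ) : Prop where
  isotropic : p * α₀ ^ 2 + 2 * r * α₀ * α₁ + s * α₁ ^ 2 = 0
  norm : p * (α₀ * conj α₀) + r * (α₀ * conj α₁ + α₁ * conj α₀) + s * (α₁ * conj α₁) = κ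
  area : α₀ * conj α₁ - conj α₀ * α₁ = Complex.I * ħ

/-- The quadratic p z² + 2 r z + s has a pair of conjugate nonreal roots z = α₀/α₁. The sign of ħ
selects the root, and the absolute value of the area fixes the scale. -/
theorem exists_isIsotropicFrame {p r s ħ : ℝ} (hp : 0 < p) (hδ : 0 < p * s - r ^ 2)
    (hħ : ħ ≠ 0) :
    ∃ α₀ α₁ : ℂ, IsIsotropicFrame p r s (|ħ| * √(p * s - r ^ 2)) ħ α₀ α₁ := by
  set δ := p * s - r ^ 2 with hδdef
  set d := √δ with hd
  have hd0 : 0 < d := Real.sqrt_pos.2 hδ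
  have hdd : d ^ 2 = δ := Real.sq_sqrt hδ.le
  set t := √(|ħ| * p / (2 * d)) with ht
  have htt : t ^ 2 = |ħ| * p / (2 * d) := Real.sq_sqrt (by positivity)
  set ε := Real.sign ħ with hε
  have hεε : ε ^ 2 = 1 := by
    rcases hħ.lt_or_gt with h | h
    · rw [hε, Real.sign_of_neg h]; norm_num
    · rw [hε, Real.sign_of_pos h]; norm_num
  have hεħ : ε * |ħ| = ħ := real_sign_mul_abs ħ
  have hpC : (p : ℂ) ≠ 0 := Complex.ofReal_ne_zero.2 hp.ne'
  have hs : s = (d ^ 2 + r ^ 2) / p := by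
    rw [hdd, hδdef]
    field_simp
    ring
  have hI : Complex.I ^ 2 = -1 := Complex.I_sq
  have hεC : (ε : ℂ) ^ 2 = 1 := by exact_mod_cast hεε
  have htC : (t : ℂ) ^ 2 = |ħ| * p / (2 * d) := by exact_mod_cast htt
  have hdC : (d : ℂ) ≠ 0 := Complex.ofReal_ne_zero.2 hd0.ne'
  have hεħC : (ε : ℂ) * |ħ| = ħ := by exact_mod_cast hεħ
  -- The area of this vector with its conjugate is 2iεd t²/p, which is iħ by the choice of t.
  refine ⟨t * (-r + Complex.I * (ε * d)) / p, t, ?_, ?_, ?_⟩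
  · have : (t : ℂ) ^ 2 * (Complex.I ^ 2 * ε ^ 2 * d ^ 2 - r ^ 2 + p * s) / p = 0 := by
      rw [hI, hεC, hs]
      push_cast
      field_simp
      ring
    rw [← this]
    field_simp
    ring
  · simp only [map_div₀, map_mul, map_add, map_neg, Complex.conj_I, Complex.conj_ofReal]
    have : (t : ℂ) ^ 2 * (p * s - r ^ 2 - Complex.I ^ 2 * ε ^ 2 * d ^ 2) / p =
        ((|ħ| * d : ℝ) : ℂ) := by
      rw [hI, hεC, hs, htC]
      push_cast
      field_simp
      ring
    rw [← this]
    field_simp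
    ring
  · simp only [map_div₀, map_mul, map_add, map_neg, Complex.conj_I, Complex.conj_ofReal]
    have : (t : ℂ) ^ 2 * (2 * Complex.I * ε * d) / p = Complex.I * ħ := by
      rw [htC, ← hεħC]
      field_simp
    rw [← this]
    ring

namespace IsIsotropicFrame

variable {p r s κ ħ : ℝ} {α₀ α₁ : ℂ}

theorem isotropic_conj (h : IsIsotropicFrame p r s κ ħ α₀ α₁) :
    p * conj α₀ ^ 2 + 2 * r * conj α₀ * conj α₁ + s * conj α₁ ^ 2 = 0 := by
  have := congrArg conj h.isotropic
  simpa [map_ofNat] using this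

theorem area_ne (h : IsIsotropicFrame p r s κ ħ α₀ α₁) (hħ : ħ ≠ 0) :
    α₀ * conj α₁ - conj α₀ * α₁ ≠ 0 := by
  rw [h.area]
  exact I_mul_ne hħ

theorem isLadder (h : IsIsotropicFrame p r s κ ħ α₀ α₁) (hħ : ħ ≠ 0) :
    IsLadder (schrodinger ħ) (lowerOp ħ α₀ α₁) (raiseOp ħ α₀ α₁) α₀ α₁ (conj α₀) (conj α₁) where
  ne := h.area_ne hħ
  comm := ladder_comm hħ h.area
  zero := schrodinger_zero_eq hħ h.area
  one := schrodinger_one_eq hħ h.area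
  two f := by rw [h.area]; rfl
  center := ⟨rfl, rfl⟩

/-- Isotropy of α and of its conjugate removes the mixed terms; the diagonal ones both carry κ. -/
theorem blockInner_pairFrame (h : IsIsotropicFrame p r s κ ħ α₀ α₁)
    (hc : α₀ * conj α₁ - conj α₀ * α₁ ≠ 0) (x y : 𝓢(ℝ, ℂ) × 𝓢(ℝ, ℂ)) :
    blockInner p r s (pairFrame hc x) (pairFrame hc y) =
      κ * ⟪J2 schwartzToL2 x, J2 schwartzToL2 y⟫_ℂ := by
  obtain ⟨u, v⟩ := x
  obtain ⟨u', v'⟩ := y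
  rw [inner_J2, pairFrame_apply, pairFrame_apply]
  simp only [blockInner, map_add, map_smul, inner_add_left, inner_add_right, inner_smul_left,
    inner_smul_right, Complex.conj_conj]
  linear_combination (⟪schwartzToL2 u, schwartzToL2 u'⟫_ℂ + ⟪schwartzToL2 v, schwartzToL2 v'⟫_ℂ) *
    h.norm + ⟪schwartzToL2 v, schwartzToL2 u'⟫_ℂ * h.isotropic +
    ⟪schwartzToL2 u, schwartzToL2 v'⟫_ℂ * h.isotropic_conj

/-- A symmetric tensor is a pair of pairs, so the pair identity is applied in each slot; the shared
mixed coefficient then appears twice. -/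
theorem blockInnerSym_symFrame (h : IsIsotropicFrame p r s κ ħ α₀ α₁)
    (hc : α₀ * conj α₁ - conj α₀ * α₁ ≠ 0) (x y : 𝓢(ℝ, ℂ) × 𝓢(ℝ, ℂ) × 𝓢(ℝ, ℂ)) :
    blockInnerSym p r s (symFrame hc x) (symFrame hc y) =
      κ ^ 2 * ⟪J3 schwartzToL2 x, J3 schwartzToL2 y⟫_ℂ := by
  obtain ⟨A, B, C⟩ := x
  obtain ⟨A', B', C'⟩ := y
  have h2 : ∀ u v u' v' : 𝓢(ℝ, ℂ), blockInner p r s (α₀ • u + conj α₀ • v, α₁ • u + conj α₁ • v)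
      (α₀ • u' + conj α₀ • v', α₁ • u' + conj α₁ • v') =
      κ * (⟪schwartzToL2 u, schwartzToL2 u'⟫_ℂ + ⟪schwartzToL2 v, schwartzToL2 v'⟫_ℂ) := by
    intro u v u' v'
    have := h.blockInner_pairFrame hc (u, v) (u', v')
    rwa [inner_J2, pairFrame_apply, pairFrame_apply] at this
  have e0 : ∀ A B C : 𝓢(ℝ, ℂ), ((symFrame hc (A, B, C)).1, (symFrame hc (A, B, C)).2.1) =
      (α₀ • (α₀ • A + conj α₀ • B) + conj α₀ • (α₀ • B + conj α₀ • C),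
        α₁ • (α₀ • A + conj α₀ • B) + conj α₁ • (α₀ • B + conj α₀ • C)) := by
    intro A B C
    rw [symFrame_apply]
    ext1 <;> module
  have e1 : ∀ A B C : 𝓢(ℝ, ℂ), (symFrame hc (A, B, C)).2 =
      (α₀ • (α₁ • A + conj α₁ • B) + conj α₀ • (α₁ • B + conj α₁ • C),
        α₁ • (α₁ • A + conj α₁ • B) + conj α₁ • (α₁ • B + conj α₁ • C)) := by
    intro A B C
    rw [symFrame_apply]
    ext1 <;> module
  have h3 := h2 A B A' B'
  have h4 := h2 B C B' C'
  rw [blockInnerSym, e0, e0, e1, e1, h2, h2, h2, h2, inner_J3]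
  rw [blockInner] at h3 h4
  simp only at h3 h4 ⊢
  linear_combination (κ : ℂ) * h3 + (κ : ℂ) * h4

end IsIsotropicFrame

end isotropic

end

/-! ### Transfer from the model to harmonic forms. -/

noncomputable section

open scoped ComplexConjugate SchwartzMap InnerProductSpace
open Lie235 IsBlockCogram Oscillator

section transfer

variable {g : LinearMap.BilinForm ℝ Lie235} {K K' X Y : Type*}
  [NormedAddCommGroup K] [InnerProductSpace ℂ K] [AddCommGroup X] [Module ℂ X]
  [NormedAddCommGroup K'] [InnerProductSpace ℂ K'] [AddCommGroup Y] [Module ℂ Y]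
  {J : X →ₗ[ℂ] K} {J' : Y →ₗ[ℂ] K'}

theorem EigenSystem.smul {T : X →ₗ[ℂ] X} {B : Submodule ℂ X} {ι : Type} {E : ι → X} {lam : ι → ℝ}
    (h : EigenSystem J T B E lam) {c : ι → ℂ} (hc : ∀ i, c i ≠ 0) :
    EigenSystem J T B (fun i => c i • E i) lam where
  pos := h.pos
  eigen i := by rw [map_smul, h.eigen, smul_comm]
  ne i := smul_ne_zero (hc i) (h.ne i)
  orth i k hik := by
    rw [map_smul, map_smul, inner_smul_left, inner_smul_right, h.orth i k hik, mul_zero, mul_zero]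
  span := by
    refine h.span.trans (sup_le_sup_right (Submodule.span_le.2 ?_) _)
    rintro _ ⟨i, rfl⟩
    rw [← inv_smul_smul₀ (hc i) (E i)]
    exact Submodule.smul_mem _ _ (Submodule.subset_span ⟨i, rfl⟩)

/-- An isomorphism of `X` with the space of harmonic forms which is an isometry up to the factor
`κ`. -/
structure IsHarmModel {q : ℕ} (Φ : X ≃ₗ[ℂ] Harm 𝓢(ℝ, ℂ) g q) (J : X →ₗ[ℂ] K) (κ : ℝ) : Prop where
  pos : 0 < κ
  inner_eq : ∀ x y, formInner g (Φ x).1 (Φ y).1 = κ * ⟪J x, J y⟫_ℂ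

/-- Normalizing the eigenvectors and dividing by √κ turns Parseval's identity in the model into the
one for the metric on harmonic forms. -/
theorem IsHarmModel.exists_isSpectralResolution [CompleteSpace K] {q : ℕ}
    {Φ : X ≃ₗ[ℂ] Harm 𝓢(ℝ, ℂ) g q} {κ : ℝ} (hΦ : IsHarmModel Φ J κ) (hJ : Function.Injective J)
    {T : X →ₗ[ℂ] X} (hT : ∀ x y, ⟪J (T x), J y⟫_ℂ = ⟪J x, J (T y)⟫_ℂ) {B : Submodule ℂ X}
    (hB : ∀ r : K, (∀ b ∈ B, ⟪J b, r⟫_ℂ = 0) → r = 0) {ι : Type} {E : ι → X} {lam : ι → ℝ}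
    (h : EigenSystem J T B E lam) {C : ℝ} (hC : 0 < C)
    {T' : Harm 𝓢(ℝ, ℂ) g q →ₗ[ℂ] Harm 𝓢(ℝ, ℂ) g q} (hT' : ∀ x, T' (Φ x) = (C : ℂ) • Φ (T x)) :
    ∃ e, IsSpectralResolution g T' e fun i => C * lam i := by
  obtain ⟨F, h', horth⟩ : ∃ F : ι → X, EigenSystem J T B F lam ∧
      Orthonormal ℂ fun i => J (F i) := by
    have hN : ∀ i, ‖J (E i)‖ ≠ 0 := fun i =>
      norm_ne_zero_iff.2 ((map_ne_zero_iff J hJ).2 (h.ne i))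
    have h' := h.smul fun i => inv_ne_zero (Complex.ofReal_ne_zero.2 (hN i))
    refine ⟨_, h', fun i => ?_, fun i k hik => h'.orth i k hik⟩
    beta_reduce
    rw [map_smul, norm_smul, norm_inv, Complex.norm_real, norm_norm, inv_mul_cancel₀ (hN i)]
  have hself : ∀ i, ⟪J (F i), J (F i)⟫_ℂ = 1 := fun i => by
    rw [inner_self_eq_norm_sq_to_K, horth.1 i]
    simp
  set t := √κ with ht
  have htt : t * t = κ := Real.mul_self_sqrt hΦ.pos.le
  have ht0 : t ≠ 0 := (Real.sqrt_pos.2 hΦ.pos).ne'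
  have htC : (t : ℂ) ≠ 0 := Complex.ofReal_ne_zero.2 ht0
  have hin : ∀ i x, formInner g (Φ ((t : ℂ)⁻¹ • F i)).1 (Φ x).1 = t * ⟪J (F i), J x⟫_ℂ := by
    intro i x
    rw [hΦ.inner_eq, map_smul, inner_smul_left, map_inv₀, Complex.conj_ofReal, ← htt]
    push_cast
    field_simp
  refine ⟨fun i => Φ ((t : ℂ)⁻¹ • F i), fun i => mul_pos hC (h.pos i), fun i => ?_, fun i => ?_,
    fun i k hik => ?_, fun φ => ?_⟩
  · rw [hT', map_smul T, h'.eigen, smul_comm _ (lam i : ℂ), map_smul Φ, smul_smul]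
    push_cast
    rfl
  · rw [hin, map_smul, inner_smul_right, hself, mul_one, mul_inv_cancel₀ htC]
  · rw [hin, map_smul, inner_smul_right, h'.orth i k hik, mul_zero, mul_zero]
  · obtain ⟨x, rfl⟩ := Φ.surjective φ
    have hs := (h'.hasSum hT hB horth x).mul_left (κ * C ^ 2)
    have e1 : T' (Φ x) = Φ ((C : ℂ) • T x) := by rw [hT', map_smul]
    have e2 : ∀ i, ‖formInner g (Φ ((t : ℂ)⁻¹ • F i)).1 (Φ ((C : ℂ) • T x)).1‖ ^ 2 =
        κ * C ^ 2 * ‖⟪J (F i), J (T x)⟫_ℂ‖ ^ 2 := by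
      intro i
      rw [hin, map_smul, inner_smul_right, norm_mul, norm_mul, Complex.norm_real, Complex.norm_real,
        mul_pow, mul_pow, Real.norm_eq_abs, Real.norm_eq_abs, sq_abs, sq_abs, ← htt]
      ring
    have e3 : (formInner g (Φ ((C : ℂ) • T x)).1 (Φ ((C : ℂ) • T x)).1).re =
        κ * C ^ 2 * ‖J (T x)‖ ^ 2 := by
      have hn : ⟪J (T x), J (T x)⟫_ℂ = ((‖J (T x)‖ ^ 2 : ℝ) : ℂ) := by
        rw [inner_self_eq_norm_sq_to_K]
        norm_cast
      rw [hΦ.inner_eq, map_smul, inner_smul_left, inner_smul_right, hn, Complex.conj_ofReal, ← Complex.ofReal_re (κ * C ^ 2 * ‖J (T x)‖ ^ 2)]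
      congr 1
      push_cast
      ring
    simp only [e1, e2, e3]
    exact hs

/-- The operator between spaces of harmonic forms that corresponds to `c • d`. -/
def transfer {p q : ℕ} (Φ : X ≃ₗ[ℂ] Harm 𝓢(ℝ, ℂ) g p) (Ψ : Y ≃ₗ[ℂ] Harm 𝓢(ℝ, ℂ) g q)
    (d : X →ₗ[ℂ] Y) (c : ℂ) : Harm 𝓢(ℝ, ℂ) g p →ₗ[ℂ] Harm 𝓢(ℝ, ℂ) g q :=
  Ψ.toLinearMap ∘ₗ (c • d) ∘ₗ Φ.symm.toLinearMap

theorem transfer_apply {p q : ℕ} (Φ : X ≃ₗ[ℂ] Harm 𝓢(ℝ, ℂ) g p) (Ψ : Y ≃ₗ[ℂ] Harm 𝓢(ℝ, ℂ) g q)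
    (d : X →ₗ[ℂ] Y) (c : ℂ) (x : X) : transfer Φ Ψ d c (Φ x) = Ψ (c • d x) := by
  change Ψ (c • d (Φ.symm (Φ x))) = _
  rw [Φ.symm_apply_apply]

/-- The ratio κ'/κ compensates for the different scales of the two metrics. Consequently D*D is |c|²
κ'/κ times the model operator. -/
theorem isFormalAdjoint_transfer {p q : ℕ} {Φ : X ≃ₗ[ℂ] Harm 𝓢(ℝ, ℂ) g p}
    {Ψ : Y ≃ₗ[ℂ] Harm 𝓢(ℝ, ℂ) g q} {κ κ' : ℝ} (hΦ : IsHarmModel Φ J κ) (hΨ : IsHarmModel Ψ J' κ')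
    {d : X →ₗ[ℂ] Y} {d' : Y →ₗ[ℂ] X} (hd : ∀ x y, ⟪J' (d x), J' y⟫_ℂ = ⟪J x, J (d' y)⟫_ℂ) (c : ℂ) :
    IsFormalAdjoint g (transfer Φ Ψ d c)
      (transfer Ψ Φ d' (conj c * ((κ' / κ : ℝ) : ℂ))) := by
  intro σ τ
  obtain ⟨x, rfl⟩ := Φ.surjective σ
  obtain ⟨y, rfl⟩ := Ψ.surjective τ
  have hκ : (κ : ℂ) ≠ 0 := Complex.ofReal_ne_zero.2 hΦ.pos.ne'
  rw [transfer_apply, transfer_apply, hΦ.inner_eq, hΨ.inner_eq, map_smul, map_smul,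
    inner_smul_left, inner_smul_right, hd]
  push_cast
  field_simp

theorem transfer_transfer {p q : ℕ} (Φ : X ≃ₗ[ℂ] Harm 𝓢(ℝ, ℂ) g p)
    (Ψ : Y ≃ₗ[ℂ] Harm 𝓢(ℝ, ℂ) g q) (d : X →ₗ[ℂ] Y) (d' : Y →ₗ[ℂ] X) (c : ℂ) (t : ℝ) (x : X) :
    (transfer Ψ Φ d' (conj c * (t : ℂ)) ∘ₗ transfer Φ Ψ d c) (Φ x) =
      ((‖c‖ ^ 2 * t : ℝ) : ℂ) • Φ ((d' ∘ₗ d) x) := by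
  rw [LinearMap.comp_apply, transfer_apply, transfer_apply, map_smul Φ, map_smul d', map_smul Φ, smul_smul]
  congr 1
  push_cast
  rw [← Complex.conj_mul']
  ring

theorem inner_adjoint_symm {d : X →ₗ[ℂ] Y} {d' : Y →ₗ[ℂ] X}
    (hd : ∀ x y, ⟪J' (d x), J' y⟫_ℂ = ⟪J x, J (d' y)⟫_ℂ) (y : Y) (x : X) :
    ⟪J (d' y), J x⟫_ℂ = ⟪J' y, J' (d x)⟫_ℂ := by
  rw [← inner_conj_symm, ← hd, inner_conj_symm]

theorem exists_spectral_transfer [CompleteSpace K] {p q : ℕ} {Φ : X ≃ₗ[ℂ] Harm 𝓢(ℝ, ℂ) g p}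
    {Ψ : Y ≃ₗ[ℂ] Harm 𝓢(ℝ, ℂ) g q} {κ κ' : ℝ} (hΦ : IsHarmModel Φ J κ) (hΨ : IsHarmModel Ψ J' κ')
    (hJ : Function.Injective J) {d : X →ₗ[ℂ] Y} {d' : Y →ₗ[ℂ] X}
    (hd : ∀ x y, ⟪J' (d x), J' y⟫_ℂ = ⟪J x, J (d' y)⟫_ℂ) {B : Submodule ℂ X}
    (hB : ∀ r : K, (∀ b ∈ B, ⟪J b, r⟫_ℂ = 0) → r = 0) {ι : Type} {E : ι → X} {lam : ι → ℝ}
    (h : EigenSystem J (d' ∘ₗ d) B E lam) {c : ℂ} (hc : c ≠ 0) :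
    ∃ e, IsSpectralResolution g
      (transfer Ψ Φ d' (conj c * ((κ' / κ : ℝ) : ℂ)) ∘ₗ transfer Φ Ψ d c) e
      fun i => ‖c‖ ^ 2 * (κ' / κ) * lam i := by
  refine hΦ.exists_isSpectralResolution hJ (fun x y => ?_) hB h ?_
    (transfer_transfer Φ Ψ d d' c (κ' / κ))
  · rw [LinearMap.comp_apply, LinearMap.comp_apply, inner_adjoint_symm hd, hd]
  · have := norm_pos_iff.2 hc
    have := hΦ.pos
    have := hΨ.pos
    positivity

theorem hasRegDetSqrt_of_spectral {q : ℕ} {T : Harm 𝓢(ℝ, ℂ) g q →ₗ[ℂ] Harm 𝓢(ℝ, ℂ) g q} {ι : Type}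
    {lam : ι → ℝ} {C d : ℝ} (h : ∃ e, IsSpectralResolution g T e fun i => C * lam i)
    (hz : IsZetaDet lam d) (hlam : ∀ i, 0 < lam i) (hC : 0 < C) (hd : 0 < d) :
    HasRegDetSqrt g T d := by
  obtain ⟨e, he⟩ := h
  obtain ⟨ζ, h1, h2, h3, -, h5⟩ := hz.scale hlam hC
  exact ⟨ι, e, _, ζ, he, h1, h2, h3, hd, h5⟩

end transfer

section models

variable {g : LinearMap.BilinForm ℝ Lie235} {p r s k m κ ħ : ℝ} {α₀ α₁ : ℂ}

namespace IsBlockCogram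

variable (h : IsBlockCogram g p r s k m) (hc : α₀ * conj α₁ - conj α₀ * α₁ ≠ 0)

/-- The model of `𝓢 ⊗ H⁰(𝔤)`. -/
def modelZero : 𝓢(ℝ, ℂ) ≃ₗ[ℂ] Harm 𝓢(ℝ, ℂ) g 0 := h.harmZero.symm

/-- The model of `𝓢 ⊗ H¹(𝔤)`. -/
def modelOne : (𝓢(ℝ, ℂ) × 𝓢(ℝ, ℂ)) ≃ₗ[ℂ] Harm 𝓢(ℝ, ℂ) g 1 :=
  (pairFrame hc).trans h.harmOne.symm

/-- The model of `𝓢 ⊗ H²(𝔤)`. -/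
def modelTwo : (𝓢(ℝ, ℂ) × 𝓢(ℝ, ℂ) × 𝓢(ℝ, ℂ)) ≃ₗ[ℂ] Harm 𝓢(ℝ, ℂ) g 2 :=
  (symFrame hc).trans h.harmTwo.symm

/-- The model of `𝓢 ⊗ H³(𝔤)`. -/
def modelThree : (𝓢(ℝ, ℂ) × 𝓢(ℝ, ℂ) × 𝓢(ℝ, ℂ)) ≃ₗ[ℂ] Harm 𝓢(ℝ, ℂ) g 3 :=
  (flipSym.trans (symFrame hc)).trans h.harmThree.symm

/-- The model of `𝓢 ⊗ H⁴(𝔤)`. -/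
def modelFour : (𝓢(ℝ, ℂ) × 𝓢(ℝ, ℂ)) ≃ₗ[ℂ] Harm 𝓢(ℝ, ℂ) g 4 :=
  (flipPair.trans (pairFrame hc)).trans h.harmFour.symm

/-- The model of `𝓢 ⊗ H⁵(𝔤)`. -/
def modelFive : 𝓢(ℝ, ℂ) ≃ₗ[ℂ] Harm 𝓢(ℝ, ℂ) g 5 := h.harmFive.symm

theorem isHarmModel_zero : IsHarmModel h.modelZero schwartzToL2 1 where
  pos := one_pos
  inner_eq x y := by
    rw [h.formInner_zero, modelZero, LinearEquiv.apply_symm_apply, LinearEquiv.apply_symm_apply,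
      Complex.ofReal_one, one_mul]

theorem isHarmModel_one (hα : IsIsotropicFrame p r s κ ħ α₀ α₁) (hκ : 0 < κ) :
    IsHarmModel (h.modelOne hc) (J2 schwartzToL2) κ where
  pos := hκ
  inner_eq x y := by
    rw [h.formInner_one, modelOne, LinearEquiv.trans_apply, LinearEquiv.trans_apply,
      LinearEquiv.apply_symm_apply, LinearEquiv.apply_symm_apply, hα.blockInner_pairFrame hc]

theorem isHarmModel_two (hα : IsIsotropicFrame p r s κ ħ α₀ α₁) (hκ : 0 < κ) :
    IsHarmModel (h.modelTwo hc) (J3 schwartzToL2) (m * κ ^ 2) where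
  pos := mul_pos h.m_pos (pow_pos hκ 2)
  inner_eq x y := by
    rw [h.formInner_two, modelTwo, LinearEquiv.trans_apply, LinearEquiv.trans_apply,
      LinearEquiv.apply_symm_apply, LinearEquiv.apply_symm_apply, hα.blockInnerSym_symFrame hc]
    push_cast
    ring

theorem isHarmModel_three (hα : IsIsotropicFrame p r s κ ħ α₀ α₁) (hκ : 0 < κ) :
    IsHarmModel (h.modelThree hc) (J3 schwartzToL2) (k * m * κ ^ 2) where
  pos := mul_pos (mul_pos h.k_pos h.m_pos) (pow_pos hκ 2)
  inner_eq x y := by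
    rw [h.formInner_three, modelThree]
    simp only [LinearEquiv.trans_apply, LinearEquiv.apply_symm_apply]
    rw [hα.blockInnerSym_symFrame hc, inner_J3, inner_J3]
    obtain ⟨A, B, C⟩ := x
    obtain ⟨A', B', C'⟩ := y
    simp only [flipSym_apply, map_neg, inner_neg_neg]
    push_cast
    ring

theorem isHarmModel_four (hα : IsIsotropicFrame p r s κ ħ α₀ α₁) (hκ : 0 < κ) :
    IsHarmModel (h.modelFour hc) (J2 schwartzToL2) (k * m ^ 2 * (p * s - r ^ 2) * κ) where
  pos := mul_pos (mul_pos (mul_pos h.k_pos (pow_pos h.m_pos 2)) h.det_pos) hκ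
  inner_eq x y := by
    rw [h.formInner_four, modelFour]
    simp only [LinearEquiv.trans_apply, LinearEquiv.apply_symm_apply]
    rw [hα.blockInner_pairFrame hc, inner_J2, inner_J2]
    obtain ⟨A, B⟩ := x
    obtain ⟨A', B'⟩ := y
    simp only [flipPair_apply, map_neg, inner_neg_neg]
    push_cast
    ring

theorem isHarmModel_five :
    IsHarmModel h.modelFive schwartzToL2 (k * m ^ 2 * (p * s - r ^ 2) ^ 2) where
  pos := mul_pos (mul_pos h.k_pos (pow_pos h.m_pos 2)) (pow_pos h.det_pos 2)
  inner_eq x y := by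
    rw [h.formInner_five, modelFive, LinearEquiv.apply_symm_apply, LinearEquiv.apply_symm_apply]
    push_cast
    ring

variable {a ad : 𝓢(ℝ, ℂ) →ₗ[ℂ] 𝓢(ℝ, ℂ)} {ρ : Fin 5 → 𝓢(ℝ, ℂ) →ₗ[ℂ] 𝓢(ℝ, ℂ)}

theorem rumin_zero (hl : IsLadder ρ a ad α₀ α₁ (conj α₀) (conj α₁)) :
    IsRuminDifferential ρ g 0 (transfer h.modelZero (h.modelOne hl.ne) (d0 a ad) 1) := by
  refine h.isRuminDifferential_zero hl.isHeisenbergRep fun σ => ?_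
  obtain ⟨x, rfl⟩ := h.modelZero.surjective σ
  rw [transfer_apply, modelOne, LinearEquiv.trans_apply, LinearEquiv.apply_symm_apply, one_smul,
    hl.pairFrame_d0, modelZero, LinearEquiv.apply_symm_apply]

theorem rumin_one (hl : IsLadder ρ a ad α₀ α₁ (conj α₀) (conj α₁)) :
    IsRuminDifferential ρ g 1 (transfer (h.modelOne hl.ne) (h.modelTwo hl.ne) (d1 a ad)
      (α₀ * conj α₁ - conj α₀ * α₁)) := by
  refine h.isRuminDifferential_one hl.isHeisenbergRep fun σ u v hσ w hw => ?_
  obtain ⟨x, rfl⟩ := (h.modelOne hl.ne).surjective σ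
  rw [modelOne, LinearEquiv.trans_apply, LinearEquiv.apply_symm_apply] at hσ
  rw [transfer_apply, modelTwo, LinearEquiv.trans_apply, LinearEquiv.apply_symm_apply]
  exact hl.symFrame_d1 hσ hw

theorem rumin_two (hl : IsLadder ρ a ad α₀ α₁ (conj α₀) (conj α₁)) :
    IsRuminDifferential ρ g 2 (transfer (h.modelTwo hl.ne) (h.modelThree hl.ne) (d2 a ad)
      (α₀ * conj α₁ - conj α₀ * α₁)) := by
  refine h.isRuminDifferential_two hl.isHeisenbergRep fun σ A B C hσ u v hu hv => ?_
  obtain ⟨x, rfl⟩ := (h.modelTwo hl.ne).surjective σ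
  rw [modelTwo, LinearEquiv.trans_apply, LinearEquiv.apply_symm_apply] at hσ
  rw [transfer_apply, modelThree, LinearEquiv.trans_apply, LinearEquiv.apply_symm_apply,
    LinearEquiv.trans_apply, map_smul flipSym]
  exact hl.symFrame_d2 hσ hu hv

theorem rumin_three (hl : IsLadder ρ a ad α₀ α₁ (conj α₀) (conj α₁)) :
    IsRuminDifferential ρ g 3 (transfer (h.modelThree hl.ne) (h.modelFour hl.ne) (d1' a ad)
      ((α₀ * conj α₁ - conj α₀ * α₁) ^ 2)) := by
  refine h.isRuminDifferential_three hl.isHeisenbergRep fun σ A B C hσ u v w hu hv hw => ?_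
  obtain ⟨x, rfl⟩ := (h.modelThree hl.ne).surjective σ
  rw [modelThree, LinearEquiv.trans_apply, LinearEquiv.apply_symm_apply,
    LinearEquiv.trans_apply] at hσ
  rw [transfer_apply, modelFour, LinearEquiv.trans_apply, LinearEquiv.apply_symm_apply,
    LinearEquiv.trans_apply, map_smul flipPair, ← hl.pairFrame_d1' hσ hu hv hw, flipSym_flipSym]

theorem rumin_four (hl : IsLadder ρ a ad α₀ α₁ (conj α₀) (conj α₁)) :
    IsRuminDifferential ρ g 4 (transfer (h.modelFour hl.ne) h.modelFive (d0' a ad)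
      (α₀ * conj α₁ - conj α₀ * α₁)) := by
  refine h.isRuminDifferential_four hl.isHeisenbergRep fun σ u v hσ => ?_
  obtain ⟨x, rfl⟩ := (h.modelFour hl.ne).surjective σ
  rw [modelFour, LinearEquiv.trans_apply, LinearEquiv.apply_symm_apply,
    LinearEquiv.trans_apply] at hσ
  rw [transfer_apply, modelFive, LinearEquiv.apply_symm_apply, ← hl.smul_d0' hσ,
    flipPair_flipPair]

end IsBlockCogram

end models

end

/-! ### Assembly of the differentials, spectra and determinants. -/

noncomputable section

open scoped ComplexConjugate SchwartzMap InnerProductSpace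
open Lie235 IsBlockCogram Oscillator

section differentials

variable {g : LinearMap.BilinForm ℝ Lie235} {p r s k m κ ħ : ℝ} {α₀ α₁ : ℂ}
  {a ad : 𝓢(ℝ, ℂ) →ₗ[ℂ] 𝓢(ℝ, ℂ)} {H : ℕ → 𝓢(ℝ, ℂ)}

/-- The factor by which the model `d0`, `d1`, `d2`, `d1'`, `d0'` of the Rumin differential has to be
multiplied. -/
def ruminFactor (α₀ α₁ : ℂ) : Fin 5 → ℂ :=
  ![1, α₀ * conj α₁ - conj α₀ * α₁, α₀ * conj α₁ - conj α₀ * α₁,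
    (α₀ * conj α₁ - conj α₀ * α₁) ^ 2, α₀ * conj α₁ - conj α₀ * α₁]

/-- The factor by which the metric on harmonic forms differs from that of the model. -/
def metricFactor (p r s k m κ : ℝ) : Fin 6 → ℝ :=
  ![1, κ, m * κ ^ 2, k * m * κ ^ 2, k * m ^ 2 * (p * s - r ^ 2) * κ,
    k * m ^ 2 * (p * s - r ^ 2) ^ 2]

namespace IsBlockCogram

variable (h : IsBlockCogram g p r s k m) (hc : α₀ * conj α₁ - conj α₀ * α₁ ≠ 0)
  (a ad : 𝓢(ℝ, ℂ) →ₗ[ℂ] 𝓢(ℝ, ℂ))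

/-- The Rumin differentials. -/
def rumin : ∀ q : Fin 5, Harm (SchwartzMap ℝ ℂ) g (q : ℕ) →ₗ[ℂ]
    Harm (SchwartzMap ℝ ℂ) g ((q : ℕ) + 1)
  | ⟨0, _⟩ => transfer h.modelZero (h.modelOne hc) (d0 a ad) (ruminFactor α₀ α₁ 0)
  | ⟨1, _⟩ => transfer (h.modelOne hc) (h.modelTwo hc) (d1 a ad) (ruminFactor α₀ α₁ 1)
  | ⟨2, _⟩ => transfer (h.modelTwo hc) (h.modelThree hc) (d2 a ad) (ruminFactor α₀ α₁ 2)
  | ⟨3, _⟩ => transfer (h.modelThree hc) (h.modelFour hc) (d1' a ad) (ruminFactor α₀ α₁ 3)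
  | ⟨4, _⟩ => transfer (h.modelFour hc) h.modelFive (d0' a ad) (ruminFactor α₀ α₁ 4)

/-- The constant in the formal adjoint of the Rumin differential. -/
def adjointFactor (p r s k m κ : ℝ) (α₀ α₁ : ℂ) (q : Fin 5) : ℂ :=
  conj (ruminFactor α₀ α₁ q) *
    ((metricFactor p r s k m κ q.succ / metricFactor p r s k m κ q.castSucc : ℝ) : ℂ)

/-- The formal adjoints of the Rumin differentials. -/
def ruminAdjoint (κ : ℝ) : ∀ q : Fin 5, Harm (SchwartzMap ℝ ℂ) g ((q : ℕ) + 1) →ₗ[ℂ]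
    Harm (SchwartzMap ℝ ℂ) g (q : ℕ)
  | ⟨0, _⟩ => transfer (h.modelOne hc) h.modelZero (d0' a ad) (adjointFactor p r s k m κ α₀ α₁ 0)
  | ⟨1, _⟩ => transfer (h.modelTwo hc) (h.modelOne hc) (d1' a ad)
      (adjointFactor p r s k m κ α₀ α₁ 1)
  | ⟨2, _⟩ => transfer (h.modelThree hc) (h.modelTwo hc) (d2 a ad)
      (adjointFactor p r s k m κ α₀ α₁ 2)
  | ⟨3, _⟩ => transfer (h.modelFour hc) (h.modelThree hc) (d1 a ad)
      (adjointFactor p r s k m κ α₀ α₁ 3)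
  | ⟨4, _⟩ => transfer h.modelFive (h.modelFour hc) (d0 a ad)
      (adjointFactor p r s k m κ α₀ α₁ 4)

/-- The factor by which the eigenvalues of the Rumin Laplacians differ from those of the model. -/
def eigenFactor (p r s k m κ : ℝ) (α₀ α₁ : ℂ) (q : Fin 5) : ℝ :=
  ‖ruminFactor α₀ α₁ q‖ ^ 2 *
    (metricFactor p r s k m κ q.succ / metricFactor p r s k m κ q.castSucc)

variable {a ad hc}

theorem isRuminDifferential_rumin {ρ : Fin 5 → 𝓢(ℝ, ℂ) →ₗ[ℂ] 𝓢(ℝ, ℂ)}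
    (hl : IsLadder ρ a ad α₀ α₁ (conj α₀) (conj α₁)) (q : Fin 5) :
    IsRuminDifferential ρ g (q : ℕ) (h.rumin hl.ne a ad q) := by
  fin_cases q
  · exact h.rumin_zero hl
  · exact h.rumin_one hl
  · exact h.rumin_two hl
  · exact h.rumin_three hl
  · exact h.rumin_four hl

theorem isFormalAdjoint_rumin (hα : IsIsotropicFrame p r s κ ħ α₀ α₁) (hκ : 0 < κ)
    (ho : Oscillator schwartzToL2 a ad H) (q : Fin 5) :
    IsFormalAdjoint g (h.rumin hc a ad q) (h.ruminAdjoint hc a ad κ q) := by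
  fin_cases q
  · exact isFormalAdjoint_transfer h.isHarmModel_zero (h.isHarmModel_one hc hα hκ)
      ho.d0_adj _
  · exact isFormalAdjoint_transfer (h.isHarmModel_one hc hα hκ)
      (h.isHarmModel_two hc hα hκ) ho.d1_adj _
  · exact isFormalAdjoint_transfer (h.isHarmModel_two hc hα hκ)
      (h.isHarmModel_three hc hα hκ) ho.d2_adj _
  · exact isFormalAdjoint_transfer (h.isHarmModel_three hc hα hκ)
      (h.isHarmModel_four hc hα hκ) (inner_adjoint_symm ho.d1_adj) _
  · exact isFormalAdjoint_transfer (h.isHarmModel_four hc hα hκ) h.isHarmModel_five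
      (inner_adjoint_symm ho.d0_adj) _

theorem exists_spectral_zero (hα : IsIsotropicFrame p r s κ ħ α₀ α₁) (hκ : 0 < κ)
    (ho : Oscillator schwartzToL2 a ad H) :
    ∃ e, IsSpectralResolution g (h.ruminAdjoint hc a ad κ 0 ∘ₗ h.rumin hc a ad 0) e
      fun i => eigenFactor p r s k m κ α₀ α₁ 0 * oddN i :=
  exists_spectral_transfer h.isHarmModel_zero (h.isHarmModel_one hc hα hκ) ho.inj ho.d0_adj
    ho.total1 (eigenSystem_d0 ho) one_ne_zero

theorem exists_spectral_one (hα : IsIsotropicFrame p r s κ ħ α₀ α₁) (hκ : 0 < κ)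
    (ho : Oscillator schwartzToL2 a ad H) :
    ∃ e, IsSpectralResolution g (h.ruminAdjoint hc a ad κ 1 ∘ₗ h.rumin hc a ad 1) e
      fun i => eigenFactor p r s k m κ α₀ α₁ 1 * cubicEigen i :=
  exists_spectral_transfer (h.isHarmModel_one hc hα hκ) (h.isHarmModel_two hc hα hκ)
    (J2_injective ho.inj) ho.d1_adj ho.total2 (eigenSystem_d1 ho) hc

theorem exists_spectral_two (hα : IsIsotropicFrame p r s κ ħ α₀ α₁) (hκ : 0 < κ)
    (ho : Oscillator schwartzToL2 a ad H) :
    ∃ e, IsSpectralResolution g (h.ruminAdjoint hc a ad κ 2 ∘ₗ h.rumin hc a ad 2) e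
      fun i => eigenFactor p r s k m κ α₀ α₁ 2 * quadEigen i :=
  exists_spectral_transfer (h.isHarmModel_two hc hα hκ) (h.isHarmModel_three hc hα hκ)
    (J3_injective ho.inj) ho.d2_adj ho.total3 (eigenSystem_d2 ho) hc

theorem exists_spectral_three (hα : IsIsotropicFrame p r s κ ħ α₀ α₁) (hκ : 0 < κ)
    (ho : Oscillator schwartzToL2 a ad H) :
    ∃ e, IsSpectralResolution g (h.ruminAdjoint hc a ad κ 3 ∘ₗ h.rumin hc a ad 3) e
      fun i => eigenFactor p r s k m κ α₀ α₁ 3 * cubicEigen i :=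
  exists_spectral_transfer (h.isHarmModel_three hc hα hκ) (h.isHarmModel_four hc hα hκ)
    (J3_injective ho.inj) (inner_adjoint_symm ho.d1_adj) ho.total3
    ((eigenSystem_d1 ho).dual (J2_injective ho.inj) (J3_injective ho.inj) ho.d1_adj ho.d1'_mem)
    (pow_ne_zero 2 hc)

theorem exists_spectral_four (hα : IsIsotropicFrame p r s κ ħ α₀ α₁) (hκ : 0 < κ)
    (ho : Oscillator schwartzToL2 a ad H) :
    ∃ e, IsSpectralResolution g (h.ruminAdjoint hc a ad κ 4 ∘ₗ h.rumin hc a ad 4) e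
      fun i => eigenFactor p r s k m κ α₀ α₁ 4 * oddN i :=
  exists_spectral_transfer (h.isHarmModel_four hc hα hκ) h.isHarmModel_five
    (J2_injective ho.inj) (inner_adjoint_symm ho.d0_adj) ho.total2
    ((eigenSystem_d0 ho).dual ho.inj (J2_injective ho.inj) ho.d0_adj ho.d0'_mem) hc

theorem eigenFactor_pos (h : IsBlockCogram g p r s k m)
    (hc : α₀ * conj α₁ - conj α₀ * α₁ ≠ 0)
    (hκ : 0 < κ) (q : Fin 5) : 0 < eigenFactor p r s k m κ α₀ α₁ q := by
  have hf : ruminFactor α₀ α₁ q ≠ 0 := by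
    have h2 := pow_ne_zero 2 hc
    fin_cases q <;> first | exact one_ne_zero | exact hc | exact h2
  have hm : ∀ i, 0 < metricFactor p r s k m κ i := by
    have h2 := mul_pos h.m_pos (pow_pos hκ 2)
    have h3 := mul_pos (mul_pos h.k_pos h.m_pos) (pow_pos hκ 2)
    have h4 := mul_pos (mul_pos (mul_pos h.k_pos (pow_pos h.m_pos 2)) h.det_pos) hκ
    have h5 := mul_pos (mul_pos h.k_pos (pow_pos h.m_pos 2)) (pow_pos h.det_pos 2)
    intro i
    fin_cases i
    · exact one_pos
    · exact hκ
    · exact h2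
    · exact h3
    · exact h4
    · exact h5
  exact mul_pos (pow_pos (norm_pos_iff.2 hf) 2) (div_pos (hm _) (hm _))

/-- The regularized determinants of the Rumin differentials. -/
def ruminDet : Fin 5 → ℝ :=
  ![(2 : ℝ) ^ (1 / 4 : ℝ), (2 : ℝ) ^ (3 / 4 : ℝ) * √(Real.sin (Real.pi * ((√2 - 1) / 2))),
    2 * Real.sin (Real.pi * ((√2 - 1) / 2)),
    (2 : ℝ) ^ (3 / 4 : ℝ) * √(Real.sin (Real.pi * ((√2 - 1) / 2))), (2 : ℝ) ^ (1 / 4 : ℝ)]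

theorem ruminDet_pos (q : Fin 5) : 0 < ruminDet q := by
  have h0 : (0 : ℝ) < 2 ^ (1 / 4 : ℝ) := Real.rpow_pos_of_pos two_pos _
  have h1 := mul_pos (Real.rpow_pos_of_pos two_pos (3 / 4 : ℝ)) (Real.sqrt_pos.2 sin_pos_value)
  have h2 := mul_pos two_pos sin_pos_value
  fin_cases q
  · exact h0
  · exact h1
  · exact h2
  · exact h1
  · exact h0

theorem torsion_ruminDet : torsion ruminDet = 1 := by
  have h1 := sin_pos_value
  have h2 := Real.mul_self_sqrt h1.le
  have h3 : (2 : ℝ) ^ (1 / 4 : ℝ) * (2 : ℝ) ^ (1 / 4 : ℝ) * 2 =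
      (2 : ℝ) ^ (3 / 4 : ℝ) * (2 : ℝ) ^ (3 / 4 : ℝ) := by
    rw [← Real.rpow_add two_pos, ← Real.rpow_add two_pos, ← Real.rpow_add_one two_ne_zero]
    norm_num
  have h4 : ruminDet 1 * ruminDet 3 ≠ 0 := (mul_pos (ruminDet_pos 1) (ruminDet_pos 3)).ne'
  rw [torsion, div_eq_one_iff_eq h4]
  change (2 : ℝ) ^ (1 / 4 : ℝ) * (2 * Real.sin (Real.pi * ((√2 - 1) / 2))) *
    (2 : ℝ) ^ (1 / 4 : ℝ) = ((2 : ℝ) ^ (3 / 4 : ℝ) * √(Real.sin (Real.pi * ((√2 - 1) / 2)))) *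
    ((2 : ℝ) ^ (3 / 4 : ℝ) * √(Real.sin (Real.pi * ((√2 - 1) / 2))))
  linear_combination Real.sin (Real.pi * ((√2 - 1) / 2)) * h3 -
    (2 : ℝ) ^ (3 / 4 : ℝ) * (2 : ℝ) ^ (3 / 4 : ℝ) * h2

theorem hasRegDetSqrt_rumin (hα : IsIsotropicFrame p r s κ ħ α₀ α₁) (hκ : 0 < κ)
    (ho : Oscillator schwartzToL2 a ad H) (q : Fin 5) :
    HasRegDetSqrt g (h.ruminAdjoint hc a ad κ q ∘ₗ h.rumin hc a ad q) (ruminDet q) := by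
  have hp := h.eigenFactor_pos hc hκ
  fin_cases q
  · exact hasRegDetSqrt_of_spectral (h.exists_spectral_zero hα hκ ho) isZetaDet_linear
      oddN_pos (hp 0) (ruminDet_pos 0)
  · exact hasRegDetSqrt_of_spectral (h.exists_spectral_one hα hκ ho) isZetaDet_cubic
      cubicEigen_pos (hp 1) (ruminDet_pos 1)
  · exact hasRegDetSqrt_of_spectral (h.exists_spectral_two hα hκ ho) isZetaDet_quad
      (eigenSystem_d2 ho).pos (hp 2) (ruminDet_pos 2)
  · exact hasRegDetSqrt_of_spectral (h.exists_spectral_three hα hκ ho) isZetaDet_cubic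
      cubicEigen_pos (hp 3) (ruminDet_pos 3)
  · exact hasRegDetSqrt_of_spectral (h.exists_spectral_four hα hκ ho) isZetaDet_linear
      oddN_pos (hp 4) (ruminDet_pos 4)

/-- All five constants can be read off from the inverse Gram matrix. This pins them down when the
basis is orthonormal. -/
theorem ext_coeff {p' r' s' k' m' : ℝ} (h : IsBlockCogram g p r s k m)
    (h' : IsBlockCogram g p' r' s' k' m') :
    p = p' ∧ r = r' ∧ s = s' ∧ k = k' ∧ m = m' := by
  have e := h.inv_eq.symm.trans h'.inv_eq
  have hp : p = p' := congrFun (congrFun e 0) 0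
  have hm : m * p = m' * p' := congrFun (congrFun e 3) 3
  refine ⟨hp, congrFun (congrFun e 0) 1, congrFun (congrFun e 1) 1, congrFun (congrFun e 2) 2, ?_⟩
  rw [← hp] at hm
  exact mul_right_cancel₀ h.p_pos.ne' hm

end IsBlockCogram

end differentials

theorem theorem2p3 (g : LinearMap.BilinForm ℝ Lie235) (hg : IsGradedEuclidean g)
    (b : LinearMap.BilinForm ℝ (Lie235.gr 1))
    (hb : ∀ (x y : Lie235.gr 1) (z : Lie235.gr 2),
      g ⁅(x : Lie235), (z : Lie235)⁆ ⁅(y : Lie235), (z : Lie235)⁆ =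
        g (z : Lie235) (z : Lie235) * b x y)
    (hprop : ∃ c : ℝ, ∀ x y : Lie235.gr 1, b x y = c * g (x : Lie235) (y : Lie235))
    (ħ : ℝ) (hħ : ħ ≠ 0) :
    ∃ (D : ∀ q : Fin 5, Harm (SchwartzMap ℝ ℂ) g (q : ℕ) →ₗ[ℂ]
          Harm (SchwartzMap ℝ ℂ) g ((q : ℕ) + 1))
      (D' : ∀ q : Fin 5, Harm (SchwartzMap ℝ ℂ) g ((q : ℕ) + 1) →ₗ[ℂ]
          Harm (SchwartzMap ℝ ℂ) g (q : ℕ))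
      (d : Fin 5 → ℝ),
      (∀ q : Fin 5, IsRuminDifferential (schrodinger ħ) g (q : ℕ) (D q)) ∧
      (∀ q : Fin 5, IsFormalAdjoint g (D q) (D' q)) ∧
      (∀ q : Fin 5, HasRegDetSqrt g (D' q ∘ₗ D q) (d q)) ∧
      d 0 = (2 : ℝ) ^ (1 / 4 : ℝ) ∧
      d 4 = (2 : ℝ) ^ (1 / 4 : ℝ) ∧
      d 1 = (2 : ℝ) ^ (3 / 4 : ℝ) * √(Real.sin (Real.pi * ((√2 - 1) / 2))) ∧
      d 3 = (2 : ℝ) ^ (3 / 4 : ℝ) * √(Real.sin (Real.pi * ((√2 - 1) / 2))) ∧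
      d 2 = 2 * Real.sin (Real.pi * ((√2 - 1) / 2)) ∧
      torsion d = 1 ∧
      ((∀ i j, g (Lie235.X i) (Lie235.X j) = if i = j then 1 else 0) →
        (∃ e : ℕ → Harm (SchwartzMap ℝ ℂ) g 1,
          IsSpectralResolution g (D' 1 ∘ₗ D 1) e
            (fun n => |ħ| ^ 3 * (2 * (n : ℝ) + 1) * |(2 * (n : ℝ) + 1) ^ 2 - 2|)) ∧
        (∃ e : ℕ ⊕ ℕ → Harm (SchwartzMap ℝ ℂ) g 2,
          IsSpectralResolution g (D' 2 ∘ₗ D 2) e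
            (Sum.elim
              (fun n => ħ ^ 2 * ((√(8 * (2 * (n : ℝ) + 1) ^ 2 + 9) + 5) / 4) ^ 2)
              (fun n => ħ ^ 2 * ((√(8 * (2 * (n : ℝ) + 1) ^ 2 + 9) - 5) / 4) ^ 2)))) := by
  obtain ⟨p, r, s, k, m, h⟩ := exists_isBlockCogram hg hb hprop
  obtain ⟨α₀, α₁, hα⟩ := exists_isIsotropicFrame h.p_pos h.det_pos hħ
  have hκ : 0 < |ħ| * √(p * s - r ^ 2) :=
    mul_pos (abs_pos.2 hħ) (Real.sqrt_pos.2 h.det_pos)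
  have hl := hα.isLadder hħ
  have ho := schrodinger_oscillator hħ hα.area
  refine ⟨h.rumin hl.ne _ _, h.ruminAdjoint hl.ne _ _ (|ħ| * √(p * s - r ^ 2)), ruminDet,
    h.isRuminDifferential_rumin hl, h.isFormalAdjoint_rumin hα hκ ho,
    h.hasRegDetSqrt_rumin hα hκ ho, rfl, rfl, rfl, rfl, rfl, torsion_ruminDet, fun hX => ?_⟩
  obtain ⟨rfl, rfl, rfl, rfl, rfl⟩ := h.ext_coeff (isBlockCogram_of_orthonormal hX)
  have hn : ‖α₀ * conj α₁ - conj α₀ * α₁‖ = |ħ| := by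
    rw [hα.area, norm_mul, Complex.norm_I, one_mul, Complex.norm_real, Real.norm_eq_abs]
  have hħ' : |ħ| ≠ 0 := abs_ne_zero.2 hħ
  have hd : √((1 : ℝ) * 1 - 0 ^ 2) = 1 := by norm_num
  -- The squared area contributes ħ², and the metrics in degrees 2 and 1 have ratio κ²/κ = κ = |ħ|.
  have f1 : eigenFactor 1 0 1 1 1 (|ħ| * √((1 : ℝ) * 1 - 0 ^ 2)) α₀ α₁ 1 = |ħ| ^ 3 := by
    change ‖α₀ * conj α₁ - conj α₀ * α₁‖ ^ 2 *
      (1 * (|ħ| * √((1 : ℝ) * 1 - 0 ^ 2)) ^ 2 / (|ħ| * √((1 : ℝ) * 1 - 0 ^ 2))) = _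
    rw [hn, hd]
    field_simp
  -- Degrees 2 and 3 carry the same power of κ, so only the squared area remains.
  have f2 : eigenFactor 1 0 1 1 1 (|ħ| * √((1 : ℝ) * 1 - 0 ^ 2)) α₀ α₁ 2 = ħ ^ 2 := by
    change ‖α₀ * conj α₁ - conj α₀ * α₁‖ ^ 2 *
      (1 * 1 * (|ħ| * √((1 : ℝ) * 1 - 0 ^ 2)) ^ 2 / (1 * (|ħ| * √((1 : ℝ) * 1 - 0 ^ 2)) ^ 2)) = _
    rw [hn, hd, ← sq_abs ħ]
    field_simp
  have e1 := h.exists_spectral_one (hc := hl.ne) hα hκ ho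
  have e2 := h.exists_spectral_two (hc := hl.ne) hα hκ ho
  have g1 : (fun n : ℕ => |ħ| ^ 3 * (2 * (n : ℝ) + 1) * |(2 * (n : ℝ) + 1) ^ 2 - 2|) =
      fun n => |ħ| ^ 3 * cubicEigen n := funext fun n => mul_assoc _ _ _
  have g2 : Sum.elim (fun n : ℕ => ħ ^ 2 * ((√(8 * (2 * (n : ℝ) + 1) ^ 2 + 9) + 5) / 4) ^ 2)
      (fun n : ℕ => ħ ^ 2 * ((√(8 * (2 * (n : ℝ) + 1) ^ 2 + 9) - 5) / 4) ^ 2) =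
      fun i => ħ ^ 2 * quadEigen i := by
    funext i
    rcases i with i | i <;> rfl
  rw [f1, ← g1] at e1
  rw [f2, ← g2] at e2
  exact ⟨e1, e2⟩
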